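/- Let $W_2\in\mathbb R^{m\times h}$, $W_1\in\mathbb R^{h\times n}$, $Y_{\rm pre}=W_2W_1$, and $Y_{\rm ft}\in\mathbb R^{m\times n}$. Assume that there are orthogonal matrices $U,G,V$ and rectangular diagonal matrices $\Sigma_{W_2},\Sigma_{W_1},\Sigma_{\Delta}$ with non-negative entries such that $W_2=U\Sigma_{W_2}G^\top$, $W_1=G\Sigma_{W_1}V^\top$ and $\Delta Y:=Y_{\rm ft}-Y_{\rm pre}=U\Sigma_{\Delta}V^\top$. Assume that $\Delta Y=\sigma uv^\top$ has rank one, where $\sigma>0$ and $u,g,v$ are unit vectors with $W_2g=\sigma_{W_2}u$, $W_2^\top u=\sigma_{W_2}g$, $W_1v=\sigma_{W_1}g$, $W_1^\top g=\sigma_{W_1}v$, $\sigma_{W_2}>0$, $\sigma_{W_1}\ge 0$, and that $\delta_w:=\sigma_{W_1}/\sigma_{W_2}<1$. For a rank $r\ge1$, let $(A_1,B_1,A_2,B_2)(t)$, $t\ge 0$, with $A_1\in\mathbb R^{r\times n}$, $B_1\in\mathbb R^{h\times r}$, $A_2\in\mathbb R^{r\times h}$, $B_2\in\mathbb R^{m\times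 r}$, be the gradient flow of $$L(A_1,A_2,B_1,B_2)=\tfrac12\lVert Y_{\rm ft}-(W_2+B_2A_2)(W_1+B_1A_1)\rVert_F^2$$ started at $A_i(0)=\alpha X_i$, $B_i(0)=0$, where $X_1,X_2$ are independent and have i.i.d. $\mathcal N(0,1)$ entries (so that the entries of $A_i(0)$ are i.i.d. $\mathcal N(0,\alpha^2)$). Put $Z_i=\begin{pmatrix}B_i\\A_i^\top\end{pmatrix}$ and $\gamma_1=\begin{pmatrix}g\\v\end{pmatrix}$, let $\lVert\cdot\rVert$ be the spectral norm, $z_{\max}=\frac1\alpha\max(\lVert Z_1(0)\rVert_F,\lVert Z_2(0)\rVert_F)$, and $$\hat T_1=\frac{2}{(5-\delta_w)\sigma\sigma_{W_2}}\log\frac{1}{\alpha z_{\max}^2\bigl(\lVert\Delta Y\rVert+\lVert W_1\rVert^2+\lVert W_1\rVert\lVert W_2\rVert+\lVert W_2\rVert^2+\sqrt{\lVert W_1\rVert+\lVert W_2\rVert}\bigr)},$$ $$\tilde T_1=\frac{2}{(1+\delta_w)\sigma\sigma_{W_2}}\log\Bigl(1+\frac{(1-\delta_w^2)\sigma^2}{4\alpha^2z_{\max}^2}\Bigr).$$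 The end $T_1$ of the alignment phase is the first time $t\ge 0$ at which $g^\top B_1(t)A_1(t)v\ge\frac{(1-\delta_w)\sigma}{4\sigma_{W_2}}$. Then there are constants $c_4,c_5>0$, independent of $\alpha$ and of the initialization, such that for every $\eta>0$ there are $\alpha^*>0$ and an event for $(X_1,X_2)$ of probability at least $1-\eta$ on which the following holds for all $0<\alpha\le\alpha^*$: the time $T_1$ exists, $\hat T_1\le T_1\le\hat T_1+\tilde T_1$, and 1. (good alignment) every unit top left singular vector $U^S_{Z_1}(T_1)$ of $Z_1(T_1)$ satisfies $\cos^2\bigl(U^S_{Z_1}(T_1),\gamma_1\bigr)\ge 1-c_4\,\alpha^{\frac{1+\delta_w}{3+\delta_w}}$; 2. (sufficient imbalance) $Z_2(T_1)\ne0$ and $\dfrac{\lVert Z_1(T_1)\rVert^2}{\lVert Z_2(T_1)\rVert^2}\ge c_5\,\alpha^{-\frac{4(1-\delta_w)}{5-\delta_w}}$. -/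

import Mathlib

open scoped Matrix

noncomputable section

/-- A rectangular diagonal matrix with non-negative diagonal entries: the middle factor of a full
singular value decomposition. -/
def IsSVDDiag {p q : ℕ} (S : Matrix (Fin p) (Fin q) ℝ) : Prop :=
  (∀ (i : Fin p) (j : Fin q), (i : ℕ) ≠ (j : ℕ) → S i j = 0) ∧ ∀ i j, 0 ≤ S i j

/-- The standing assumptions on the pre-trained weights and on the two targets: `W₂ W₁` factorizes
`Ypre` exactly, `W₂ = U S₂ Gᵀ` and `W₁ = G S₁ Vᵀ` with `U`, `G`, `V` orthogonal, and
`Yft - Ypre = U SΔ Vᵀ` with the same `U` and `V`. -/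
def AlignedTask {m h n : ℕ} (W₂ : Matrix (Fin m) (Fin h) ℝ) (W₁ : Matrix (Fin h) (Fin n) ℝ)
    (Ypre Yft : Matrix (Fin m) (Fin n) ℝ) : Prop :=
  Ypre = W₂ * W₁ ∧
  ∃ U ∈ Matrix.orthogonalGroup (Fin m) ℝ, ∃ G ∈ Matrix.orthogonalGroup (Fin h) ℝ,
  ∃ V ∈ Matrix.orthogonalGroup (Fin n) ℝ,
  ∃ (S₂ : Matrix (Fin m) (Fin h) ℝ) (S₁ : Matrix (Fin h) (Fin n) ℝ)
    (SΔ : Matrix (Fin m) (Fin n) ℝ),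
    IsSVDDiag S₂ ∧ IsSVDDiag S₁ ∧ IsSVDDiag SΔ ∧
    W₂ = U * S₂ * Gᵀ ∧ W₁ = G * S₁ * Vᵀ ∧ Yft - Ypre = U * SΔ * Vᵀ

/-- `s` is a singular value of `M` with unit left singular vector `a` and unit right singular
vector `b`. -/
def IsSingularTriple {ι κ : Type*} [Fintype ι] [Fintype κ] (M : Matrix ι κ ℝ) (s : ℝ)
    (a : ι → ℝ) (b : κ → ℝ) : Prop :=
  0 ≤ s ∧ a ⬝ᵥ a = 1 ∧ b ⬝ᵥ b = 1 ∧ M *ᵥ b = s • a ∧ Mᵀ *ᵥ a = s • b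

open scoped Matrix.Norms.L2Operator in
/-- The spectral norm (operator norm between Euclidean spaces). -/
def specNorm {ι κ : Type*} [Fintype ι] [Fintype κ] [DecidableEq κ] (M : Matrix ι κ ℝ) : ℝ := ‖M‖

/-- The Frobenius norm. -/
def frobNorm {ι κ : Type*} [Fintype ι] [Fintype κ] (M : Matrix ι κ ℝ) : ℝ :=
  Real.sqrt (∑ i, ∑ j, M i j ^ 2)

/-- `a` is a (unit) left singular vector of `M` for its largest singular value. -/
def IsTopLeftSingularVector {ι κ : Type*} [Fintype ι] [Fintype κ] [DecidableEq κ]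
    (M : Matrix ι κ ℝ) (a : ι → ℝ) : Prop :=
  ∃ b : κ → ℝ, IsSingularTriple M (specNorm M) a b

/-- The squared cosine of the Euclidean angle between two vectors. -/
def cosSq {ι : Type*} [Fintype ι] (a b : ι → ℝ) : ℝ :=
  Real.cos (InnerProductGeometry.angle (WithLp.toLp 2 a : EuclideanSpace ℝ ι)
    (WithLp.toLp 2 b : EuclideanSpace ℝ ι)) ^ 2

/-- The four LoRA weight matrices of rank parameter `r`. -/
structure LoRAWeights (m h n r : ℕ) where
  A₁ : Matrix (Fin r) (Fin n) ℝ
  B₁ : Matrix (Fin h) (Fin r) ℝ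
  A₂ : Matrix (Fin r) (Fin h) ℝ
  B₂ : Matrix (Fin m) (Fin r) ℝ

namespace LoRAWeights

variable {m h n r : ℕ}

/-- `Z₁` is `B₁` stacked on top of `A₁ᵀ`. -/
def Z₁ (θ : LoRAWeights m h n r) : Matrix (Fin h ⊕ Fin n) (Fin r) ℝ :=
  Matrix.fromRows θ.B₁ θ.A₁ᵀ

/-- `Z₂` is `B₂` stacked on top of `A₂ᵀ`. -/
def Z₂ (θ : LoRAWeights m h n r) : Matrix (Fin m ⊕ Fin h) (Fin r) ℝ :=
  Matrix.fromRows θ.B₂ θ.A₂ᵀ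

/-- The fine-tuning objective `½ ‖Yft - (W₂ + B₂ A₂) (W₁ + B₁ A₁)‖_F²`. -/
def loss (W₂ : Matrix (Fin m) (Fin h) ℝ) (W₁ : Matrix (Fin h) (Fin n) ℝ)
    (Yft : Matrix (Fin m) (Fin n) ℝ) (θ : LoRAWeights m h n r) : ℝ :=
  1 / 2 * frobNorm (Yft - (W₂ + θ.B₂ * θ.A₂) * (W₁ + θ.B₁ * θ.A₁)) ^ 2

end LoRAWeights

/-- The matrix of partial derivatives of `f` at `X` with respect to the entries of `X`. -/
def matGrad {p q : ℕ} (f : Matrix (Fin p) (Fin q) ℝ → ℝ) (X : Matrix (Fin p) (Fin q) ℝ) :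
    Matrix (Fin p) (Fin q) ℝ :=
  Matrix.of fun i j => deriv (fun ε : ℝ => f (X + ε • Matrix.single i j (1 : ℝ))) 0

/-- `θ` solves the gradient flow of the fine-tuning objective on `[0, ∞)` (with a one-sided
derivative at time `0`). -/
structure IsGradientFlow {m h n r : ℕ} (W₂ : Matrix (Fin m) (Fin h) ℝ)
    (W₁ : Matrix (Fin h) (Fin n) ℝ) (Yft : Matrix (Fin m) (Fin n) ℝ)
    (θ : ℝ → LoRAWeights m h n r) : Prop where
  flow_A₁ : ∀ t, 0 ≤ t → ∀ i j, HasDerivWithinAt (fun s => (θ s).A₁ i j)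
    (-(matGrad (fun X => LoRAWeights.loss W₂ W₁ Yft { θ t with A₁ := X }) (θ t).A₁ i j))
    (Set.Ici 0) t
  flow_B₁ : ∀ t, 0 ≤ t → ∀ i j, HasDerivWithinAt (fun s => (θ s).B₁ i j)
    (-(matGrad (fun X => LoRAWeights.loss W₂ W₁ Yft { θ t with B₁ := X }) (θ t).B₁ i j))
    (Set.Ici 0) t
  flow_A₂ : ∀ t, 0 ≤ t → ∀ i j, HasDerivWithinAt (fun s => (θ s).A₂ i j)
    (-(matGrad (fun X => LoRAWeights.loss W₂ W₁ Yft { θ t with A₂ := X }) (θ t).A₂ i j))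
    (Set.Ici 0) t
  flow_B₂ : ∀ t, 0 ≤ t → ∀ i j, HasDerivWithinAt (fun s => (θ s).B₂ i j)
    (-(matGrad (fun X => LoRAWeights.loss W₂ W₁ Yft { θ t with B₂ := X }) (θ t).B₂ i j))
    (Set.Ici 0) t

/-- The law of a pair of independent matrices of sizes `r × n` and `r × h` whose entries are
i.i.d. standard Gaussian. -/
def stdGaussianPair (r n h : ℕ) :
    MeasureTheory.Measure ((Fin r → Fin n → ℝ) × (Fin r → Fin h → ℝ)) :=
  (MeasureTheory.Measure.pi fun _ : Fin r => MeasureTheory.Measure.pi fun _ : Fin n =>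
    ProbabilityTheory.gaussianReal 0 1).prod
  (MeasureTheory.Measure.pi fun _ : Fin r => MeasureTheory.Measure.pi fun _ : Fin h =>
    ProbabilityTheory.gaussianReal 0 1)

/-- The LoRA initialization of scale `α`: `A₁ = α X₁`, `A₂ = α X₂`, `B₁ = 0`, `B₂ = 0`. If the
entries of `X₁, X₂` are i.i.d. `N(0, 1)`, those of `A₁, A₂` are i.i.d. `N(0, α²)`. -/
def loraInit {r n h : ℕ} (m : ℕ) (α : ℝ) (X : (Fin r → Fin n → ℝ) × (Fin r → Fin h → ℝ)) :
    LoRAWeights m h n r where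
  A₁ := α • Matrix.of X.1
  B₁ := 0
  A₂ := α • Matrix.of X.2
  B₂ := 0

/-- `z_max = max (‖Z₁(0)‖_F, ‖Z₂(0)‖_F) / α`. -/
def zMax {m h n r : ℕ} (α : ℝ) (θ₀ : LoRAWeights m h n r) : ℝ :=
  1 / α * max (frobNorm θ₀.Z₁) (frobNorm θ₀.Z₂)

/-- The end of the early alignment phase; `ΔY` is the residual at time `0`. -/
def earlyTime {m h n : ℕ} (W₂ : Matrix (Fin m) (Fin h) ℝ) (W₁ : Matrix (Fin h) (Fin n) ℝ)
    (ΔY : Matrix (Fin m) (Fin n) ℝ) (σ σ₂ δ α z : ℝ) : ℝ :=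
  2 / ((5 - δ) * σ * σ₂) * Real.log (1 / (α * z ^ 2 *
    (specNorm ΔY + specNorm W₁ ^ 2 + specNorm W₁ * specNorm W₂ + specNorm W₂ ^ 2
      + Real.sqrt (specNorm W₁ + specNorm W₂))))

/-- The maximal duration of the escape-saddle phase. -/
def escapeDuration (σ σ₂ δ α z : ℝ) : ℝ :=
  2 * Real.log (1 + (1 - δ ^ 2) * σ ^ 2 / (4 * α ^ 2 * z ^ 2)) / ((1 + δ) * σ * σ₂)

/-- `T₁` is the end of the alignment phase: the first time at which
`gᵀ B₁ A₁ v ≥ (1 - δ) σ / (4 σ₂)`. -/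
def IsAlignmentEnd {m h n r : ℕ} (θ : ℝ → LoRAWeights m h n r) (g : Fin h → ℝ) (v : Fin n → ℝ)
    (σ σ₂ δ T₁ : ℝ) : Prop :=
  IsLeast {t : ℝ | 0 ≤ t ∧ (1 - δ) * σ / (4 * σ₂) ≤ g ⬝ᵥ (((θ t).B₁ * (θ t).A₁) *ᵥ v)} T₁

end

set_option linter.unusedSectionVars false

/-! Put l = σσ₂ and L = log(1/α). Near the origin the flow linearizes as follows. The force on the
first adapter is about l·g vᵀ, so Z₁ grows like e^{lt} along (g, v), decays along (g, −v), and is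
stationary in all other directions. The force on the second adapter is about σσ₁·u gᵀ = lδ·u gᵀ, so
Z₂ grows at most like e^{lδt}. Three squared sizes are tracked: the signal F of Z₁ along (g, v), the
bulk P (all of Z₂ and the rest of Z₁), and the off-axis part Q ≤ P (the rest of Z₁ and the parts of
B₂, A₂ᵀ orthogonal to u, g).

Since u, g, v are common singular directions of the weights and the target, weights lying on the
axes stay there. Hence Q has no linear growth, and the nonlinear terms perturb the growth of Q and P
only by a relative rate C(F + P); for F they contribute C(F + P)(F + Q). These are the inequalities
of `LoRAWeights.rates_bounds`, valid as long as x = gᵀB₁A₁v is at most the stopping threshold c and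
P is small.

The perturbation is harmless because the integral of F + P stays bounded. As long as x ≤ c, the
residual along the axes keeps a definite share of σ, so F' ≥ lF − CQ and the integral of F is
controlled by F itself, which is at most 2c + 1; and P is below α^{1−δ} over a time O(L). So
`SaddleSystem.apriori` gives Q = O(α²), P = O(α^{2−2δ}) and F comparable to α²e^{2lt}. A continuity
argument (`SaddleSystem.escape`) then shows that x reaches c at a time T with lT = L + O(1).

At this time F ≥ 2c, so a top singular vector misses (g, v) by O(α²) in squared sine, and the
squared norm ratio is at least of order α^{−(2−2δ)}. The required powers of α are strictly weaker,
and the required time window has slack in the coefficient of L, so all constants are absorbed for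
small α. The constants are uniform over initializations with bounded entries and X₁v bounded away
from 0; Gaussian initializations satisfy this, and X₂ ≠ 0, with probability arbitrarily close to 1.
-/

noncomputable section

/-! ### Frobenius inner product and derivatives of matrix-valued curves. -/

section MatrixCalculus

open scoped Matrix.Norms.Frobenius

variable {ι κ μ : Type*} [Fintype ι] [Fintype κ] [Fintype μ]

/-- The Frobenius inner product of real matrices. -/
def matInner (X Y : Matrix ι κ ℝ) : ℝ := ∑ i, ∑ j, X i j * Y i j

theorem matInner_eq_trace (X Y : Matrix ι κ ℝ) : matInner X Y = (Xᵀ * Y).trace := by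
  simp only [matInner, Matrix.trace, Matrix.diag, Matrix.mul_apply, Matrix.transpose_apply]
  exact Finset.sum_comm

theorem matInner_comm (X Y : Matrix ι κ ℝ) : matInner X Y = matInner Y X := by
  simp [matInner, mul_comm]

theorem matInner_transpose (X Y : Matrix ι κ ℝ) : matInner Xᵀ Yᵀ = matInner X Y := by
  simp only [matInner, Matrix.transpose_apply]
  exact Finset.sum_comm

theorem matInner_add_left (X Y Z : Matrix ι κ ℝ) :
    matInner (X + Y) Z = matInner X Z + matInner Y Z := by
  simp [matInner, add_mul, Finset.sum_add_distrib]

theorem matInner_add_right (X Y Z : Matrix ι κ ℝ) :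
    matInner X (Y + Z) = matInner X Y + matInner X Z := by
  simp [matInner, mul_add, Finset.sum_add_distrib]

theorem matInner_sub_left (X Y Z : Matrix ι κ ℝ) :
    matInner (X - Y) Z = matInner X Z - matInner Y Z := by
  simp [matInner, sub_mul, Finset.sum_sub_distrib]

theorem matInner_sub_right (X Y Z : Matrix ι κ ℝ) :
    matInner X (Y - Z) = matInner X Y - matInner X Z := by
  simp [matInner, mul_sub, Finset.sum_sub_distrib]

theorem matInner_smul_right (c : ℝ) (X Y : Matrix ι κ ℝ) :
    matInner X (c • Y) = c * matInner X Y := by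
  simp only [matInner, Matrix.smul_apply, smul_eq_mul, Finset.mul_sum]
  exact Finset.sum_congr rfl fun i _ => Finset.sum_congr rfl fun j _ => by ring

theorem matInner_mul_left (X : Matrix ι μ ℝ) (Y : Matrix μ κ ℝ) (Z : Matrix ι κ ℝ) :
    matInner (X * Y) Z = matInner Y (Xᵀ * Z) := by
  rw [matInner_eq_trace, matInner_eq_trace, Matrix.transpose_mul, Matrix.mul_assoc]

theorem matInner_mul_right (X : Matrix ι μ ℝ) (Y : Matrix μ κ ℝ) (Z : Matrix ι κ ℝ) :
    matInner (X * Y) Z = matInner X (Z * Yᵀ) := by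
  rw [← matInner_transpose, Matrix.transpose_mul, matInner_mul_left, ← matInner_transpose]
  simp

theorem matInner_self (X : Matrix ι κ ℝ) : matInner X X = ‖X‖ ^ 2 := by
  rw [Matrix.frobenius_norm_def, ← Real.sqrt_eq_rpow, Real.sq_sqrt (by positivity)]
  simp [matInner, sq]

theorem frobNorm_eq_norm (X : Matrix ι κ ℝ) : frobNorm X = ‖X‖ := by
  rw [Matrix.frobenius_norm_def, ← Real.sqrt_eq_rpow, frobNorm]
  simp

theorem abs_matInner_le (X Y : Matrix ι κ ℝ) : |matInner X Y| ≤ ‖X‖ * ‖Y‖ := by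
  refine abs_le_of_sq_le_sq ?_ (by positivity)
  rw [mul_pow, ← matInner_self, ← matInner_self]
  simp only [matInner, ← Finset.sum_product']
  refine (Finset.sum_mul_sq_le_sq_mul_sq _ _ _).trans (le_of_eq ?_)
  simp [sq]

theorem norm_add_sq_matInner (X Y : Matrix ι κ ℝ) :
    ‖X + Y‖ ^ 2 = ‖X‖ ^ 2 + 2 * matInner X Y + ‖Y‖ ^ 2 := by
  simp only [← matInner_self, matInner_add_left, matInner_add_right, matInner_comm Y X]
  ring

theorem norm_sub_sq_matInner (X Y : Matrix ι κ ℝ) :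
    ‖X - Y‖ ^ 2 = ‖X‖ ^ 2 - 2 * matInner X Y + ‖Y‖ ^ 2 := by
  simp only [← matInner_self, matInner_sub_left, matInner_sub_right, matInner_comm Y X]
  ring

/-- Entrywise one-sided differentiability of a matrix-valued function on `[0, ∞)`. -/
def HasMatDeriv (f : ℝ → Matrix ι κ ℝ) (f' : Matrix ι κ ℝ) (t : ℝ) : Prop :=
  ∀ i j, HasDerivWithinAt (fun s => f s i j) (f' i j) (Set.Ici 0) t

theorem HasMatDeriv.const_mul {f : ℝ → Matrix μ κ ℝ} {f' : Matrix μ κ ℝ} {t : ℝ}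
    (hf : HasMatDeriv f f' t) (X : Matrix ι μ ℝ) :
    HasMatDeriv (fun s => X * f s) (X * f') t := by
  intro i j
  simp only [Matrix.mul_apply]
  exact HasDerivWithinAt.fun_sum fun k _ => (hf k j).const_mul (X i k)

theorem HasMatDeriv.transpose {f : ℝ → Matrix ι κ ℝ} {f' : Matrix ι κ ℝ} {t : ℝ}
    (hf : HasMatDeriv f f' t) : HasMatDeriv (fun s => (f s)ᵀ) f'ᵀ t :=
  fun i j => hf j i

theorem HasMatDeriv.mul_const {f : ℝ → Matrix ι μ ℝ} {f' : Matrix ι μ ℝ} {t : ℝ}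
    (hf : HasMatDeriv f f' t) (X : Matrix μ κ ℝ) :
    HasMatDeriv (fun s => f s * X) (f' * X) t := by
  simpa using (hf.transpose.const_mul Xᵀ).transpose

theorem HasMatDeriv.add {f g : ℝ → Matrix ι κ ℝ} {f' g' : Matrix ι κ ℝ} {t : ℝ}
    (hf : HasMatDeriv f f' t) (hg : HasMatDeriv g g' t) :
    HasMatDeriv (fun s => f s + g s) (f' + g') t :=
  fun i j => (hf i j).add (hg i j)

theorem HasMatDeriv.sub {f g : ℝ → Matrix ι κ ℝ} {f' g' : Matrix ι κ ℝ} {t : ℝ}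
    (hf : HasMatDeriv f f' t) (hg : HasMatDeriv g g' t) :
    HasMatDeriv (fun s => f s - g s) (f' - g') t :=
  fun i j => (hf i j).sub (hg i j)

theorem HasMatDeriv.matInner {f g : ℝ → Matrix ι κ ℝ} {f' g' : Matrix ι κ ℝ} {t : ℝ}
    (hf : HasMatDeriv f f' t) (hg : HasMatDeriv g g' t) :
    HasDerivWithinAt (fun s => matInner (f s) (g s)) (matInner f' (g t) + matInner (f t) g')
      (Set.Ici 0) t := by
  simp only [_root_.matInner, ← Finset.sum_add_distrib]
  exact HasDerivWithinAt.fun_sum fun i _ => HasDerivWithinAt.fun_sum fun j _ =>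
    (hf i j).mul (hg i j)

theorem HasMatDeriv.norm_sq {f : ℝ → Matrix ι κ ℝ} {f' : Matrix ι κ ℝ} {t : ℝ}
    (hf : HasMatDeriv f f' t) :
    HasDerivWithinAt (fun s => ‖f s‖ ^ 2) (2 * _root_.matInner (f t) f') (Set.Ici 0) t := by
  simp only [← matInner_self]
  convert hf.matInner hf using 1
  rw [matInner_comm f' (f t)]; ring

/-- The residual is affine in each single weight matrix, so every partial derivative of the loss has
this form, with K the image of an elementary matrix. -/
theorem deriv_half_frobNorm_sq (E K : Matrix ι κ ℝ) :
    deriv (fun ε : ℝ => 1 / 2 * frobNorm (E - ε • K) ^ 2) 0 = -matInner E K := by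
  have h : (fun ε : ℝ => 1 / 2 * frobNorm (E - ε • K) ^ 2)
      = fun ε => 1 / 2 * (‖E‖ ^ 2 - 2 * (ε * matInner E K) + ε ^ 2 * ‖K‖ ^ 2) := by
    funext ε
    rw [frobNorm_eq_norm, norm_sub_sq_matInner, matInner_smul_right, norm_smul, mul_pow]
    simp
  rw [h]
  have : HasDerivAt (fun ε : ℝ => 1 / 2 * (‖E‖ ^ 2 - 2 * (ε * matInner E K) + ε ^ 2 * ‖K‖ ^ 2))
      (1 / 2 * (0 - 2 * (1 * matInner E K) + (2 * (0:ℝ)) * ‖K‖ ^ 2)) 0 := by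
    refine HasDerivAt.const_mul _ (((hasDerivAt_const _ _).sub
      (((hasDerivAt_id' _).mul_const _).const_mul _)).add ?_)
    simpa using (hasDerivAt_pow 2 (0:ℝ)).mul_const (‖K‖ ^ 2)
  rw [this.deriv]; ring

theorem matInner_single [DecidableEq ι] [DecidableEq κ] (X : Matrix ι κ ℝ) (i : ι) (j : κ) :
    matInner X (Matrix.single i j (1 : ℝ)) = X i j := by
  simp [matInner, Matrix.single_apply, ite_and]

end MatrixCalculus

/-! ### The gradient of the loss and the matrix form of the flow. -/

namespace LoRAWeights

variable {m h n r : ℕ}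

/-- The fine-tuned first layer. -/
def layer₁ (W₁ : Matrix (Fin h) (Fin n) ℝ) (θ : LoRAWeights m h n r) :
    Matrix (Fin h) (Fin n) ℝ := W₁ + θ.B₁ * θ.A₁

/-- The fine-tuned second layer. -/
def layer₂ (W₂ : Matrix (Fin m) (Fin h) ℝ) (θ : LoRAWeights m h n r) :
    Matrix (Fin m) (Fin h) ℝ := W₂ + θ.B₂ * θ.A₂

/-- The residual of the fine-tuned network. -/
def residual (W₂ : Matrix (Fin m) (Fin h) ℝ) (W₁ : Matrix (Fin h) (Fin n) ℝ)
    (Yft : Matrix (Fin m) (Fin n) ℝ) (θ : LoRAWeights m h n r) : Matrix (Fin m) (Fin n) ℝ :=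
  Yft - θ.layer₂ W₂ * θ.layer₁ W₁

/-- The negative gradient of the loss with respect to the first layer. -/
def force₁ (W₂ : Matrix (Fin m) (Fin h) ℝ) (W₁ : Matrix (Fin h) (Fin n) ℝ)
    (Yft : Matrix (Fin m) (Fin n) ℝ) (θ : LoRAWeights m h n r) : Matrix (Fin h) (Fin n) ℝ :=
  (θ.layer₂ W₂)ᵀ * θ.residual W₂ W₁ Yft

/-- The negative gradient of the loss with respect to the second layer. -/
def force₂ (W₂ : Matrix (Fin m) (Fin h) ℝ) (W₁ : Matrix (Fin h) (Fin n) ℝ)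
    (Yft : Matrix (Fin m) (Fin n) ℝ) (θ : LoRAWeights m h n r) : Matrix (Fin m) (Fin h) ℝ :=
  θ.residual W₂ W₁ Yft * (θ.layer₁ W₁)ᵀ

variable (W₂ : Matrix (Fin m) (Fin h) ℝ) (W₁ : Matrix (Fin h) (Fin n) ℝ)
  (Yft : Matrix (Fin m) (Fin n) ℝ) (θ : LoRAWeights m h n r)

/-- The adjoint rules for the Frobenius product move all other factors away from the elementary
matrix, which then reads off one entry. The three gradients that follow are obtained in the same
way. -/
theorem matGrad_A₁ : matGrad (fun X => loss W₂ W₁ Yft { θ with A₁ := X }) θ.A₁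
    = -(θ.B₁ᵀ * θ.force₁ W₂ W₁ Yft) := by
  ext i j
  have key : ∀ ε : ℝ, loss W₂ W₁ Yft { θ with A₁ := θ.A₁ + ε • Matrix.single i j (1 : ℝ) }
      = 1 / 2 * frobNorm (θ.residual W₂ W₁ Yft
        - ε • (θ.layer₂ W₂ * (θ.B₁ * Matrix.single i j (1 : ℝ)))) ^ 2 := by
    intro ε
    simp only [loss, residual, layer₁, layer₂]
    congr 3
    simp only [Matrix.mul_add, Matrix.add_mul, Matrix.mul_smul]
    module
  simp only [matGrad, Matrix.of_apply, key, deriv_half_frobNorm_sq, Matrix.neg_apply, force₁]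
  rw [matInner_comm, matInner_mul_left, matInner_mul_left, matInner_comm, matInner_single]

theorem matGrad_B₁ : matGrad (fun X => loss W₂ W₁ Yft { θ with B₁ := X }) θ.B₁
    = -(θ.force₁ W₂ W₁ Yft * θ.A₁ᵀ) := by
  ext i j
  have key : ∀ ε : ℝ, loss W₂ W₁ Yft { θ with B₁ := θ.B₁ + ε • Matrix.single i j (1 : ℝ) }
      = 1 / 2 * frobNorm (θ.residual W₂ W₁ Yft
        - ε • (θ.layer₂ W₂ * (Matrix.single i j (1 : ℝ) * θ.A₁))) ^ 2 := by
    intro ε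
    simp only [loss, residual, layer₁, layer₂]
    congr 3
    simp only [Matrix.mul_add, Matrix.add_mul, Matrix.mul_smul, Matrix.smul_mul]
    module
  simp only [matGrad, Matrix.of_apply, key, deriv_half_frobNorm_sq, Matrix.neg_apply, force₁]
  rw [matInner_comm, matInner_mul_left, matInner_mul_right, matInner_comm, matInner_single]

theorem matGrad_A₂ : matGrad (fun X => loss W₂ W₁ Yft { θ with A₂ := X }) θ.A₂
    = -(θ.B₂ᵀ * θ.force₂ W₂ W₁ Yft) := by
  ext i j
  have key : ∀ ε : ℝ, loss W₂ W₁ Yft { θ with A₂ := θ.A₂ + ε • Matrix.single i j (1 : ℝ) }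
      = 1 / 2 * frobNorm (θ.residual W₂ W₁ Yft
        - ε • (θ.B₂ * Matrix.single i j (1 : ℝ) * θ.layer₁ W₁)) ^ 2 := by
    intro ε
    simp only [loss, residual, layer₁, layer₂]
    congr 3
    simp only [Matrix.mul_add, Matrix.add_mul, Matrix.mul_smul, Matrix.smul_mul]
    module
  simp only [matGrad, Matrix.of_apply, key, deriv_half_frobNorm_sq, Matrix.neg_apply, force₂]
  rw [matInner_comm, matInner_mul_right, matInner_mul_left, matInner_comm, matInner_single]

theorem matGrad_B₂ : matGrad (fun X => loss W₂ W₁ Yft { θ with B₂ := X }) θ.B₂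
    = -(θ.force₂ W₂ W₁ Yft * θ.A₂ᵀ) := by
  ext i j
  have key : ∀ ε : ℝ, loss W₂ W₁ Yft { θ with B₂ := θ.B₂ + ε • Matrix.single i j (1 : ℝ) }
      = 1 / 2 * frobNorm (θ.residual W₂ W₁ Yft
        - ε • (Matrix.single i j (1 : ℝ) * θ.A₂ * θ.layer₁ W₁)) ^ 2 := by
    intro ε
    simp only [loss, residual, layer₁, layer₂]
    congr 3
    simp only [Matrix.mul_add, Matrix.add_mul, Matrix.smul_mul]
    module
  simp only [matGrad, Matrix.of_apply, key, deriv_half_frobNorm_sq, Matrix.neg_apply, force₂]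
  rw [matInner_comm, matInner_mul_right, matInner_mul_right, matInner_comm, matInner_single]

end LoRAWeights

section GradientFlow

variable {m h n r : ℕ} {W₂ : Matrix (Fin m) (Fin h) ℝ} {W₁ : Matrix (Fin h) (Fin n) ℝ}
  {Yft : Matrix (Fin m) (Fin n) ℝ} {θ : ℝ → LoRAWeights m h n r}

theorem IsGradientFlow.hasMatDeriv_A₁ (hθ : IsGradientFlow W₂ W₁ Yft θ) {t : ℝ} (ht : 0 ≤ t) :
    HasMatDeriv (fun s => (θ s).A₁) ((θ t).B₁ᵀ * (θ t).force₁ W₂ W₁ Yft) t := by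
  intro i j
  simpa [LoRAWeights.matGrad_A₁] using hθ.flow_A₁ t ht i j

theorem IsGradientFlow.hasMatDeriv_B₁ (hθ : IsGradientFlow W₂ W₁ Yft θ) {t : ℝ} (ht : 0 ≤ t) :
    HasMatDeriv (fun s => (θ s).B₁) ((θ t).force₁ W₂ W₁ Yft * (θ t).A₁ᵀ) t := by
  intro i j
  simpa [LoRAWeights.matGrad_B₁] using hθ.flow_B₁ t ht i j

theorem IsGradientFlow.hasMatDeriv_A₂ (hθ : IsGradientFlow W₂ W₁ Yft θ) {t : ℝ} (ht : 0 ≤ t) :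
    HasMatDeriv (fun s => (θ s).A₂) ((θ t).B₂ᵀ * (θ t).force₂ W₂ W₁ Yft) t := by
  intro i j
  simpa [LoRAWeights.matGrad_A₂] using hθ.flow_A₂ t ht i j

theorem IsGradientFlow.hasMatDeriv_B₂ (hθ : IsGradientFlow W₂ W₁ Yft θ) {t : ℝ} (ht : 0 ≤ t) :
    HasMatDeriv (fun s => (θ s).B₂) ((θ t).force₂ W₂ W₁ Yft * (θ t).A₂ᵀ) t := by
  intro i j
  simpa [LoRAWeights.matGrad_B₂] using hθ.flow_B₂ t ht i j

end GradientFlow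
end

noncomputable section

open scoped Matrix.Norms.Frobenius

/-! ### Splitting matrices along a unit column. -/

section Projection

variable {ι κ μ : Type*} [Fintype ι] [Fintype κ] [Fintype μ]

/-- The part of `X` whose columns are orthogonal to the unit column `a`. -/
def projOff (a : Matrix ι Unit ℝ) (X : Matrix ι κ ℝ) : Matrix ι κ ℝ := X - a * (aᵀ * X)

theorem projOff_add_self (a : Matrix ι Unit ℝ) (X : Matrix ι κ ℝ) :
    projOff a X + a * (aᵀ * X) = X := by simp [projOff]

theorem projOff_add (a : Matrix ι Unit ℝ) (X Y : Matrix ι κ ℝ) :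
    projOff a (X + Y) = projOff a X + projOff a Y := by
  simp only [projOff, Matrix.mul_add]; abel

theorem projOff_sub (a : Matrix ι Unit ℝ) (X Y : Matrix ι κ ℝ) :
    projOff a (X - Y) = projOff a X - projOff a Y := by
  simp only [projOff, Matrix.mul_sub]; abel

theorem projOff_smul (a : Matrix ι Unit ℝ) (c : ℝ) (X : Matrix ι κ ℝ) :
    projOff a (c • X) = c • projOff a X := by
  simp only [projOff, Matrix.mul_smul, smul_sub]

theorem projOff_mul (a : Matrix ι Unit ℝ) (X : Matrix ι μ ℝ) (Y : Matrix μ κ ℝ) :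
    projOff a (X * Y) = projOff a X * Y := by
  simp only [projOff, Matrix.sub_mul, Matrix.mul_assoc]

theorem projOff_self {a : Matrix ι Unit ℝ} (ha : aᵀ * a = 1) : projOff a a = 0 := by
  simp [projOff, ha]

theorem transpose_mul_projOff {a : Matrix ι Unit ℝ} (ha : aᵀ * a = 1) (X : Matrix ι κ ℝ) :
    aᵀ * projOff a X = 0 := by
  simp [projOff, Matrix.mul_sub, ← Matrix.mul_assoc, ha]

theorem norm_sq_eq_projOff {a : Matrix ι Unit ℝ} (ha : aᵀ * a = 1) (X : Matrix ι κ ℝ) :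
    ‖X‖ ^ 2 = ‖projOff a X‖ ^ 2 + ‖aᵀ * X‖ ^ 2 := by
  conv_lhs => rw [← projOff_add_self a X]
  rw [norm_add_sq_matInner, matInner_comm, matInner_mul_left, transpose_mul_projOff ha,
    ← matInner_self (a * (aᵀ * X)), matInner_mul_left a _ (a * _), ← Matrix.mul_assoc aᵀ a, ha,
    Matrix.one_mul, matInner_self]
  simp [matInner]

theorem norm_transpose_mul_le {a : Matrix ι Unit ℝ} (ha : aᵀ * a = 1) (X : Matrix ι κ ℝ) :
    ‖aᵀ * X‖ ≤ ‖X‖ := by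
  refine abs_le_of_sq_le_sq' ?_ (norm_nonneg _) |>.2
  rw [norm_sq_eq_projOff ha X]; linarith [sq_nonneg ‖projOff a X‖]

theorem norm_projOff_le {a : Matrix ι Unit ℝ} (ha : aᵀ * a = 1) (X : Matrix ι κ ℝ) :
    ‖projOff a X‖ ≤ ‖X‖ := by
  refine abs_le_of_sq_le_sq' ?_ (norm_nonneg _) |>.2
  rw [norm_sq_eq_projOff ha X]; linarith [sq_nonneg ‖aᵀ * X‖]

/-- The projection is symmetric and idempotent, so applying it to one factor is enough. -/
theorem transpose_projOff_mul {a : Matrix ι Unit ℝ} (ha : aᵀ * a = 1) (X : Matrix ι κ ℝ)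
    (Y : Matrix ι μ ℝ) : (projOff a X)ᵀ * projOff a Y = (projOff a X)ᵀ * Y := by
  conv_rhs => rw [← projOff_add_self a Y]
  rw [Matrix.mul_add, ← Matrix.mul_assoc _ a]
  have : (projOff a X)ᵀ * a = 0 := by
    rw [← Matrix.transpose_inj, Matrix.transpose_mul, Matrix.transpose_transpose,
      transpose_mul_projOff ha, Matrix.transpose_zero]
  simp [this]

/-- Splitting a product along the unit column `a` in the middle. -/
theorem projOff_mul_split (b : Matrix ι Unit ℝ) (a : Matrix μ Unit ℝ) (X : Matrix ι μ ℝ)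
    (Y : Matrix μ κ ℝ) :
    projOff b (X * Y) = projOff b (X * a) * (aᵀ * Y) + projOff b (X * projOff a Y) := by
  conv_lhs => rw [← projOff_add_self a Y]
  rw [Matrix.mul_add, projOff_add, add_comm, ← Matrix.mul_assoc X a, projOff_mul b (X * a)]

/-- The range of the rank-one term lies on the axis b. This is why the leading part of a force
causes no growth off the axes. -/
theorem projOff_rankOne_add_mul {b : Matrix ι Unit ℝ} (hb : bᵀ * b = 1) (a : Matrix μ Unit ℝ)
    (c : ℝ) (N : Matrix ι μ ℝ) (Y : Matrix μ κ ℝ) :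
    projOff b ((c • (b * aᵀ) + N) * Y) = projOff b (N * Y) := by
  rw [Matrix.add_mul, projOff_add, Matrix.smul_mul, projOff_smul, Matrix.mul_assoc, projOff_mul,
    projOff_self hb]
  simp

theorem matInner_self_mul (X : Matrix ι Unit ℝ) (c : Matrix Unit Unit ℝ) :
    matInner X (X * c) = c () () * ‖X‖ ^ 2 := by
  rw [← matInner_self]
  simp only [matInner, Matrix.mul_apply, Finset.univ_unique, Finset.sum_singleton, Finset.mul_sum]
  exact Finset.sum_congr rfl fun i _ => by
    simp only [PUnit.default_eq_unit]; ring

theorem transpose_unit_matrix (c : Matrix Unit Unit ℝ) : cᵀ = c := by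
  ext i j; rfl

theorem abs_apply_le_norm (c : Matrix Unit Unit ℝ) : |c () ()| = ‖c‖ := by
  have : ‖c‖ ^ 2 = c () () ^ 2 := by rw [← matInner_self]; simp [matInner, sq]
  rw [← abs_of_nonneg (norm_nonneg c)]
  exact (sq_eq_sq_iff_abs_eq_abs _ _).1 this.symm

end Projection

/-! ### Order-of-magnitude calculus for matrix products. -/

section BigO

open Asymptotics

variable {X ι κ μ : Type*} [Fintype ι] [Fintype κ] [Fintype μ] {l : Filter X}

theorem Asymptotics.IsBigO.matMul {f : X → Matrix ι μ ℝ} {g : X → Matrix μ κ ℝ} {a b : X → ℝ}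
    (hf : f =O[l] a) (hg : g =O[l] b) : (fun x => f x * g x) =O[l] fun x => a x * b x :=
  (IsBigO.of_norm_le fun x => by
    simpa using Matrix.frobenius_norm_mul (f x) (g x)).trans (hf.norm_left.mul hg.norm_left)

theorem Asymptotics.IsBigO.matInner {f g : X → Matrix ι κ ℝ} {a b : X → ℝ}
    (hf : f =O[l] a) (hg : g =O[l] b) :
    (fun x => _root_.matInner (f x) (g x)) =O[l] fun x => a x * b x :=
  (IsBigO.of_norm_le fun x => by
    simpa using abs_matInner_le (f x) (g x)).trans (hf.norm_left.mul hg.norm_left)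

theorem Asymptotics.IsBigO.matTranspose {f : X → Matrix ι κ ℝ} {a : X → ℝ}
    (hf : f =O[l] a) : (fun x => (f x)ᵀ) =O[l] a :=
  (IsBigO.of_norm_le fun x => by
    simp).trans hf.norm_left

theorem Asymptotics.IsBigO.projOff {a : Matrix ι Unit ℝ} (ha : aᵀ * a = 1)
    {f : X → Matrix ι κ ℝ} {b : X → ℝ} (hf : f =O[l] b) :
    (fun x => _root_.projOff a (f x)) =O[l] b :=
  (IsBigO.of_norm_le fun x => by
    simpa only [norm_norm] using norm_projOff_le ha (f x)).trans hf.norm_left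

theorem matConst_isBigO_one (W : Matrix ι κ ℝ) : (fun _ : X => W) =O[l] fun _ => (1 : ℝ) :=
  isBigO_const_const W one_ne_zero l

/-- Being nearly parallel to fixed axes is preserved by matrices that nearly map one axis to the
other. -/
theorem projOff_mul_isBigO {a : Matrix μ Unit ℝ} {b : Matrix ι Unit ℝ}
    (hb : bᵀ * b = 1) {f : X → Matrix ι μ ℝ} {w : X → Matrix μ Unit ℝ} {e : X → ℝ}
    (hf : f =O[l] fun _ => (1 : ℝ)) (hw : w =O[l] fun _ => (1 : ℝ))
    (hfa : (fun x => projOff b (f x * a)) =O[l] e) (hwa : (fun x => projOff a (w x)) =O[l] e) :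
    (fun x => projOff b (f x * w x)) =O[l] e := by
  refine IsBigO.congr_left ?_ fun x => (projOff_mul_split b a (f x) (w x)).symm
  have h1 := hfa.matMul ((matConst_isBigO_one aᵀ).matMul hw)
  have h2 := (hf.matMul hwa).projOff hb
  simp only [mul_one, one_mul] at h1 h2
  exact h1.add h2

/-- The key cancellation: for `f = c b aᵀ + N`, the part of `f Y` off the axis `b` is controlled by
`N` and the parts of `f a` and `Y` off the axes. -/
theorem projOff_mul_isBigO_of_rankOne {a : Matrix μ Unit ℝ} {b : Matrix ι Unit ℝ}
    (hb : bᵀ * b = 1) (c : ℝ) {f : X → Matrix ι μ ℝ} {Y : X → Matrix μ κ ℝ} {N e : X → ℝ}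
    (hf : (fun x => f x - c • (b * aᵀ)) =O[l] fun x => N x ^ 2)
    (hfa : (fun x => projOff b (f x * a)) =O[l] fun x => N x * e x) (hY : Y =O[l] N)
    (hYa : (fun x => projOff a (Y x)) =O[l] e) :
    (fun x => projOff b (f x * Y x)) =O[l] fun x => N x ^ 2 * e x := by
  have key : ∀ x, projOff b (f x * Y x) = projOff b (f x * a) * (aᵀ * Y x)
      + projOff b ((f x - c • (b * aᵀ)) * projOff a (Y x)) := by
    intro x
    rw [projOff_mul_split b a]
    congr 1
    conv_lhs => rw [← add_sub_cancel (c • (b * aᵀ)) (f x)]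
    rw [projOff_rankOne_add_mul hb]
  refine IsBigO.congr_left ?_ fun x => (key x).symm
  have h1 := hfa.matMul ((matConst_isBigO_one aᵀ).matMul hY)
  have h2 := (hf.matMul hYa).projOff hb
  refine IsBigO.add (h1.congr_right fun x => ?_) h2
  ring

end BigO

/-! ### The aligned rank-one task, and the signal, off-axis and bulk sizes. -/

/-- Fine-tuning towards a target that differs from the product of the layers in one common singular
direction; unit vectors are written as columns. -/
structure RankOneTask {m h n : ℕ} (W₂ : Matrix (Fin m) (Fin h) ℝ) (W₁ : Matrix (Fin h) (Fin n) ℝ)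
    (Yft : Matrix (Fin m) (Fin n) ℝ) (U : Matrix (Fin m) Unit ℝ) (G : Matrix (Fin h) Unit ℝ)
    (V : Matrix (Fin n) Unit ℝ) (σ σ₁ σ₂ : ℝ) : Prop where
  unit_U : Uᵀ * U = 1
  unit_G : Gᵀ * G = 1
  unit_V : Vᵀ * V = 1
  target : Yft = W₂ * W₁ + σ • (U * Vᵀ)
  W₁_mul : W₁ * V = σ₁ • G
  W₁_transpose_mul : W₁ᵀ * G = σ₁ • V
  W₂_mul : W₂ * G = σ₂ • U
  W₂_transpose_mul : W₂ᵀ * U = σ₂ • G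

namespace LoRAWeights

variable {m h n r : ℕ}

/-- The squared size of `Z₁` along the direction `(G, V)`. -/
def signal (G : Matrix (Fin h) Unit ℝ) (V : Matrix (Fin n) Unit ℝ) (θ : LoRAWeights m h n r) : ℝ :=
  ‖θ.B₁ᵀ * G + θ.A₁ * V‖ ^ 2 / 2

/-- The squared size of `Z₁` orthogonally to the direction `(G, V)`. -/
def offAxis₁ (G : Matrix (Fin h) Unit ℝ) (V : Matrix (Fin n) Unit ℝ) (θ : LoRAWeights m h n r) :
    ℝ :=
  ‖θ.B₁ᵀ * G - θ.A₁ * V‖ ^ 2 / 2 + ‖projOff G θ.B₁‖ ^ 2 + ‖projOff V θ.A₁ᵀ‖ ^ 2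

/-- The squared size of the blocks of `Z₂` off the axes `U` and `G`. -/
def offAxis₂ (U : Matrix (Fin m) Unit ℝ) (G : Matrix (Fin h) Unit ℝ) (θ : LoRAWeights m h n r) :
    ℝ :=
  ‖projOff U θ.B₂‖ ^ 2 + ‖projOff G θ.A₂ᵀ‖ ^ 2

/-- The squared size of everything in `Z₁`, `Z₂` off the axes. -/
def offAxis (U : Matrix (Fin m) Unit ℝ) (G : Matrix (Fin h) Unit ℝ) (V : Matrix (Fin n) Unit ℝ)
    (θ : LoRAWeights m h n r) : ℝ :=
  θ.offAxis₁ G V + θ.offAxis₂ U G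

/-- The squared size of all weights but the signal. -/
def bulk (G : Matrix (Fin h) Unit ℝ) (V : Matrix (Fin n) Unit ℝ) (θ : LoRAWeights m h n r) : ℝ :=
  ‖θ.A₂‖ ^ 2 + ‖θ.B₂‖ ^ 2 + θ.offAxis₁ G V

theorem signal_nonneg (G : Matrix (Fin h) Unit ℝ) (V : Matrix (Fin n) Unit ℝ)
    (θ : LoRAWeights m h n r) : 0 ≤ θ.signal G V := by unfold signal; positivity

theorem offAxis₁_nonneg (G : Matrix (Fin h) Unit ℝ) (V : Matrix (Fin n) Unit ℝ)
    (θ : LoRAWeights m h n r) : 0 ≤ θ.offAxis₁ G V := by unfold offAxis₁; positivity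

theorem offAxis₂_nonneg (U : Matrix (Fin m) Unit ℝ) (G : Matrix (Fin h) Unit ℝ)
    (θ : LoRAWeights m h n r) : 0 ≤ θ.offAxis₂ U G := by unfold offAxis₂; positivity

/-- Pythagoras off the axes G and V, and the parallelogram law for the two on-axis vectors B₁ᵀG and
A₁V. -/
theorem signal_add_offAxis₁ {G : Matrix (Fin h) Unit ℝ} {V : Matrix (Fin n) Unit ℝ}
    (hG : Gᵀ * G = 1) (hV : Vᵀ * V = 1) (θ : LoRAWeights m h n r) :
    θ.signal G V + θ.offAxis₁ G V = ‖θ.A₁‖ ^ 2 + ‖θ.B₁‖ ^ 2 := by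
  have e1 : ‖θ.A₁ * V‖ = ‖Vᵀ * θ.A₁ᵀ‖ := by
    rw [← Matrix.transpose_mul, Matrix.frobenius_norm_transpose]
  have e2 : ‖θ.B₁ᵀ * G‖ = ‖Gᵀ * θ.B₁‖ := by
    rw [← Matrix.frobenius_norm_transpose]; simp
  rw [← Matrix.frobenius_norm_transpose θ.A₁, norm_sq_eq_projOff hV, norm_sq_eq_projOff hG,
    ← e1, ← e2]
  unfold signal offAxis₁
  rw [norm_add_sq_matInner, norm_sub_sq_matInner]
  ring

theorem offAxis₂_le {U : Matrix (Fin m) Unit ℝ} {G : Matrix (Fin h) Unit ℝ}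
    (hU : Uᵀ * U = 1) (hG : Gᵀ * G = 1) (θ : LoRAWeights m h n r) :
    θ.offAxis₂ U G ≤ ‖θ.A₂‖ ^ 2 + ‖θ.B₂‖ ^ 2 := by
  rw [← Matrix.frobenius_norm_transpose θ.A₂, norm_sq_eq_projOff hU θ.B₂,
    norm_sq_eq_projOff hG θ.A₂ᵀ]
  unfold offAxis₂
  nlinarith [sq_nonneg ‖Gᵀ * θ.A₂ᵀ‖, sq_nonneg ‖Uᵀ * θ.B₂‖]

theorem offAxis_le_bulk {U : Matrix (Fin m) Unit ℝ} {G : Matrix (Fin h) Unit ℝ}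
    (hU : Uᵀ * U = 1) (hG : Gᵀ * G = 1) (V : Matrix (Fin n) Unit ℝ) (θ : LoRAWeights m h n r) :
    θ.offAxis U G V ≤ θ.bulk G V := by
  unfold offAxis bulk
  linarith [offAxis₂_le hU hG θ]

theorem offAxis_nonneg (U : Matrix (Fin m) Unit ℝ) (G : Matrix (Fin h) Unit ℝ)
    (V : Matrix (Fin n) Unit ℝ) (θ : LoRAWeights m h n r) : 0 ≤ θ.offAxis U G V :=
  add_nonneg (offAxis₁_nonneg G V θ) (offAxis₂_nonneg U G θ)

theorem bulk_nonneg (G : Matrix (Fin h) Unit ℝ) (V : Matrix (Fin n) Unit ℝ)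
    (θ : LoRAWeights m h n r) : 0 ≤ θ.bulk G V := by
  have := offAxis₁_nonneg G V θ
  unfold bulk; positivity

/-- Polarization. It links the signal to the quantity gᵀB₁A₁v that defines the stopping time; the
two differ, up to the factor 2, only by an off-axis term. -/
theorem signal_eq_two_mul_add (G : Matrix (Fin h) Unit ℝ) (V : Matrix (Fin n) Unit ℝ)
    (θ : LoRAWeights m h n r) : θ.signal G V
      = 2 * matInner (θ.B₁ᵀ * G) (θ.A₁ * V) + ‖θ.B₁ᵀ * G - θ.A₁ * V‖ ^ 2 / 2 := by
  unfold signal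
  rw [norm_add_sq_matInner, norm_sub_sq_matInner]; ring

end LoRAWeights
end

noncomputable section

open scoped Matrix.Norms.Frobenius

/-! ### Time derivatives along the flow, and the forces up to quadratic terms. -/

namespace LoRAWeights

open Asymptotics Filter

variable {m h n r : ℕ}

/-- The time derivative of `signal` along the gradient flow. -/
def signalRate (W₂ : Matrix (Fin m) (Fin h) ℝ) (W₁ : Matrix (Fin h) (Fin n) ℝ)
    (Yft : Matrix (Fin m) (Fin n) ℝ) (G : Matrix (Fin h) Unit ℝ) (V : Matrix (Fin n) Unit ℝ)
    (θ : LoRAWeights m h n r) : ℝ :=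
  matInner (θ.B₁ᵀ * G + θ.A₁ * V)
    (θ.A₁ * ((θ.force₁ W₂ W₁ Yft)ᵀ * G) + θ.B₁ᵀ * (θ.force₁ W₂ W₁ Yft * V))

/-- The time derivative of `offAxis₁` along the gradient flow. -/
def offAxis₁Rate (W₂ : Matrix (Fin m) (Fin h) ℝ) (W₁ : Matrix (Fin h) (Fin n) ℝ)
    (Yft : Matrix (Fin m) (Fin n) ℝ) (G : Matrix (Fin h) Unit ℝ) (V : Matrix (Fin n) Unit ℝ)
    (θ : LoRAWeights m h n r) : ℝ :=
  matInner (θ.B₁ᵀ * G - θ.A₁ * V)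
    (θ.A₁ * ((θ.force₁ W₂ W₁ Yft)ᵀ * G) - θ.B₁ᵀ * (θ.force₁ W₂ W₁ Yft * V))
  + 2 * matInner (projOff G θ.B₁) (projOff G (θ.force₁ W₂ W₁ Yft * θ.A₁ᵀ))
  + 2 * matInner (projOff V θ.A₁ᵀ) (projOff V ((θ.force₁ W₂ W₁ Yft)ᵀ * θ.B₁))

/-- The time derivative of `offAxis₂` along the gradient flow. -/
def offAxis₂Rate (W₂ : Matrix (Fin m) (Fin h) ℝ) (W₁ : Matrix (Fin h) (Fin n) ℝ)
    (Yft : Matrix (Fin m) (Fin n) ℝ) (U : Matrix (Fin m) Unit ℝ) (G : Matrix (Fin h) Unit ℝ)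
    (θ : LoRAWeights m h n r) : ℝ :=
  2 * matInner (projOff U θ.B₂) (projOff U (θ.force₂ W₂ W₁ Yft * θ.A₂ᵀ))
  + 2 * matInner (projOff G θ.A₂ᵀ) (projOff G ((θ.force₂ W₂ W₁ Yft)ᵀ * θ.B₂))

/-- The time derivative of `‖A₂‖² + ‖B₂‖²` along the gradient flow. -/
def sizeRate (W₂ : Matrix (Fin m) (Fin h) ℝ) (W₁ : Matrix (Fin h) (Fin n) ℝ)
    (Yft : Matrix (Fin m) (Fin n) ℝ) (θ : LoRAWeights m h n r) : ℝ :=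
  4 * matInner (θ.B₂ * θ.A₂) (θ.force₂ W₂ W₁ Yft)

section Derivatives

variable {W₂ : Matrix (Fin m) (Fin h) ℝ} {W₁ : Matrix (Fin h) (Fin n) ℝ}
  {Yft : Matrix (Fin m) (Fin n) ℝ} {θ : ℝ → LoRAWeights m h n r}

theorem hasDeriv_signal (hθ : IsGradientFlow W₂ W₁ Yft θ) {t : ℝ} (ht : 0 ≤ t)
    (G : Matrix (Fin h) Unit ℝ) (V : Matrix (Fin n) Unit ℝ) :
    HasDerivWithinAt (fun s => (θ s).signal G V) ((θ t).signalRate W₂ W₁ Yft G V)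
      (Set.Ici 0) t := by
  have hA := (hθ.hasMatDeriv_A₁ ht).mul_const V
  have hB := (hθ.hasMatDeriv_B₁ ht).transpose.mul_const G
  have := (hB.add hA).norm_sq.div_const 2
  unfold signal signalRate
  refine this.congr_deriv ?_
  rw [mul_div_cancel_left₀ _ two_ne_zero]
  simp only [Matrix.transpose_mul, Matrix.transpose_transpose, Matrix.mul_assoc]

theorem hasDeriv_offAxis₁ (hθ : IsGradientFlow W₂ W₁ Yft θ) {t : ℝ} (ht : 0 ≤ t)
    (G : Matrix (Fin h) Unit ℝ) (V : Matrix (Fin n) Unit ℝ) :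
    HasDerivWithinAt (fun s => (θ s).offAxis₁ G V) ((θ t).offAxis₁Rate W₂ W₁ Yft G V)
      (Set.Ici 0) t := by
  have hA := (hθ.hasMatDeriv_A₁ ht).mul_const V
  have hB := (hθ.hasMatDeriv_B₁ ht).transpose.mul_const G
  have h1 := (hB.sub hA).norm_sq.div_const 2
  have hB' := hθ.hasMatDeriv_B₁ ht
  have hA' := (hθ.hasMatDeriv_A₁ ht).transpose
  have h2 := (hB'.sub ((hB'.const_mul Gᵀ).const_mul G)).norm_sq
  have h3 := (hA'.sub ((hA'.const_mul Vᵀ).const_mul V)).norm_sq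
  unfold offAxis₁ offAxis₁Rate
  refine ((h1.add h2).add h3).congr_deriv ?_
  rw [mul_div_cancel_left₀ _ two_ne_zero]
  simp only [Matrix.transpose_mul, Matrix.transpose_transpose, Matrix.mul_assoc, projOff]

theorem hasDeriv_offAxis₂ (hθ : IsGradientFlow W₂ W₁ Yft θ) {t : ℝ} (ht : 0 ≤ t)
    (U : Matrix (Fin m) Unit ℝ) (G : Matrix (Fin h) Unit ℝ) :
    HasDerivWithinAt (fun s => (θ s).offAxis₂ U G) ((θ t).offAxis₂Rate W₂ W₁ Yft U G)
      (Set.Ici 0) t := by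
  have hB' := hθ.hasMatDeriv_B₂ ht
  have hA' := (hθ.hasMatDeriv_A₂ ht).transpose
  have h2 := (hB'.sub ((hB'.const_mul Uᵀ).const_mul U)).norm_sq
  have h3 := (hA'.sub ((hA'.const_mul Gᵀ).const_mul G)).norm_sq
  unfold offAxis₂ offAxis₂Rate
  refine (h2.add h3).congr_deriv ?_
  simp only [Matrix.transpose_mul, Matrix.transpose_transpose, projOff]

theorem hasDeriv_size (hθ : IsGradientFlow W₂ W₁ Yft θ) {t : ℝ} (ht : 0 ≤ t) :
    HasDerivWithinAt (fun s => ‖(θ s).A₂‖ ^ 2 + ‖(θ s).B₂‖ ^ 2) ((θ t).sizeRate W₂ W₁ Yft)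
      (Set.Ici 0) t := by
  refine ((hθ.hasMatDeriv_A₂ ht).norm_sq.add (hθ.hasMatDeriv_B₂ ht).norm_sq).congr_deriv ?_
  rw [sizeRate, ← matInner_mul_left, matInner_mul_right]
  ring

/-- Both squared norms change at the rate 2⟨B₂A₂, `force₂`⟩. This conservation law is what later
keeps Z₂ away from 0. -/
theorem hasDeriv_imbalance₂ (hθ : IsGradientFlow W₂ W₁ Yft θ) {t : ℝ} (ht : 0 ≤ t) :
    HasDerivWithinAt (fun s => ‖(θ s).A₂‖ ^ 2 - ‖(θ s).B₂‖ ^ 2) 0 (Set.Ici 0) t := by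
  refine ((hθ.hasMatDeriv_A₂ ht).norm_sq.sub (hθ.hasMatDeriv_B₂ ht).norm_sq).congr_deriv ?_
  rw [← matInner_mul_left, matInner_mul_right]
  ring

end Derivatives

section Estimates

variable {W₂ : Matrix (Fin m) (Fin h) ℝ} {W₁ : Matrix (Fin h) (Fin n) ℝ}
  {Yft : Matrix (Fin m) (Fin n) ℝ} {U : Matrix (Fin m) Unit ℝ} {G : Matrix (Fin h) Unit ℝ}
  {V : Matrix (Fin n) Unit ℝ} {σ σ₁ σ₂ : ℝ}

/-- The Frobenius norm of all weights. -/
def totalNorm (θ : LoRAWeights m h n r) : ℝ :=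
  Real.sqrt (‖θ.A₁‖ ^ 2 + ‖θ.B₁‖ ^ 2 + ‖θ.A₂‖ ^ 2 + ‖θ.B₂‖ ^ 2)

theorem totalNorm_sq (θ : LoRAWeights m h n r) :
    θ.totalNorm ^ 2 = ‖θ.A₁‖ ^ 2 + ‖θ.B₁‖ ^ 2 + ‖θ.A₂‖ ^ 2 + ‖θ.B₂‖ ^ 2 :=
  Real.sq_sqrt (by positivity)

/-- The filter of all weights of norm at most `R`. -/
def bounded (m h n r : ℕ) (R : ℝ) : Filter (LoRAWeights m h n r) := 𝓟 {θ | θ.totalNorm ≤ R}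

/-- On a principal filter, `IsBigO` is a bound with one constant on the whole set. The asymptotic
notation thus serves as bookkeeping for uniform constants depending on R. -/
theorem exists_bound_of_isBigO {R : ℝ} {f g : LoRAWeights m h n r → ℝ}
    (hfg : f =O[bounded m h n r R] g) (hg : ∀ θ, 0 ≤ g θ) :
    ∃ C ≥ 0, ∀ θ, θ.totalNorm ≤ R → |f θ| ≤ C * g θ := by
  obtain ⟨C, hC, hb⟩ := hfg.exists_nonneg
  refine ⟨C, hC, fun θ hθ => ?_⟩
  have := mem_principal.1 hb.bound hθ
  simpa only [Set.mem_ofPred_eq, Real.norm_eq_abs, abs_of_nonneg (hg θ)] using this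

theorem isBigO_of_sq_le {E : Type*} [SeminormedAddCommGroup E] {l : Filter (LoRAWeights m h n r)}
    {f : LoRAWeights m h n r → E} {c : ℝ} (hc : 0 ≤ c) {a : LoRAWeights m h n r → ℝ}
    (hf : ∀ θ, ‖f θ‖ ^ 2 ≤ c * a θ) : f =O[l] fun θ => Real.sqrt (a θ) := by
  refine IsBigO.of_bound (Real.sqrt c) (Eventually.of_forall fun θ => ?_)
  rw [Real.norm_of_nonneg (Real.sqrt_nonneg _), ← Real.sqrt_mul hc]
  exact Real.le_sqrt_of_sq_le (hf θ)

theorem isBigO_totalNorm {E : Type*} [SeminormedAddCommGroup E]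
    {l : Filter (LoRAWeights m h n r)} {f : LoRAWeights m h n r → E}
    (hf : ∀ θ : LoRAWeights m h n r,
      ‖f θ‖ ^ 2 ≤ ‖θ.A₁‖ ^ 2 + ‖θ.B₁‖ ^ 2 + ‖θ.A₂‖ ^ 2 + ‖θ.B₂‖ ^ 2) :
    f =O[l] totalNorm :=
  isBigO_of_sq_le zero_le_one fun θ => by simpa using hf θ

theorem A₁_isBigO {l : Filter (LoRAWeights m h n r)} : A₁ =O[l] totalNorm :=
  isBigO_totalNorm fun θ => by nlinarith [sq_nonneg ‖θ.B₁‖, sq_nonneg ‖θ.A₂‖, sq_nonneg ‖θ.B₂‖]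

theorem B₁_isBigO {l : Filter (LoRAWeights m h n r)} : B₁ =O[l] totalNorm :=
  isBigO_totalNorm fun θ => by nlinarith [sq_nonneg ‖θ.A₁‖, sq_nonneg ‖θ.A₂‖, sq_nonneg ‖θ.B₂‖]

theorem A₂_isBigO {l : Filter (LoRAWeights m h n r)} : A₂ =O[l] totalNorm :=
  isBigO_totalNorm fun θ => by nlinarith [sq_nonneg ‖θ.B₁‖, sq_nonneg ‖θ.A₁‖, sq_nonneg ‖θ.B₂‖]

theorem B₂_isBigO {l : Filter (LoRAWeights m h n r)} : B₂ =O[l] totalNorm :=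
  isBigO_totalNorm fun θ => by nlinarith [sq_nonneg ‖θ.B₁‖, sq_nonneg ‖θ.A₂‖, sq_nonneg ‖θ.A₁‖]

/-- The size of the weights off the axes. -/
def offNorm (U : Matrix (Fin m) Unit ℝ) (G : Matrix (Fin h) Unit ℝ) (V : Matrix (Fin n) Unit ℝ)
    (θ : LoRAWeights m h n r) : ℝ := Real.sqrt (θ.offAxis U G V)

/-- The factor 2 is needed because the difference B₁ᵀG − A₁V enters `offAxis₁` with weight 1/2. -/
theorem isBigO_offNorm {E : Type*} [SeminormedAddCommGroup E]
    {l : Filter (LoRAWeights m h n r)} {f : LoRAWeights m h n r → E}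
    (hf : ∀ θ : LoRAWeights m h n r, ‖f θ‖ ^ 2 ≤ 2 * θ.offAxis U G V) :
    f =O[l] offNorm U G V := isBigO_of_sq_le zero_le_two hf

theorem projOff_B₁_isBigO {l : Filter (LoRAWeights m h n r)} :
    (fun θ : LoRAWeights m h n r => projOff G θ.B₁) =O[l] offNorm U G V :=
  isBigO_offNorm fun θ => by
    unfold offAxis offAxis₁ offAxis₂
    nlinarith [sq_nonneg ‖θ.B₁ᵀ * G - θ.A₁ * V‖, sq_nonneg ‖projOff G θ.B₁‖,
      sq_nonneg ‖projOff V θ.A₁ᵀ‖, sq_nonneg ‖projOff U θ.B₂‖, sq_nonneg ‖projOff G θ.A₂ᵀ‖]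

theorem projOff_A₁_isBigO {l : Filter (LoRAWeights m h n r)} :
    (fun θ : LoRAWeights m h n r => projOff V θ.A₁ᵀ) =O[l] offNorm U G V :=
  isBigO_offNorm fun θ => by
    unfold offAxis offAxis₁ offAxis₂
    nlinarith [sq_nonneg ‖θ.B₁ᵀ * G - θ.A₁ * V‖, sq_nonneg ‖projOff G θ.B₁‖,
      sq_nonneg ‖projOff V θ.A₁ᵀ‖, sq_nonneg ‖projOff U θ.B₂‖, sq_nonneg ‖projOff G θ.A₂ᵀ‖]

theorem projOff_B₂_isBigO {l : Filter (LoRAWeights m h n r)} :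
    (fun θ : LoRAWeights m h n r => projOff U θ.B₂) =O[l] offNorm U G V :=
  isBigO_offNorm fun θ => by
    unfold offAxis offAxis₁ offAxis₂
    nlinarith [sq_nonneg ‖θ.B₁ᵀ * G - θ.A₁ * V‖, sq_nonneg ‖projOff G θ.B₁‖,
      sq_nonneg ‖projOff V θ.A₁ᵀ‖, sq_nonneg ‖projOff U θ.B₂‖, sq_nonneg ‖projOff G θ.A₂ᵀ‖]

theorem projOff_A₂_isBigO {l : Filter (LoRAWeights m h n r)} :
    (fun θ : LoRAWeights m h n r => projOff G θ.A₂ᵀ) =O[l] offNorm U G V :=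
  isBigO_offNorm fun θ => by
    unfold offAxis offAxis₁ offAxis₂
    nlinarith [sq_nonneg ‖θ.B₁ᵀ * G - θ.A₁ * V‖, sq_nonneg ‖projOff G θ.B₁‖,
      sq_nonneg ‖projOff V θ.A₁ᵀ‖, sq_nonneg ‖projOff U θ.B₂‖, sq_nonneg ‖projOff G θ.A₂ᵀ‖]

theorem sub_isBigO {l : Filter (LoRAWeights m h n r)} :
    (fun θ : LoRAWeights m h n r => θ.B₁ᵀ * G - θ.A₁ * V) =O[l] offNorm U G V :=
  isBigO_offNorm fun θ => by
    unfold offAxis offAxis₁ offAxis₂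
    nlinarith [sq_nonneg ‖θ.B₁ᵀ * G - θ.A₁ * V‖, sq_nonneg ‖projOff G θ.B₁‖,
      sq_nonneg ‖projOff V θ.A₁ᵀ‖, sq_nonneg ‖projOff U θ.B₂‖, sq_nonneg ‖projOff G θ.A₂ᵀ‖]

theorem totalNorm_isBigO_one (R : ℝ) :
    (totalNorm (r := r)) =O[bounded m h n r R] fun _ => (1 : ℝ) := by
  refine IsBigO.of_bound R (mem_principal.2 fun θ hθ => ?_)
  simp only [Set.mem_ofPred_eq, norm_one, mul_one] at hθ ⊢
  rwa [totalNorm, Real.norm_of_nonneg (Real.sqrt_nonneg _)]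

theorem totalNorm_sq_isBigO_one (R : ℝ) :
    (fun θ => totalNorm (r := r) θ ^ 2) =O[bounded m h n r R] fun _ => (1 : ℝ) := by
  simpa using (totalNorm_isBigO_one R).pow 2

theorem B₁A₁_isBigO {l : Filter (LoRAWeights m h n r)} :
    (fun θ : LoRAWeights m h n r => θ.B₁ * θ.A₁) =O[l] fun θ => θ.totalNorm ^ 2 :=
  (B₁_isBigO.matMul A₁_isBigO).congr_right fun _ => (sq _).symm

theorem B₂A₂_isBigO {l : Filter (LoRAWeights m h n r)} :
    (fun θ : LoRAWeights m h n r => θ.B₂ * θ.A₂) =O[l] fun θ => θ.totalNorm ^ 2 :=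
  (B₂_isBigO.matMul A₂_isBigO).congr_right fun _ => (sq _).symm

theorem layer₁_isBigO (W₁ : Matrix (Fin h) (Fin n) ℝ) (R : ℝ) :
    layer₁ W₁ =O[bounded m h n r R] fun _ => (1 : ℝ) :=
  (matConst_isBigO_one W₁).add (B₁A₁_isBigO.trans (totalNorm_sq_isBigO_one R))

theorem layer₂_isBigO (W₂ : Matrix (Fin m) (Fin h) ℝ) (R : ℝ) :
    layer₂ W₂ =O[bounded m h n r R] fun _ => (1 : ℝ) :=
  (matConst_isBigO_one W₂).add (B₂A₂_isBigO.trans (totalNorm_sq_isBigO_one R))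

theorem residual_isBigO (W₂ : Matrix (Fin m) (Fin h) ℝ) (W₁ : Matrix (Fin h) (Fin n) ℝ)
    (Yft : Matrix (Fin m) (Fin n) ℝ) (R : ℝ) :
    residual W₂ W₁ Yft =O[bounded m h n r R] fun _ => (1 : ℝ) := by
  have := (layer₂_isBigO (r := r) W₂ R).matMul (layer₁_isBigO W₁ R)
  simp only [mul_one] at this
  exact (matConst_isBigO_one Yft).sub this

theorem _root_.Matrix.const_mul_isBigO {X ι κ μ : Type*} [Fintype ι] [Fintype κ] [Fintype μ]
    {l : Filter X} (W : Matrix ι κ ℝ) {f : X → Matrix κ μ ℝ} {a : X → ℝ} (hf : f =O[l] a) :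
    (fun x => W * f x) =O[l] a := by
  simpa using (matConst_isBigO_one W).matMul hf

theorem _root_.Matrix.mul_const_isBigO {X ι κ μ : Type*} [Fintype ι] [Fintype κ] [Fintype μ]
    {l : Filter X} (W : Matrix κ μ ℝ) {f : X → Matrix ι κ ℝ} {a : X → ℝ} (hf : f =O[l] a) :
    (fun x => f x * W) =O[l] a := by
  simpa using hf.matMul (matConst_isBigO_one W)

/-- The weights enter the residual only through B₁A₁ and B₂A₂, which are already quadratic. -/
theorem residual_sub_isBigO (hT : RankOneTask W₂ W₁ Yft U G V σ σ₁ σ₂) (R : ℝ) :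
    (fun θ => θ.residual W₂ W₁ Yft - σ • (U * Vᵀ)) =O[bounded m h n r R]
      fun θ => θ.totalNorm ^ 2 := by
  have h3 := (B₂A₂_isBigO (m := m) (h := h) (n := n) (r := r)).matMul (layer₁_isBigO W₁ R)
  simp only [mul_one] at h3
  refine ((Matrix.const_mul_isBigO W₂ B₁A₁_isBigO).add h3).neg_left.congr_left fun θ => ?_
  simp only [residual, hT.target, layer₂, layer₁, Matrix.add_mul, Matrix.mul_add]
  abel

/-- The initial residual σUVᵀ is multiplied by σ₂ here and by σ₁ in `force₂_sub_isBigO`. This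
difference in growth rate is the source of the imbalance between Z₁ and Z₂. -/
theorem force₁_sub_isBigO (hT : RankOneTask W₂ W₁ Yft U G V σ σ₁ σ₂) (R : ℝ) :
    (fun θ => θ.force₁ W₂ W₁ Yft - (σ * σ₂) • (G * Vᵀ)) =O[bounded m h n r R]
      fun θ => θ.totalNorm ^ 2 := by
  have h3 := (B₂A₂_isBigO (m := m) (h := h) (n := n) (r := r)).matTranspose.matMul
    (residual_isBigO W₂ W₁ Yft R)
  simp only [mul_one] at h3
  refine ((Matrix.const_mul_isBigO W₂ᵀ (residual_sub_isBigO hT R)).add h3).congr_left fun θ => ?_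
  have : W₂ᵀ * (σ • (U * Vᵀ)) = (σ * σ₂) • (G * Vᵀ) := by
    rw [Matrix.mul_smul, ← Matrix.mul_assoc, hT.W₂_transpose_mul, Matrix.smul_mul, smul_smul]
  rw [Matrix.mul_sub, this, force₁, layer₂, Matrix.transpose_add, Matrix.add_mul]
  abel

theorem force₂_sub_isBigO (hT : RankOneTask W₂ W₁ Yft U G V σ σ₁ σ₂) (R : ℝ) :
    (fun θ => θ.force₂ W₂ W₁ Yft - (σ * σ₁) • (U * Gᵀ)) =O[bounded m h n r R]
      fun θ => θ.totalNorm ^ 2 := by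
  have h3 := (residual_isBigO (r := r) W₂ W₁ Yft R).matMul
    (B₁A₁_isBigO (m := m) (h := h) (n := n) (r := r)).matTranspose
  simp only [one_mul] at h3
  refine ((Matrix.mul_const_isBigO W₁ᵀ (residual_sub_isBigO hT R)).add h3).congr_left fun θ => ?_
  have : (σ • (U * Vᵀ)) * W₁ᵀ = (σ * σ₁) • (U * Gᵀ) := by
    rw [Matrix.smul_mul, Matrix.mul_assoc, ← Matrix.transpose_mul, hT.W₁_mul,
      Matrix.transpose_smul, Matrix.mul_smul, smul_smul]
  rw [Matrix.sub_mul, this, force₂, layer₁, Matrix.transpose_add, Matrix.mul_add]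
  abel

end Estimates

end LoRAWeights
end

noncomputable section

open scoped Matrix.Norms.Frobenius

/-! ### Forces off the axes, and bounds for the growth rates. -/

namespace LoRAWeights

open Asymptotics Filter

variable {m h n r : ℕ} {W₂ : Matrix (Fin m) (Fin h) ℝ} {W₁ : Matrix (Fin h) (Fin n) ℝ}
  {Yft : Matrix (Fin m) (Fin n) ℝ} {U : Matrix (Fin m) Unit ℝ} {G : Matrix (Fin h) Unit ℝ}
  {V : Matrix (Fin n) Unit ℝ} {σ σ₁ σ₂ : ℝ}

/-- The pre-trained layer maps axis to axis, so only the off-axis part of one adapter factor, times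
the other factor, survives. The same holds for the other layer and for the transposes. -/
theorem projOff_layer₁_mul_isBigO (hT : RankOneTask W₂ W₁ Yft U G V σ σ₁ σ₂)
    {l : Filter (LoRAWeights m h n r)} :
    (fun θ => projOff G (θ.layer₁ W₁ * V)) =O[l] fun θ => θ.totalNorm * θ.offNorm U G V := by
  refine ((projOff_B₁_isBigO (U := U) (V := V)).matMul
    (Matrix.mul_const_isBigO V A₁_isBigO)).congr (fun θ => ?_) fun θ => mul_comm _ _
  rw [layer₁, Matrix.add_mul, hT.W₁_mul, projOff_add, projOff_smul, projOff_self hT.unit_G,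
    Matrix.mul_assoc, projOff_mul, smul_zero, zero_add]

theorem projOff_layer₁_transpose_mul_isBigO (hT : RankOneTask W₂ W₁ Yft U G V σ σ₁ σ₂)
    {l : Filter (LoRAWeights m h n r)} :
    (fun θ => projOff V ((θ.layer₁ W₁)ᵀ * G)) =O[l]
      fun θ => θ.totalNorm * θ.offNorm U G V := by
  refine ((projOff_A₁_isBigO (U := U) (G := G)).matMul
    (Matrix.mul_const_isBigO G B₁_isBigO.matTranspose)).congr (fun θ => ?_) fun θ => mul_comm _ _
  rw [layer₁, Matrix.transpose_add, Matrix.add_mul, hT.W₁_transpose_mul, projOff_add,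
    projOff_smul, projOff_self hT.unit_V, Matrix.transpose_mul, Matrix.mul_assoc, projOff_mul,
    smul_zero, zero_add]

theorem projOff_layer₂_mul_isBigO (hT : RankOneTask W₂ W₁ Yft U G V σ σ₁ σ₂)
    {l : Filter (LoRAWeights m h n r)} :
    (fun θ => projOff U (θ.layer₂ W₂ * G)) =O[l] fun θ => θ.totalNorm * θ.offNorm U G V := by
  refine ((projOff_B₂_isBigO (G := G) (V := V)).matMul
    (Matrix.mul_const_isBigO G A₂_isBigO)).congr (fun θ => ?_) fun θ => mul_comm _ _
  rw [layer₂, Matrix.add_mul, hT.W₂_mul, projOff_add, projOff_smul, projOff_self hT.unit_U,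
    Matrix.mul_assoc, projOff_mul, smul_zero, zero_add]

theorem projOff_layer₂_transpose_mul_isBigO (hT : RankOneTask W₂ W₁ Yft U G V σ σ₁ σ₂)
    {l : Filter (LoRAWeights m h n r)} :
    (fun θ => projOff G ((θ.layer₂ W₂)ᵀ * U)) =O[l]
      fun θ => θ.totalNorm * θ.offNorm U G V := by
  refine ((projOff_A₂_isBigO (U := U) (V := V)).matMul
    (Matrix.mul_const_isBigO U B₂_isBigO.matTranspose)).congr (fun θ => ?_) fun θ => mul_comm _ _
  rw [layer₂, Matrix.transpose_add, Matrix.add_mul, hT.W₂_transpose_mul, projOff_add,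
    projOff_smul, projOff_self hT.unit_G, Matrix.transpose_mul, Matrix.mul_assoc, projOff_mul,
    smul_zero, zero_add]

theorem _root_.RankOneTask.target_mul (hT : RankOneTask W₂ W₁ Yft U G V σ σ₁ σ₂) :
    Yft * V = (σ₁ * σ₂ + σ) • U := by
  rw [hT.target, Matrix.add_mul, Matrix.mul_assoc, hT.W₁_mul, Matrix.mul_smul, hT.W₂_mul,
    Matrix.smul_mul, Matrix.mul_assoc, hT.unit_V, Matrix.mul_one, smul_smul, add_smul]

theorem _root_.RankOneTask.target_transpose_mul (hT : RankOneTask W₂ W₁ Yft U G V σ σ₁ σ₂) :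
    Yftᵀ * U = (σ₂ * σ₁ + σ) • V := by
  rw [hT.target, Matrix.transpose_add, Matrix.add_mul, Matrix.transpose_mul, Matrix.mul_assoc,
    hT.W₂_transpose_mul, Matrix.mul_smul, hT.W₁_transpose_mul, Matrix.transpose_smul,
    Matrix.transpose_mul, Matrix.transpose_transpose, Matrix.smul_mul, Matrix.mul_assoc, hT.unit_U,
    Matrix.mul_one, smul_smul, add_smul]

/-- The target also maps axis to axis, so the error comes from the layers alone. Composing residual
and layers gives the same estimate for the forces. -/
theorem projOff_residual_mul_isBigO (hT : RankOneTask W₂ W₁ Yft U G V σ σ₁ σ₂) (R : ℝ) :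
    (fun θ => projOff U (θ.residual W₂ W₁ Yft * V)) =O[bounded m h n r R]
      fun θ => θ.totalNorm * θ.offNorm U G V := by
  have := projOff_mul_isBigO hT.unit_U (layer₂_isBigO (r := r) W₂ R)
    (Matrix.mul_const_isBigO V (layer₁_isBigO W₁ R)) (projOff_layer₂_mul_isBigO hT)
    (projOff_layer₁_mul_isBigO hT)
  refine this.neg_left.congr_left fun θ => ?_
  rw [residual, Matrix.sub_mul, hT.target_mul, projOff_sub, projOff_smul, projOff_self hT.unit_U,
    Matrix.mul_assoc, smul_zero, zero_sub]

theorem projOff_residual_transpose_mul_isBigO (hT : RankOneTask W₂ W₁ Yft U G V σ σ₁ σ₂) (R : ℝ) :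
    (fun θ => projOff V ((θ.residual W₂ W₁ Yft)ᵀ * U)) =O[bounded m h n r R]
      fun θ => θ.totalNorm * θ.offNorm U G V := by
  have := projOff_mul_isBigO hT.unit_V (layer₁_isBigO (r := r) W₁ R).matTranspose
    (Matrix.mul_const_isBigO U (layer₂_isBigO W₂ R).matTranspose)
    (projOff_layer₁_transpose_mul_isBigO hT) (projOff_layer₂_transpose_mul_isBigO hT)
  refine this.neg_left.congr_left fun θ => ?_
  rw [residual, Matrix.transpose_sub, Matrix.sub_mul, hT.target_transpose_mul, projOff_sub,
    projOff_smul, projOff_self hT.unit_V, Matrix.transpose_mul, Matrix.mul_assoc, smul_zero,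
    zero_sub]

theorem projOff_force₁_mul_isBigO (hT : RankOneTask W₂ W₁ Yft U G V σ σ₁ σ₂) (R : ℝ) :
    (fun θ => projOff G (θ.force₁ W₂ W₁ Yft * V)) =O[bounded m h n r R]
      fun θ => θ.totalNorm * θ.offNorm U G V := by
  refine (projOff_mul_isBigO hT.unit_G (layer₂_isBigO (r := r) W₂ R).matTranspose
    (Matrix.mul_const_isBigO V (residual_isBigO W₂ W₁ Yft R))
    (projOff_layer₂_transpose_mul_isBigO hT) (projOff_residual_mul_isBigO hT R)).congr_left
    fun θ => ?_
  rw [force₁, Matrix.mul_assoc]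

theorem projOff_force₁_transpose_mul_isBigO (hT : RankOneTask W₂ W₁ Yft U G V σ σ₁ σ₂) (R : ℝ) :
    (fun θ => projOff V ((θ.force₁ W₂ W₁ Yft)ᵀ * G)) =O[bounded m h n r R]
      fun θ => θ.totalNorm * θ.offNorm U G V := by
  refine (projOff_mul_isBigO hT.unit_V (residual_isBigO (r := r) W₂ W₁ Yft R).matTranspose
    (Matrix.mul_const_isBigO G (layer₂_isBigO W₂ R))
    (projOff_residual_transpose_mul_isBigO hT R) (projOff_layer₂_mul_isBigO hT)).congr_left
    fun θ => ?_
  rw [force₁, Matrix.transpose_mul, Matrix.transpose_transpose, Matrix.mul_assoc]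

theorem projOff_force₂_mul_isBigO (hT : RankOneTask W₂ W₁ Yft U G V σ σ₁ σ₂) (R : ℝ) :
    (fun θ => projOff U (θ.force₂ W₂ W₁ Yft * G)) =O[bounded m h n r R]
      fun θ => θ.totalNorm * θ.offNorm U G V := by
  refine (projOff_mul_isBigO hT.unit_U (residual_isBigO (r := r) W₂ W₁ Yft R)
    (Matrix.mul_const_isBigO G (layer₁_isBigO W₁ R).matTranspose)
    (projOff_residual_mul_isBigO hT R) (projOff_layer₁_transpose_mul_isBigO hT)).congr_left
    fun θ => ?_
  rw [force₂, Matrix.mul_assoc]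

theorem projOff_force₂_transpose_mul_isBigO (hT : RankOneTask W₂ W₁ Yft U G V σ σ₁ σ₂) (R : ℝ) :
    (fun θ => projOff G ((θ.force₂ W₂ W₁ Yft)ᵀ * U)) =O[bounded m h n r R]
      fun θ => θ.totalNorm * θ.offNorm U G V := by
  refine (projOff_mul_isBigO hT.unit_G (layer₁_isBigO (r := r) W₁ R)
    (Matrix.mul_const_isBigO U (residual_isBigO W₂ W₁ Yft R).matTranspose)
    (projOff_layer₁_mul_isBigO hT) (projOff_residual_transpose_mul_isBigO hT R)).congr_left
    fun θ => ?_
  rw [force₂, Matrix.transpose_mul, Matrix.transpose_transpose, Matrix.mul_assoc]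

theorem offNorm_sq (θ : LoRAWeights m h n r) : θ.offNorm U G V ^ 2 = θ.offAxis U G V :=
  Real.sq_sqrt (offAxis_nonneg U G V θ)

theorem totalNorm_sq_eq (hT : RankOneTask W₂ W₁ Yft U G V σ σ₁ σ₂) (θ : LoRAWeights m h n r) :
    θ.totalNorm ^ 2 = θ.signal G V + θ.bulk G V := by
  rw [totalNorm_sq, bulk]
  linarith [signal_add_offAxis₁ hT.unit_G hT.unit_V θ]

theorem force₁_transpose_sub_isBigO (hT : RankOneTask W₂ W₁ Yft U G V σ σ₁ σ₂) (R : ℝ) :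
    (fun θ => (θ.force₁ W₂ W₁ Yft)ᵀ - (σ * σ₂) • (V * Gᵀ)) =O[bounded m h n r R]
      fun θ => θ.totalNorm ^ 2 :=
  (force₁_sub_isBigO hT R).matTranspose.congr_left fun θ => by
    simp [Matrix.transpose_sub, Matrix.transpose_smul, Matrix.transpose_mul]

theorem force₂_transpose_sub_isBigO (hT : RankOneTask W₂ W₁ Yft U G V σ σ₁ σ₂) (R : ℝ) :
    (fun θ => (θ.force₂ W₂ W₁ Yft)ᵀ - (σ * σ₁) • (G * Uᵀ)) =O[bounded m h n r R]
      fun θ => θ.totalNorm ^ 2 :=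
  (force₂_sub_isBigO hT R).matTranspose.congr_left fun θ => by
    simp [Matrix.transpose_sub, Matrix.transpose_smul, Matrix.transpose_mul]

/-- There is no linear term: the projection kills the rank-one part of the force, and what remains
is quadratic in the weights times off-axis quantities. -/
theorem offAxis₂Rate_isBigO (hT : RankOneTask W₂ W₁ Yft U G V σ σ₁ σ₂) (R : ℝ) :
    (fun θ => θ.offAxis₂Rate W₂ W₁ Yft U G) =O[bounded m h n r R]
      fun θ => (θ.signal G V + θ.bulk G V) * θ.offAxis U G V := by
  have h1 := (projOff_B₂_isBigO (r := r) (U := U) (G := G) (V := V)).matInner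
    (projOff_mul_isBigO_of_rankOne (b := U) (a := G) hT.unit_U _ (force₂_sub_isBigO hT R)
      (projOff_force₂_mul_isBigO hT R) A₂_isBigO.matTranspose projOff_A₂_isBigO)
  have h2 := (projOff_A₂_isBigO (r := r) (U := U) (G := G) (V := V)).matInner
    (projOff_mul_isBigO_of_rankOne (b := G) (a := U) hT.unit_G _ (force₂_transpose_sub_isBigO hT R)
      (projOff_force₂_transpose_mul_isBigO hT R) B₂_isBigO projOff_B₂_isBigO)
  refine ((h1.const_mul_left 2).add (h2.const_mul_left 2)).congr_right fun θ => ?_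
  rw [← totalNorm_sq_eq hT, ← offNorm_sq]; ring

/-- The component of Z₁ along (G, −V) is damped at first order. In the remainder the same scalar
GᵀNV multiplies both B₁ᵀG and A₁V, N being the nonlinear part of the force. So the signal-sized
contributions combine into a multiple of the difference B₁ᵀG − A₁V, and every term contains an
off-axis factor. -/
theorem offAxis₁Rate_eq (hT : RankOneTask W₂ W₁ Yft U G V σ σ₁ σ₂) (θ : LoRAWeights m h n r) :
    matInner (θ.B₁ᵀ * G - θ.A₁ * V)
      (θ.A₁ * ((θ.force₁ W₂ W₁ Yft)ᵀ * G) - θ.B₁ᵀ * (θ.force₁ W₂ W₁ Yft * V))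
    = -(σ * σ₂) * ‖θ.B₁ᵀ * G - θ.A₁ * V‖ ^ 2
      + matInner (θ.B₁ᵀ * G - θ.A₁ * V)
        ((projOff V θ.A₁ᵀ)ᵀ * (((θ.force₁ W₂ W₁ Yft)ᵀ - (σ * σ₂) • (V * Gᵀ)) * G)
        - (projOff G θ.B₁)ᵀ * ((θ.force₁ W₂ W₁ Yft - (σ * σ₂) • (G * Vᵀ)) * V)
        - (θ.B₁ᵀ * G - θ.A₁ * V)
          * (Gᵀ * ((θ.force₁ W₂ W₁ Yft - (σ * σ₂) • (G * Vᵀ)) * V))) := by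
  obtain ⟨N, hN⟩ : ∃ N, N = θ.force₁ W₂ W₁ Yft - (σ * σ₂) • (G * Vᵀ) := ⟨_, rfl⟩
  have hF : θ.force₁ W₂ W₁ Yft = (σ * σ₂) • (G * Vᵀ) + N := by rw [hN]; abel
  have hNt : (θ.force₁ W₂ W₁ Yft)ᵀ - (σ * σ₂) • (V * Gᵀ) = Nᵀ := by
    simp [hN, Matrix.transpose_sub, Matrix.transpose_smul, Matrix.transpose_mul]
  have hFt : (θ.force₁ W₂ W₁ Yft)ᵀ = (σ * σ₂) • (V * Gᵀ) + Nᵀ := by rw [← hNt]; abel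
  rw [hNt, ← hN, hFt, hF, ← matInner_self, neg_mul, ← matInner_smul_right, ← sub_eq_neg_add, ← matInner_sub_right]
  congr 1
  have hscal : Vᵀ * (Nᵀ * G) = Gᵀ * (N * V) := by
    rw [← transpose_unit_matrix (Gᵀ * (N * V))]
    simp only [Matrix.transpose_mul, Matrix.transpose_transpose, Matrix.mul_assoc]
  have hA : θ.A₁ * (Nᵀ * G) = (projOff V θ.A₁ᵀ)ᵀ * (Nᵀ * G) + θ.A₁ * V * (Gᵀ * (N * V)) := by
    rw [← hscal, projOff, Matrix.transpose_sub, Matrix.sub_mul]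
    simp only [Matrix.transpose_mul, Matrix.transpose_transpose, Matrix.mul_assoc]
    abel
  have hB : θ.B₁ᵀ * (N * V) = (projOff G θ.B₁)ᵀ * (N * V) + θ.B₁ᵀ * G * (Gᵀ * (N * V)) := by
    rw [projOff, Matrix.transpose_sub, Matrix.sub_mul]
    simp only [Matrix.transpose_mul, Matrix.transpose_transpose, Matrix.mul_assoc]
    abel
  have e1 : V * Gᵀ * G = V := by rw [Matrix.mul_assoc, hT.unit_G, Matrix.mul_one]
  have e2 : G * Vᵀ * V = G := by rw [Matrix.mul_assoc, hT.unit_V, Matrix.mul_one]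
  rw [Matrix.add_mul, Matrix.add_mul, Matrix.smul_mul, Matrix.smul_mul, e1, e2, Matrix.mul_add,
    Matrix.mul_add, hA, hB, Matrix.sub_mul, Matrix.mul_smul, Matrix.mul_smul, smul_sub]
  abel

/-- The bound is one-sided because the damping term along (G, −V) is discarded. -/
theorem offAxis₁Rate_le (hT : RankOneTask W₂ W₁ Yft U G V σ σ₁ σ₂) (hσ : 0 ≤ σ * σ₂) (R : ℝ) :
    ∃ C ≥ 0, ∀ θ : LoRAWeights m h n r, θ.totalNorm ≤ R →
      θ.offAxis₁Rate W₂ W₁ Yft G V ≤ C * ((θ.signal G V + θ.bulk G V) * θ.offAxis U G V) := by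
  have hN := force₁_sub_isBigO (r := r) hT R
  have hNt := force₁_transpose_sub_isBigO (r := r) hT R
  have hd := sub_isBigO (U := U) (G := G) (V := V) (l := bounded m h n r R)
  have h0 : (fun θ : LoRAWeights m h n r => matInner (θ.B₁ᵀ * G - θ.A₁ * V)
        ((projOff V θ.A₁ᵀ)ᵀ * (((θ.force₁ W₂ W₁ Yft)ᵀ - (σ * σ₂) • (V * Gᵀ)) * G)
        - (projOff G θ.B₁)ᵀ * ((θ.force₁ W₂ W₁ Yft - (σ * σ₂) • (G * Vᵀ)) * V)
        - (θ.B₁ᵀ * G - θ.A₁ * V)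
          * (Gᵀ * ((θ.force₁ W₂ W₁ Yft - (σ * σ₂) • (G * Vᵀ)) * V))))
      =O[bounded m h n r R] fun θ => θ.offNorm U G V * (θ.offNorm U G V * θ.totalNorm ^ 2) := by
    refine hd.matInner (IsBigO.sub (IsBigO.sub ?_ ?_) ?_)
    · exact projOff_A₁_isBigO.matTranspose.matMul (Matrix.mul_const_isBigO G hNt)
    · exact projOff_B₁_isBigO.matTranspose.matMul (Matrix.mul_const_isBigO V hN)
    · exact hd.matMul (Matrix.const_mul_isBigO Gᵀ (Matrix.mul_const_isBigO V hN))
  have h1 := (projOff_B₁_isBigO (U := U) (G := G) (V := V)).matInner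
    (projOff_mul_isBigO_of_rankOne (b := G) (a := V) hT.unit_G _ hN
      (projOff_force₁_mul_isBigO hT R) A₁_isBigO.matTranspose projOff_A₁_isBigO)
  have h2 := (projOff_A₁_isBigO (U := U) (G := G) (V := V)).matInner
    (projOff_mul_isBigO_of_rankOne (b := V) (a := G) hT.unit_V _ hNt
      (projOff_force₁_transpose_mul_isBigO hT R) B₁_isBigO projOff_B₁_isBigO)
  have h3 := (h0.congr_right fun θ => (?_ :
    _ = (θ.signal G V + θ.bulk G V) * θ.offAxis U G V)).add
    ((((h1.const_mul_left 2).add (h2.const_mul_left 2))).congr_right fun θ => (?_ :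
    _ = (θ.signal G V + θ.bulk G V) * θ.offAxis U G V))
  · obtain ⟨C, hC, hb⟩ := exists_bound_of_isBigO h3 fun θ => mul_nonneg
      (add_nonneg (signal_nonneg G V θ) (bulk_nonneg G V θ)) (offAxis_nonneg U G V θ)
    refine ⟨C, hC, fun θ hθ => ?_⟩
    have := (le_abs_self _).trans (hb θ hθ)
    rw [offAxis₁Rate, offAxis₁Rate_eq hT]
    nlinarith [mul_nonneg hσ (sq_nonneg ‖θ.B₁ᵀ * G - θ.A₁ * V‖)]
  · rw [← totalNorm_sq_eq hT, ← offNorm_sq]; ring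
  · rw [← totalNorm_sq_eq hT, ← offNorm_sq]; ring

/-- The leading term is 4σσ₁⟨B₂A₂, UGᵀ⟩ ≤ 4σσ₁‖B₂‖‖A₂‖, and the arithmetic-geometric inequality
gives the rate 2σσ₁. -/
theorem sizeRate_le (hT : RankOneTask W₂ W₁ Yft U G V σ σ₁ σ₂) (hσ : 0 ≤ σ * σ₁) (R : ℝ) :
    ∃ C ≥ 0, ∀ θ : LoRAWeights m h n r, θ.totalNorm ≤ R →
      θ.sizeRate W₂ W₁ Yft ≤ 2 * (σ * σ₁) * (‖θ.A₂‖ ^ 2 + ‖θ.B₂‖ ^ 2)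
        + C * ((θ.signal G V + θ.bulk G V) * θ.bulk G V) := by
  have hB : (B₂ : LoRAWeights m h n r → _) =O[bounded m h n r R]
      fun θ => Real.sqrt (θ.bulk G V) :=
    isBigO_of_sq_le zero_le_one fun θ => by
      have := offAxis₁_nonneg G V θ
      unfold bulk; nlinarith [sq_nonneg ‖θ.A₂‖]
  have hA : (A₂ : LoRAWeights m h n r → _) =O[bounded m h n r R]
      fun θ => Real.sqrt (θ.bulk G V) :=
    isBigO_of_sq_le zero_le_one fun θ => by
      have := offAxis₁_nonneg G V θ
      unfold bulk; nlinarith [sq_nonneg ‖θ.B₂‖]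
  have h := ((hB.matMul hA).matInner (force₂_sub_isBigO hT R)).const_mul_left 4
  have h' := h.congr_right fun θ => (?_ : _ = (θ.signal G V + θ.bulk G V) * θ.bulk G V)
  · obtain ⟨C, hC, hb⟩ := exists_bound_of_isBigO h' fun θ => mul_nonneg
      (add_nonneg (signal_nonneg G V θ) (bulk_nonneg G V θ)) (bulk_nonneg G V θ)
    refine ⟨C, hC, fun θ hθ => ?_⟩
    have := (le_abs_self _).trans (hb θ hθ)
    rw [matInner_sub_right, matInner_smul_right] at this
    have h1 : matInner (θ.B₂ * θ.A₂) (U * Gᵀ) ≤ ‖θ.B₂‖ * ‖θ.A₂‖ := by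
      rw [matInner_comm, matInner_mul_left, matInner_comm]
      have e : matInner (Uᵀ * (θ.B₂ * θ.A₂)) Gᵀ = matInner (Uᵀ * θ.B₂) (Gᵀ * θ.A₂ᵀ) := by
        rw [← Matrix.mul_assoc, matInner_mul_right]
      rw [e]
      refine (le_abs_self _).trans ((abs_matInner_le _ _).trans ?_)
      have h1 := norm_transpose_mul_le hT.unit_U θ.B₂
      have h2 := norm_transpose_mul_le hT.unit_G θ.A₂ᵀ
      rw [Matrix.frobenius_norm_transpose] at h2
      gcongr
    rw [sizeRate]
    nlinarith [mul_le_mul_of_nonneg_left h1 hσ,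
      mul_nonneg hσ (sq_nonneg (‖θ.A₂‖ - ‖θ.B₂‖))]
  · rw [← totalNorm_sq_eq hT]
    rw [show ∀ a b : ℝ, a * a * b = a ^ 2 * b by intros; ring, Real.sq_sqrt (bulk_nonneg G V θ)]
    ring

/-- The vector B₁ᵀG + A₁V is an eigenvector of the linearized flow with rate σσ₂. Only A₁ and B₁
multiply the nonlinear part of the force, hence the factor `signal + offAxis` rather than `signal +
bulk`. -/
theorem signalRate_sub_isBigO (hT : RankOneTask W₂ W₁ Yft U G V σ σ₁ σ₂) (R : ℝ) :
    (fun θ => θ.signalRate W₂ W₁ Yft G V - 2 * (σ * σ₂) * θ.signal G V) =O[bounded m h n r R]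
      fun θ => (θ.signal G V + θ.bulk G V) * (θ.signal G V + θ.offAxis U G V) := by
  have hs : ∀ θ : LoRAWeights m h n r, 0 ≤ θ.signal G V + θ.offAxis U G V := fun θ =>
    add_nonneg (signal_nonneg G V θ) (offAxis_nonneg U G V θ)
  have hsum := fun θ : LoRAWeights m h n r => signal_add_offAxis₁ hT.unit_G hT.unit_V θ
  have h2 := fun θ : LoRAWeights m h n r => offAxis₂_nonneg U G θ
  have hB : (B₁ : LoRAWeights m h n r → _) =O[bounded m h n r R]
      fun θ => Real.sqrt (θ.signal G V + θ.offAxis U G V) :=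
    isBigO_of_sq_le zero_le_one fun θ => by
      unfold offAxis; nlinarith [sq_nonneg ‖θ.A₁‖, hsum θ, h2 θ]
  have hA : (A₁ : LoRAWeights m h n r → _) =O[bounded m h n r R]
      fun θ => Real.sqrt (θ.signal G V + θ.offAxis U G V) :=
    isBigO_of_sq_le zero_le_one fun θ => by
      unfold offAxis; nlinarith [sq_nonneg ‖θ.B₁‖, hsum θ, h2 θ]
  have hN := force₁_sub_isBigO (r := r) hT R
  have hNt := force₁_transpose_sub_isBigO (r := r) hT R
  refine (((Matrix.mul_const_isBigO G hB.matTranspose).add (Matrix.mul_const_isBigO V hA)).matInner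
    ((hA.matMul (Matrix.mul_const_isBigO G hNt)).add
      (hB.matTranspose.matMul (Matrix.mul_const_isBigO V hN)))).congr (fun θ => ?_) fun θ => ?_
  · have e1 : V * Gᵀ * G = V := by rw [Matrix.mul_assoc, hT.unit_G, Matrix.mul_one]
    have e2 : G * Vᵀ * V = G := by rw [Matrix.mul_assoc, hT.unit_V, Matrix.mul_one]
    have e3 : θ.signal G V
        = matInner (θ.B₁ᵀ * G + θ.A₁ * V) (θ.B₁ᵀ * G + θ.A₁ * V) / 2 := by
      rw [matInner_self, signal]
    rw [signalRate, e3, show ∀ a b : ℝ, 2 * a * (b / 2) = a * b by intros; ring,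
      ← matInner_smul_right, ← matInner_sub_right]
    congr 1
    rw [Matrix.sub_mul, Matrix.sub_mul, Matrix.smul_mul, Matrix.smul_mul, e1, e2, Matrix.mul_sub,
      Matrix.mul_sub, Matrix.mul_smul, Matrix.mul_smul, smul_add]
    abel
  · rw [← totalNorm_sq_eq hT, ← mul_assoc, Real.mul_self_sqrt (hs θ), mul_comm]

end LoRAWeights
end

noncomputable section

open scoped Matrix.Norms.Frobenius

/-! ### Growth of the signal up to order one, and the combined differential inequalities. -/

namespace LoRAWeights

open Asymptotics Filter

variable {m h n r : ℕ} {W₂ : Matrix (Fin m) (Fin h) ℝ} {W₁ : Matrix (Fin h) (Fin n) ℝ}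
  {Yft : Matrix (Fin m) (Fin n) ℝ} {U : Matrix (Fin m) Unit ℝ} {G : Matrix (Fin h) Unit ℝ}
  {V : Matrix (Fin n) Unit ℝ} {σ σ₁ σ₂ : ℝ}

/-- An exact expansion, kept exact because the signal need not be small: the on-axis residual is σ −
σ₂x with x = ⟨B₁ᵀG, A₁V⟩, and every other term contains B₂ or the off-axis part of B₁. -/
theorem residual_mul_eq (hT : RankOneTask W₂ W₁ Yft U G V σ σ₁ σ₂) (θ : LoRAWeights m h n r) :
    Uᵀ * (θ.residual W₂ W₁ Yft * V)
      = σ • (1 : Matrix Unit Unit ℝ) - σ₂ • ((θ.B₁ᵀ * G)ᵀ * (θ.A₁ * V))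
        - (Uᵀ * (θ.B₂ * (θ.A₂ * G) * (σ₁ • (1 : Matrix Unit Unit ℝ) + (θ.B₁ᵀ * G)ᵀ * (θ.A₁ * V)))
          + Uᵀ * (θ.layer₂ W₂ * (projOff G θ.B₁ * (θ.A₁ * V)))) := by
  have e1 : θ.layer₁ W₁ * V = G * (σ₁ • (1 : Matrix Unit Unit ℝ) + (θ.B₁ᵀ * G)ᵀ * (θ.A₁ * V))
      + projOff G θ.B₁ * (θ.A₁ * V) := by
    rw [layer₁, Matrix.add_mul, hT.W₁_mul, Matrix.mul_add, Matrix.mul_smul, Matrix.mul_one,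
      projOff, Matrix.sub_mul]
    simp only [Matrix.transpose_mul, Matrix.transpose_transpose, Matrix.mul_assoc]
    abel
  have e2 : θ.layer₂ W₂ * G = σ₂ • U + θ.B₂ * (θ.A₂ * G) := by
    rw [layer₂, Matrix.add_mul, hT.W₂_mul, Matrix.mul_assoc]
  rw [residual, Matrix.sub_mul, hT.target_mul, Matrix.mul_assoc, e1, Matrix.mul_add,
    ← Matrix.mul_assoc (θ.layer₂ W₂) G, e2, Matrix.add_mul, Matrix.mul_sub, Matrix.mul_add,
    Matrix.mul_add, Matrix.mul_smul, hT.unit_U, Matrix.smul_mul, Matrix.mul_smul,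
    ← Matrix.mul_assoc Uᵀ U, hT.unit_U, Matrix.one_mul]
  module

theorem force₁_axis_sub_isBigO (hT : RankOneTask W₂ W₁ Yft U G V σ σ₁ σ₂) (R : ℝ) :
    (fun θ => Gᵀ * (θ.force₁ W₂ W₁ Yft * V)
      - σ₂ • (σ • (1 : Matrix Unit Unit ℝ) - σ₂ • ((θ.B₁ᵀ * G)ᵀ * (θ.A₁ * V))))
      =O[bounded m h n r R] fun θ => Real.sqrt (θ.bulk G V) := by
  have hA₂ : (A₂ : LoRAWeights m h n r → _) =O[bounded m h n r R] fun _ => (1 : ℝ) :=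
    A₂_isBigO.trans (totalNorm_isBigO_one R)
  have hA₁ : (A₁ : LoRAWeights m h n r → _) =O[bounded m h n r R] fun _ => (1 : ℝ) :=
    A₁_isBigO.trans (totalNorm_isBigO_one R)
  have hB₁ : (B₁ : LoRAWeights m h n r → _) =O[bounded m h n r R] fun _ => (1 : ℝ) :=
    B₁_isBigO.trans (totalNorm_isBigO_one R)
  have hB₂ : (B₂ : LoRAWeights m h n r → _) =O[bounded m h n r R]
      fun θ => Real.sqrt (θ.bulk G V) :=
    isBigO_of_sq_le zero_le_one fun θ => by
      have := offAxis₁_nonneg G V θ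
      unfold bulk; nlinarith [sq_nonneg ‖θ.A₂‖]
  have hp : (fun θ : LoRAWeights m h n r => projOff G θ.B₁) =O[bounded m h n r R]
      fun θ => Real.sqrt (θ.bulk G V) :=
    isBigO_of_sq_le zero_le_one fun θ => by
      unfold bulk offAxis₁
      nlinarith [sq_nonneg ‖θ.A₂‖, sq_nonneg ‖θ.B₂‖, sq_nonneg ‖θ.B₁ᵀ * G - θ.A₁ * V‖,
        sq_nonneg ‖projOff V θ.A₁ᵀ‖]
  have hT2 := hB₂.matMul (Matrix.mul_const_isBigO G hA₂)
  have hx := (Matrix.mul_const_isBigO G hB₁.matTranspose).matTranspose.matMul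
    (Matrix.mul_const_isBigO V hA₁)
  simp only [mul_one] at hT2 hx
  have h1 := hT2.matMul ((matConst_isBigO_one (σ₁ • (1 : Matrix Unit Unit ℝ))).add hx)
  have h2 := (layer₂_isBigO (r := r) W₂ R).matMul
    (hp.matMul (Matrix.mul_const_isBigO V hA₁))
  have h3 := hT2.matTranspose.matMul (Matrix.mul_const_isBigO V (residual_isBigO W₂ W₁ Yft R))
  simp only [mul_one, one_mul] at h1 h2 h3
  refine ((((Matrix.const_mul_isBigO Uᵀ h1).add (Matrix.const_mul_isBigO Uᵀ h2)).const_smul_left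
    (-σ₂)).add h3).congr_left fun θ => ?_
  have e : Gᵀ * (θ.force₁ W₂ W₁ Yft * V) = σ₂ • (Uᵀ * (θ.residual W₂ W₁ Yft * V))
      + (θ.B₂ * (θ.A₂ * G))ᵀ * (θ.residual W₂ W₁ Yft * V) := by
    rw [← Matrix.smul_mul, ← Matrix.add_mul, ← Matrix.transpose_smul, ← Matrix.transpose_add,
      ← hT.W₂_mul, ← Matrix.mul_assoc θ.B₂, ← Matrix.add_mul, Matrix.transpose_mul, force₁, layer₂]
    simp only [Matrix.mul_assoc]
  rw [e, residual_mul_eq hT]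
  simp only [Pi.smul_apply]
  module

theorem unit_smul_one_sub_apply (a b : ℝ) (x y : Matrix (Fin r) Unit ℝ) :
    (b • (a • (1 : Matrix Unit Unit ℝ) - b • (xᵀ * y))) () () = b * (a - b * matInner x y) := by
  simp [matInner, Matrix.mul_apply]

/-- Once the signal has order one, the error F² in `signalRate_sub_isBigO` is no longer small. Here
the force along the axis is evaluated at its true value σ₂(σ − σ₂x), which remains positive up to
the stopping threshold. -/
theorem signalRate_ge (hT : RankOneTask W₂ W₁ Yft U G V σ σ₁ σ₂) (R : ℝ) :
    ∃ C ≥ 0, ∀ θ : LoRAWeights m h n r, θ.totalNorm ≤ R →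
      2 * (σ₂ * (σ - σ₂ * matInner (θ.B₁ᵀ * G) (θ.A₁ * V)) - C * Real.sqrt (θ.bulk G V))
        * θ.signal G V - C * θ.offAxis U G V ≤ θ.signalRate W₂ W₁ Yft G V := by
  have hpq : (fun θ : LoRAWeights m h n r => θ.B₁ᵀ * G + θ.A₁ * V) =O[bounded m h n r R]
      fun _ => (1 : ℝ) :=
    ((Matrix.mul_const_isBigO G B₁_isBigO.matTranspose).add
      (Matrix.mul_const_isBigO V A₁_isBigO)).trans (totalNorm_isBigO_one R)
  have h1 := (projOff_A₁_isBigO (r := r) (U := U) (G := G) (V := V)).matTranspose.matMul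
    (projOff_force₁_transpose_mul_isBigO hT R)
  have h2 := (projOff_B₁_isBigO (r := r) (U := U) (G := G) (V := V)).matTranspose.matMul
    (projOff_force₁_mul_isBigO hT R)
  have h3 := (totalNorm_isBigO_one (m := m) (h := h) (n := n) (r := r) R).mul
    (isBigO_refl (fun θ => θ.offAxis U G V) _)
  simp only [one_mul] at h3
  have h4 := hpq.matInner (((h1.add h2).congr_right fun θ => (?_ :
    _ = θ.totalNorm * θ.offAxis U G V)).trans h3)
  · simp only [one_mul] at h4
    obtain ⟨C₁, hC₁, hb₁⟩ := exists_bound_of_isBigO h4 fun θ => offAxis_nonneg U G V θ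
    obtain ⟨C₂, hC₂, hb₂⟩ := exists_bound_of_isBigO (force₁_axis_sub_isBigO (r := r) hT R).norm_left
      fun θ => Real.sqrt_nonneg _
    refine ⟨max C₁ C₂, le_max_of_le_left hC₁, fun θ hθ => ?_⟩
    have hb1 := hb₁ θ hθ
    have hb2 := hb₂ θ hθ
    rw [abs_of_nonneg (norm_nonneg _), ← abs_apply_le_norm, Matrix.sub_apply,
      unit_smul_one_sub_apply] at hb2
    have hscal : Vᵀ * ((θ.force₁ W₂ W₁ Yft)ᵀ * G) = Gᵀ * (θ.force₁ W₂ W₁ Yft * V) := by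
      rw [← transpose_unit_matrix (Gᵀ * _)]
      simp only [Matrix.transpose_mul, Matrix.transpose_transpose, Matrix.mul_assoc]
    have key : θ.signalRate W₂ W₁ Yft G V
        = 2 * (Gᵀ * (θ.force₁ W₂ W₁ Yft * V)) () () * θ.signal G V
        + matInner (θ.B₁ᵀ * G + θ.A₁ * V)
          ((projOff V θ.A₁ᵀ)ᵀ * projOff V ((θ.force₁ W₂ W₁ Yft)ᵀ * G)
            + (projOff G θ.B₁)ᵀ * projOff G (θ.force₁ W₂ W₁ Yft * V)) := by
      rw [signal, show ∀ a b : ℝ, 2 * a * (b / 2) = a * b by intros; ring, ← matInner_self_mul,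
        ← matInner_add_right, signalRate]
      congr 1
      rw [transpose_projOff_mul hT.unit_V, transpose_projOff_mul hT.unit_G, Matrix.add_mul,
        projOff, projOff, Matrix.transpose_sub, Matrix.transpose_sub, Matrix.sub_mul,
        Matrix.sub_mul]
      nth_rewrite 2 [← hscal]
      simp only [Matrix.transpose_mul, Matrix.transpose_transpose, Matrix.mul_assoc]
      abel
    rw [key]
    have hF := signal_nonneg G V θ
    have hQ := offAxis_nonneg U G V θ
    have hs := Real.sqrt_nonneg (θ.bulk G V)
    have a1 := (abs_le.1 hb1).1
    have a2 := (abs_le.1 hb2).1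
    have a3 : C₁ * θ.offAxis U G V ≤ max C₁ C₂ * θ.offAxis U G V := by gcongr; exact le_max_left _ _
    have a4 : C₂ * Real.sqrt (θ.bulk G V) ≤ max C₁ C₂ * Real.sqrt (θ.bulk G V) := by
      gcongr; exact le_max_right _ _
    have a5 := mul_le_mul_of_nonneg_right (a2.trans' (neg_le_neg a4)) hF
    nlinarith
  · rw [← offNorm_sq]; ring

/-- The differential inequalities satisfied by the sizes of the parts of the weights. -/
theorem rates_bounds (hT : RankOneTask W₂ W₁ Yft U G V σ σ₁ σ₂) (hσ : 0 < σ) (hσ₁ : 0 ≤ σ₁)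
    (hσ₂ : 0 < σ₂) {c : ℝ} (hc : σ₂ * c ≤ σ / 4) :
    ∃ C ≥ 0, ∃ s > 0, s ≤ 1 ∧ ∀ θ : LoRAWeights m h n r,
      matInner (θ.B₁ᵀ * G) (θ.A₁ * V) ≤ c → θ.bulk G V ≤ s →
      |θ.signalRate W₂ W₁ Yft G V - 2 * (σ * σ₂) * θ.signal G V|
        ≤ C * ((θ.signal G V + θ.bulk G V) * (θ.signal G V + θ.offAxis U G V)) ∧
      σ * σ₂ * θ.signal G V - C * θ.offAxis U G V ≤ θ.signalRate W₂ W₁ Yft G V ∧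
      θ.sizeRate W₂ W₁ Yft + θ.offAxis₁Rate W₂ W₁ Yft G V
        ≤ 2 * (σ * σ₁) * θ.bulk G V + C * ((θ.signal G V + θ.bulk G V) * θ.bulk G V) ∧
      θ.offAxis₁Rate W₂ W₁ Yft G V + θ.offAxis₂Rate W₂ W₁ Yft U G
        ≤ C * ((θ.signal G V + θ.bulk G V) * θ.offAxis U G V) := by
  -- The squared norm of all weights is F + P ≤ 2x + P + P, hence at most 2c + 2 when x ≤ c and P ≤
  -- 1.
  set R := Real.sqrt (2 * c + 2)
  have hFP : ∀ θ : LoRAWeights m h n r, 0 ≤ θ.signal G V + θ.bulk G V := fun θ =>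
    add_nonneg (signal_nonneg G V θ) (bulk_nonneg G V θ)
  obtain ⟨C₁, hC₁, h₁⟩ := exists_bound_of_isBigO (signalRate_sub_isBigO (r := r) hT R)
    fun θ => mul_nonneg (hFP θ) (add_nonneg (signal_nonneg G V θ) (offAxis_nonneg U G V θ))
  obtain ⟨C₂, hC₂, h₂⟩ := signalRate_ge (r := r) hT R
  obtain ⟨C₃, hC₃, h₃⟩ := sizeRate_le (r := r) hT (mul_nonneg hσ.le hσ₁) R
  obtain ⟨C₄, hC₄, h₄⟩ := offAxis₁Rate_le (r := r) hT (mul_pos hσ hσ₂).le R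
  obtain ⟨C₅, hC₅, h₅⟩ := exists_bound_of_isBigO (offAxis₂Rate_isBigO (r := r) hT R)
    fun θ => mul_nonneg (hFP θ) (offAxis_nonneg U G V θ)
  have hl : 0 < σ * σ₂ := mul_pos hσ hσ₂
  -- The bound on P is chosen so that C₂√P ≤ σσ₂/4. Together with σ₂x ≤ σ/4 this leaves the growth
  -- rate 2(3/4 − 1/4)σσ₂ = σσ₂.
  refine ⟨C₁ + C₂ + C₃ + C₄ + C₅, by positivity, min 1 ((σ * σ₂ / (4 * (C₂ + 1))) ^ 2),
    by positivity, min_le_left _ _, fun θ hx hP => ?_⟩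
  have hF := signal_nonneg G V θ
  have hQ := offAxis_nonneg U G V θ
  have hPn := bulk_nonneg G V θ
  have hQP := offAxis_le_bulk hT.unit_U hT.unit_G V θ
  have hP1 := hP.trans (min_le_left _ _)
  have hsq : Real.sqrt (θ.bulk G V) ≤ σ * σ₂ / (4 * (C₂ + 1)) :=
    Real.sqrt_le_iff.2 ⟨by positivity, hP.trans (min_le_right _ _)⟩
  have hd : ‖θ.B₁ᵀ * G - θ.A₁ * V‖ ^ 2 / 2 ≤ θ.bulk G V := by
    unfold bulk offAxis₁
    nlinarith [sq_nonneg ‖θ.A₂‖, sq_nonneg ‖θ.B₂‖, sq_nonneg ‖projOff G θ.B₁‖,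
      sq_nonneg ‖projOff V θ.A₁ᵀ‖]
  have hN : θ.totalNorm ≤ R := by
    refine Real.le_sqrt_of_sq_le ?_
    rw [totalNorm_sq_eq hT, signal_eq_two_mul_add]
    linarith
  have m1 : 0 ≤ (θ.signal G V + θ.bulk G V) * (θ.signal G V + θ.offAxis U G V) :=
    mul_nonneg (hFP θ) (by linarith)
  have m2 : 0 ≤ (θ.signal G V + θ.bulk G V) * θ.offAxis U G V := mul_nonneg (hFP θ) hQ
  have m3 : (θ.signal G V + θ.bulk G V) * θ.offAxis U G V
      ≤ (θ.signal G V + θ.bulk G V) * θ.bulk G V := mul_le_mul_of_nonneg_left hQP (hFP θ)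
  have m4 := m2.trans m3
  refine ⟨(h₁ θ hN).trans ?_, (h₂ θ hN).trans' ?_, ?_, ?_⟩
  · gcongr; linarith
  · have e1 : σ₂ * (σ * (3 / 4)) ≤ σ₂ * (σ - σ₂ * matInner (θ.B₁ᵀ * G) (θ.A₁ * V)) := by
      refine mul_le_mul_of_nonneg_left ?_ hσ₂.le
      linarith [mul_le_mul_of_nonneg_left hx hσ₂.le]
    have e2 : C₂ * Real.sqrt (θ.bulk G V) ≤ σ * σ₂ / 4 := by
      calc C₂ * Real.sqrt (θ.bulk G V) ≤ (C₂ + 1) * (σ * σ₂ / (4 * (C₂ + 1))) := by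
            gcongr; linarith
        _ = σ * σ₂ / 4 := by field_simp
    have e3 : σ * σ₂ / 2 * θ.signal G V ≤ (σ₂ * (σ - σ₂ * matInner (θ.B₁ᵀ * G) (θ.A₁ * V))
        - C₂ * Real.sqrt (θ.bulk G V)) * θ.signal G V :=
      mul_le_mul_of_nonneg_right (by linarith) hF
    have e4 : C₂ * θ.offAxis U G V ≤ (C₁ + C₂ + C₃ + C₄ + C₅) * θ.offAxis U G V := by
      gcongr; linarith
    linarith
  · have h3 := h₃ θ hN
    have h4 := h₄ θ hN
    have hO := offAxis₁_nonneg G V θ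
    have e1 : 2 * (σ * σ₁) * (‖θ.A₂‖ ^ 2 + ‖θ.B₂‖ ^ 2) ≤ 2 * (σ * σ₁) * θ.bulk G V := by
      refine mul_le_mul_of_nonneg_left ?_ (by positivity)
      unfold bulk; linarith
    nlinarith [mul_le_mul_of_nonneg_left m3 hC₄, mul_nonneg hC₁ m4, mul_nonneg hC₂ m4,
      mul_nonneg hC₅ m4]
  · have h4 := h₄ θ hN
    have h5 := (le_abs_self _).trans (h₅ θ hN)
    nlinarith [mul_nonneg hC₁ m2, mul_nonneg hC₂ m2, mul_nonneg hC₃ m2]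

end LoRAWeights
end

noncomputable section

/-! ### Scalar differential inequalities and the escape from the saddle. -/

section Escape

open Filter Topology Set

theorem le_of_hasDerivWithinAt_nonneg {f f' : ℝ → ℝ} {T : ℝ} (hT : 0 ≤ T)
    (hf : ∀ t, 0 ≤ t → HasDerivWithinAt f (f' t) (Ici 0) t)
    (hf' : ∀ t ∈ Icc 0 T, 0 ≤ f' t) : f 0 ≤ f T := by
  refine monotoneOn_of_deriv_nonneg (convex_Icc 0 T)
    (fun t ht => ((hf t ht.1).continuousWithinAt).mono Icc_subset_Ici_self) (fun t ht => ?_)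
    (fun t ht => ?_) (left_mem_Icc.2 hT) (right_mem_Icc.2 hT) hT
  · rw [interior_Icc] at ht
    exact ((hf t ht.1.le).hasDerivAt (Ici_mem_nhds ht.1)).differentiableAt.differentiableWithinAt
  · rw [interior_Icc] at ht
    rw [((hf t ht.1.le).hasDerivAt (Ici_mem_nhds ht.1)).deriv]
    exact hf' t ⟨ht.1.le, ht.2.le⟩

theorem le_mul_exp_of_deriv_le {f f' J J' : ℝ → ℝ} {T : ℝ} (hT : 0 ≤ T)
    (hf : ∀ t, 0 ≤ t → HasDerivWithinAt f (f' t) (Ici 0) t)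
    (hJ : ∀ t, 0 ≤ t → HasDerivWithinAt J (J' t) (Ici 0) t)
    (h : ∀ t ∈ Icc 0 T, f' t ≤ J' t * f t) : f T ≤ f 0 * Real.exp (J T - J 0) := by
  have := le_of_hasDerivWithinAt_nonneg (f := fun t => -(f t * Real.exp (-J t))) hT
    (fun t ht => ((hf t ht).mul (hJ t ht).neg.exp).neg) (fun t ht => by
      have := mul_le_mul_of_nonneg_right (h t ht) (Real.exp_pos (-J t)).le
      simp only [Pi.neg_apply]
      linarith)
  simp only [neg_le_neg_iff] at this
  have h2 := mul_le_mul_of_nonneg_right this (Real.exp_pos (J T)).le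
  rw [mul_assoc, mul_assoc, ← Real.exp_add, ← Real.exp_add, neg_add_cancel, Real.exp_zero,
    mul_one] at h2
  refine h2.trans (le_of_eq ?_)
  ring_nf

/-- A lower Grönwall bound with a defect: after multiplication by the integrating factor the defect
is bounded by b, so it costs at most bT. -/
theorem mul_exp_le_of_le_deriv {f f' J J' : ℝ → ℝ} {T b : ℝ} (hT : 0 ≤ T)
    (hf : ∀ t, 0 ≤ t → HasDerivWithinAt f (f' t) (Ici 0) t)
    (hJ : ∀ t, 0 ≤ t → HasDerivWithinAt J (J' t) (Ici 0) t)
    (h : ∀ t ∈ Icc 0 T, (J' t * f t - f' t) * Real.exp (-J t) ≤ b) :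
    f 0 * Real.exp (-J 0) - b * T ≤ f T * Real.exp (-J T) := by
  have := le_of_hasDerivWithinAt_nonneg (f := fun t => f t * Real.exp (-J t) + b * t) hT
    (fun t ht => ((hf t ht).mul (hJ t ht).neg.exp).add ((hasDerivWithinAt_id t _).const_mul b))
    (fun t ht => by
      have := h t ht
      simp only [Pi.neg_apply]
      linarith)
  simp only [mul_zero, add_zero] at this
  linarith

/-- Differential inequalities near a saddle: the signal `F` grows at rate `2 l`, everything else
(`P`) at rate at most `2 l δ`, and the part `Q` of `P` only through interactions, as long as `x`,
which is close to `F / 2`, is at most `c`, and `P` is at most `s`. -/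
structure SaddleSystem (C l δ c s : ℝ) (F F' Q Q' P P' x : ℝ → ℝ) : Prop where
  deriv_F : ∀ t, 0 ≤ t → HasDerivWithinAt F (F' t) (Ici 0) t
  deriv_Q : ∀ t, 0 ≤ t → HasDerivWithinAt Q (Q' t) (Ici 0) t
  deriv_P : ∀ t, 0 ≤ t → HasDerivWithinAt P (P' t) (Ici 0) t
  cont_x : ContinuousOn x (Ici 0)
  F_nonneg : ∀ t, 0 ≤ F t
  Q_nonneg : ∀ t, 0 ≤ Q t
  Q_le_P : ∀ t, Q t ≤ P t
  x_le : ∀ t, 2 * x t ≤ F t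
  F_le : ∀ t, F t ≤ 2 * x t + Q t
  abs_sub_le : ∀ t, 0 ≤ t → x t ≤ c → P t ≤ s →
    |F' t - 2 * l * F t| ≤ C * ((F t + P t) * (F t + Q t))
  F_growth : ∀ t, 0 ≤ t → x t ≤ c → P t ≤ s → l * F t - C * Q t ≤ F' t
  P_growth : ∀ t, 0 ≤ t → x t ≤ c → P t ≤ s →
    P' t ≤ 2 * (l * δ) * P t + C * ((F t + P t) * P t)
  Q_growth : ∀ t, 0 ≤ t → x t ≤ c → P t ≤ s → Q' t ≤ C * ((F t + P t) * Q t)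

/-- The relative error C(F + P) is dominated by the derivative of I(t) = (C/l)F(t) + βt, because F'
≥ lF − CQ. Since F ≤ 2c + 1 and βT ≤ 1, I never exceeds I₀. Grönwall with I as the exponent then
gives all growth laws up to the constant factor e^{O(I₀)}, over a time interval whose length is not
bounded. -/
theorem SaddleSystem.apriori {C l δ c s : ℝ} {F F' Q Q' P P' x : ℝ → ℝ}
    (H : SaddleSystem C l δ c s F F' Q Q' P P' x) (hC : 0 ≤ C) (hl : 0 < l) (hδ : δ < 1)
    {a ρ R ε I₀ T : ℝ} (ha : 0 < a) (hR : 0 < R) (hε : ε ≤ s) (hs : s ≤ 1) (hT : 0 ≤ T)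
    (hx : ∀ t ∈ Icc 0 T, x t ≤ c) (hP : ∀ t ∈ Icc 0 T, P t ≤ ε)
    (hI₀ : I₀ = C / l * (2 * c + 1) + 1) (hI₀' : 0 ≤ I₀)
    (hεT : (C / l * C + C) * ε * T ≤ 1)
    (hF0 : ρ * a ≤ F 0) (hR0 : F 0 + P 0 ≤ R * a)
    (hbT : 2 * C * R ^ 2 * a * Real.exp (4 * I₀) * T ≤ ρ / 2) :
    Q T ≤ R * a * Real.exp I₀ ∧ P T ≤ R * a * Real.exp I₀ * Real.exp (2 * (l * δ) * T) ∧
    F T ≤ R * a * Real.exp (2 * I₀) * Real.exp (2 * l * T) ∧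
    ρ / 2 * Real.exp (-I₀) * a * Real.exp (2 * l * T) ≤ F T ∧ F T ≤ 2 * c + 1 := by
  have hQ := H.Q_nonneg
  have hFn := H.F_nonneg
  have hPn : ∀ t, 0 ≤ P t := fun t => (hQ t).trans (H.Q_le_P t)
  have hε0 : 0 ≤ ε := (hPn 0).trans (hP 0 ⟨le_rfl, hT⟩)
  -- β pays for the two remaining terms: CP, and the loss (C/l)·CQ in the growth inequality for F.
  -- Both Q and P are at most ε.
  set β := (C / l * C + C) * ε with hβ
  have hβ0 : 0 ≤ β := by positivity
  set I : ℝ → ℝ := fun t => C / l * F t + β * t with hI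
  set I' : ℝ → ℝ := fun t => C / l * F' t + β * 1 with hI'
  have dI : ∀ t, 0 ≤ t → HasDerivWithinAt I (I' t) (Ici 0) t := fun t ht =>
    ((H.deriv_F t ht).const_mul _).add ((hasDerivWithinAt_id t _).const_mul β)
  have hFc : ∀ t ∈ Icc 0 T, F t ≤ 2 * c + 1 := fun t ht => by
    linarith [H.F_le t, H.Q_le_P t, hP t ht, hx t ht]
  have hIle : ∀ t ∈ Icc 0 T, I t ≤ I₀ := fun t ht => by
    have h1 := mul_le_mul_of_nonneg_left (hFc t ht) (div_nonneg hC hl.le)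
    have h2 := mul_le_mul_of_nonneg_left ht.2 hβ0
    rw [hI₀]; simp only [hI]; linarith
  have hI0 : 0 ≤ I 0 := by
    have := hFn 0
    simp only [hI]; positivity
  have hI'ge : ∀ t ∈ Icc 0 T, C * (F t + P t) ≤ I' t := fun t ht => by
    have h1 := mul_le_mul_of_nonneg_left (H.F_growth t ht.1 (hx t ht) ((hP t ht).trans hε))
      (div_nonneg hC hl.le)
    have h2 : C / l * (l * F t - C * Q t) = C * F t - C / l * C * Q t := by
      field_simp
    have h3 : C / l * C * Q t ≤ C / l * C * ε :=
      mul_le_mul_of_nonneg_left ((H.Q_le_P t).trans (hP t ht)) (by positivity)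
    have h4 := mul_le_mul_of_nonneg_left (hP t ht) hC
    simp only [hI', hβ]
    linarith
  have hQ0 : Q 0 ≤ R * a := by linarith [H.Q_le_P 0, hFn 0]
  have hP0 : P 0 ≤ R * a := by linarith [hFn 0]
  have hFQ0 : F 0 + Q 0 ≤ R * a := by linarith [H.Q_le_P 0]
  have bQ : ∀ t ∈ Icc 0 T, Q t ≤ R * a * Real.exp I₀ := fun t ht => by
    refine (le_mul_exp_of_deriv_le ht.1 H.deriv_Q dI fun τ hτ => ?_).trans ?_
    · have hτ' : τ ∈ Icc 0 T := ⟨hτ.1, hτ.2.trans ht.2⟩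
      have := mul_le_mul_of_nonneg_right (hI'ge τ hτ') (hQ τ)
      linarith [H.Q_growth τ hτ.1 (hx τ hτ') ((hP τ hτ').trans hε)]
    · gcongr
      linarith [hIle t ht]
  have bP : ∀ t ∈ Icc 0 T, P t ≤ R * a * Real.exp I₀ * Real.exp (2 * (l * δ) * t) := fun t ht => by
    refine (le_mul_exp_of_deriv_le ht.1 H.deriv_P (fun τ hτ =>
      (dI τ hτ).add ((hasDerivWithinAt_id τ _).const_mul (2 * (l * δ)))) fun τ hτ => ?_).trans ?_
    · have hτ' : τ ∈ Icc 0 T := ⟨hτ.1, hτ.2.trans ht.2⟩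
      have := mul_le_mul_of_nonneg_right (hI'ge τ hτ') (hPn τ)
      linarith [H.P_growth τ hτ.1 (hx τ hτ') ((hP τ hτ').trans hε)]
    · rw [mul_assoc (R * a), ← Real.exp_add]
      gcongr
      simp only [Pi.add_apply, id, mul_zero, add_zero]
      linarith [hIle t ht]
  -- The sum F + Q is estimated, since the error for F involves F + Q. The errors of F and of Q add
  -- up, hence 2I in the exponent.
  have bF : ∀ t ∈ Icc 0 T, F t ≤ R * a * Real.exp (2 * I₀) * Real.exp (2 * l * t) := fun t ht => by
    refine (le_add_of_nonneg_right (hQ t)).trans ?_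
    refine (le_mul_exp_of_deriv_le ht.1 (fun τ hτ => (H.deriv_F τ hτ).add (H.deriv_Q τ hτ))
      (fun τ hτ => ((dI τ hτ).const_mul 2).add ((hasDerivWithinAt_id τ _).const_mul (2 * l)))
      fun τ hτ => ?_).trans ?_
    · have hτ' : τ ∈ Icc 0 T := ⟨hτ.1, hτ.2.trans ht.2⟩
      have h1 := mul_le_mul_of_nonneg_right (hI'ge τ hτ') (add_nonneg (hFn τ) (hQ τ))
      have h2 := (abs_le.1 (H.abs_sub_le τ hτ.1 (hx τ hτ') ((hP τ hτ').trans hε))).2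
      have h3 := H.Q_growth τ hτ.1 (hx τ hτ') ((hP τ hτ').trans hε)
      have h4 : 0 ≤ C * (F τ + P τ) * F τ :=
        mul_nonneg (mul_nonneg hC (add_nonneg (hFn τ) (hPn τ))) (hFn τ)
      have h5 : 0 ≤ l * Q τ := mul_nonneg hl.le (hQ τ)
      simp only [Pi.add_apply]
      linarith
    · rw [mul_assoc (R * a), ← Real.exp_add]
      simp only [Pi.add_apply, id, mul_zero, add_zero]
      have := hIle t ht
      gcongr
      linarith
  have hTT : T ∈ Icc 0 T := ⟨hT, le_rfl⟩
  refine ⟨bQ T hTT, bP T hTT, bF T hTT, ?_, hFc T hTT⟩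
  -- With exponent 2lt − I the error proportional to F is absorbed, and the defect is C(F + P)Q.
  -- Here F + P is of order a·e^{2lt} and Q of order a, so after cancellation of e^{2lt} the total
  -- loss is of order a²T, at most half of the initial ρa.
  have low := mul_exp_le_of_le_deriv (b := 2 * C * R ^ 2 * a * Real.exp (4 * I₀) * a) hT H.deriv_F
    (fun τ hτ => ((hasDerivWithinAt_id τ _).const_mul (2 * l)).sub (dI τ hτ)) fun t ht => ?_
  · simp only [Pi.sub_apply, id, mul_zero, zero_sub, neg_neg] at low
    have h1 : F 0 ≤ F 0 * Real.exp (I 0) :=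
      le_mul_of_one_le_right (hFn 0) (Real.one_le_exp hI0)
    have h2 := mul_le_mul_of_nonneg_right hbT ha.le
    have h3 : ρ / 2 * a ≤ F T * Real.exp (-(2 * l * T - I T)) := by linarith
    have h4 : Real.exp (-I₀) ≤ Real.exp (-(I T)) := by
      gcongr; exact hIle T hTT
    have h5 : 0 ≤ F T * Real.exp (-(2 * l * T - I T)) := mul_nonneg (hFn T) (Real.exp_pos _).le
    calc ρ / 2 * Real.exp (-I₀) * a * Real.exp (2 * l * T)
        = (ρ / 2 * a) * (Real.exp (-I₀) * Real.exp (2 * l * T)) := by ring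
      _ ≤ (F T * Real.exp (-(2 * l * T - I T))) * (Real.exp (-(I T)) * Real.exp (2 * l * T)) := by
          gcongr
      _ = F T * (Real.exp (-(2 * l * T - I T)) * Real.exp (-(I T)) * Real.exp (2 * l * T)) := by
          ring
      _ = F T := by
          rw [← Real.exp_add, ← Real.exp_add]
          ring_nf
          simp
  · have h1 := mul_le_mul_of_nonneg_right (hI'ge t ht) (hFn t)
    have h2 := (abs_le.1 (H.abs_sub_le t ht.1 (hx t ht) ((hP t ht).trans hε))).1
    have h3 : (2 * l * 1 - I' t) * F t - F' t ≤ C * (F t + P t) * Q t := by linarith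
    have hPt : P t ≤ R * a * Real.exp (2 * I₀) * Real.exp (2 * l * t) := by
      refine (bP t ht).trans ?_
      have : l * δ ≤ l := by nlinarith
      have := ht.1
      gcongr
      linarith
    have hIt := hIle t ht
    calc ((2 * l * 1 - I' t) * F t - F' t) * Real.exp (-(2 * l * t - I t))
        ≤ C * (F t + P t) * Q t * Real.exp (-(2 * l * t - I t)) := by gcongr
      _ ≤ C * (R * a * Real.exp (2 * I₀) * Real.exp (2 * l * t)
            + R * a * Real.exp (2 * I₀) * Real.exp (2 * l * t)) * (R * a * Real.exp I₀)
            * Real.exp (-(2 * l * t) + I₀) := by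
          have := hFn t
          have := hPn t
          have := hQ t
          gcongr
          · exact bF t ht
          · exact bQ t ht
          · linarith
      _ = 2 * C * R ^ 2 * a * (Real.exp (2 * I₀) * Real.exp (2 * l * t) * Real.exp I₀
            * Real.exp (-(2 * l * t) + I₀)) * a := by ring
      _ = _ := by
          rw [← Real.exp_add, ← Real.exp_add, ← Real.exp_add]
          ring_nf

theorem eventually_const_mul_rpow_lt {e : ℝ} (he : 0 < e) (k : ℝ) {y : ℝ} (hy : 0 < y) :
    ∀ᶠ a in 𝓝[>] (0 : ℝ), k * a ^ e < y := by
  have h : Tendsto (fun a : ℝ => k * a ^ e) (𝓝[>] 0) (𝓝 (k * 0 ^ e)) :=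
    ((Real.continuousAt_rpow_const 0 e (Or.inr he.le)).tendsto.mono_left
      nhdsWithin_le_nhds).const_mul k
  rw [Real.zero_rpow he.ne', mul_zero] at h
  exact h.eventually (gt_mem_nhds hy)

theorem eventually_const_mul_rpow_mul_log_lt {e : ℝ} (he : 0 < e) (k : ℝ) {y : ℝ} (hy : 0 < y) :
    ∀ᶠ a in 𝓝[>] (0 : ℝ), k * a ^ e * -Real.log a < y := by
  have h := (tendsto_log_mul_rpow_nhdsGT_zero he).const_mul (-k)
  rw [mul_zero] at h
  filter_upwards [h.eventually (gt_mem_nhds hy)] with a ha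
  linarith

-- A bootstrap: the system is followed until x reaches c, P reaches ε = α^{1−δ}, or the time reaches
-- (2/l)·log(1/α). The a priori bounds up to this exit are strict for the last two conditions, so
-- the exit is caused by x. The two bounds on F then determine the exit time up to an additive
-- constant.
set_option maxHeartbeats 800000 in
theorem SaddleSystem.escape {C l δ c s ρ R : ℝ} (hC : 0 ≤ C) (hl : 0 < l) (hδ0 : 0 ≤ δ)
    (hδ : δ < 1) (hc : 0 < c) (hs0 : 0 < s) (hs : s ≤ 1) (hρ : 0 < ρ) (hR : 0 < R) :
    ∃ K > 0, ∀ᶠ α in 𝓝[>] (0 : ℝ), ∀ F F' Q Q' P P' x : ℝ → ℝ,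
      SaddleSystem C l δ c s F F' Q Q' P P' x → ρ * α ^ 2 ≤ F 0 → F 0 + P 0 ≤ R * α ^ 2 →
      ∃ T, IsLeast {t | 0 ≤ t ∧ c ≤ x t} T ∧ l * T ≤ -Real.log α + K ∧ -Real.log α - K ≤ l * T ∧
        Q T ≤ K * α ^ 2 ∧ P T ≤ K * α ^ (2 - 2 * δ) ∧ 2 * c ≤ F T := by
  set I₀ := C / l * (2 * c + 1) + 1 with hI₀
  have hI₀0 : 0 ≤ I₀ := by positivity
  -- Comparing the lower bound for F with F ≤ 2c + 1 gives e^{2lT} ≤ k/α².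
  set k := (2 * c + 1) / (ρ / 2 * Real.exp (-I₀)) with hk
  have hk0 : 0 < k := by positivity
  set K₁ := R * Real.exp I₀ with hK₁
  set K₂ := R * Real.exp I₀ * k ^ δ with hK₂
  set K₃ := R * Real.exp (2 * I₀) with hK₃
  have hK₁0 : 0 < K₁ := by positivity
  have hK₂0 : 0 < K₂ := by positivity
  have hK₃0 : 0 < K₃ := by positivity
  have hδ' : 0 < 1 - δ := by linarith
  refine ⟨K₁ + K₂ + |Real.log k| + |Real.log (2 * c / K₃)|, by positivity, ?_⟩
  filter_upwards [self_mem_nhdsWithin, eventually_const_mul_rpow_lt (e := 1) one_pos 1 one_pos,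
    eventually_const_mul_rpow_lt hδ' 1 hs0,
    eventually_const_mul_rpow_mul_log_lt hδ' ((C / l * C + C) * (2 / l)) one_pos,
    eventually_const_mul_rpow_mul_log_lt two_pos
      (2 * C * R ^ 2 * Real.exp (4 * I₀) * (2 / l)) (half_pos hρ),
    eventually_const_mul_rpow_lt two_pos k one_pos,
    eventually_const_mul_rpow_lt hδ' K₂ one_pos,
    eventually_const_mul_rpow_lt two_pos R hc,
    eventually_const_mul_rpow_lt (e := 1 + δ) (by linarith) R one_pos]
    with α hα0 hα1 hε hεT hbT hkα hK₂α hRc hRε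
  intro F F' Q Q' P P' x H hF0 hR0
  have hα : 0 < α := hα0
  rw [one_mul, Real.rpow_one] at hα1
  rw [Real.rpow_two] at hbT hkα hRc
  rw [one_mul] at hε
  have hL : 0 < -Real.log α := neg_pos.2 (Real.log_neg hα hα1)
  set L := -Real.log α with hLdef
  -- Twice the expected escape time, so that the additive constant log k cannot exhaust it for small
  -- α.
  set Tm := 2 / l * L with hTm
  have hTm0 : 0 < Tm := by positivity
  -- The square root of the expected order α^{2−2δ} of P: small enough for ε·Tm to tend to 0, yet
  -- much larger than P.
  set ε := α ^ (1 - δ) with hεdef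
  have hε0 : 0 < ε := Real.rpow_pos_of_pos hα _
  have hεsq : α ^ (2 - 2 * δ) = ε * ε := by
    rw [hεdef, ← Real.rpow_add hα]; ring_nf
  have hRε' : R * α ^ 2 < ε := by
    have e : α ^ 2 = α ^ (1 + δ) * ε := by
      rw [hεdef, ← Real.rpow_add hα, ← Real.rpow_two]; ring_nf
    rw [e]; linarith [mul_lt_mul_of_pos_right hRε hε0]
  have hQ := H.Q_nonneg
  have hFn := H.F_nonneg
  have hPn : ∀ t, 0 ≤ P t := fun t => (hQ t).trans (H.Q_le_P t)
  have claim : ∀ T, 0 ≤ T → T ≤ Tm → (∀ t ∈ Icc 0 T, x t ≤ c) → (∀ t ∈ Icc 0 T, P t ≤ ε) →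
      2 * l * T ≤ 2 * L + Real.log k ∧ T < Tm ∧ P T ≤ K₂ * α ^ (2 - 2 * δ) ∧ P T < ε ∧
      Q T ≤ K₁ * α ^ 2 ∧ F T ≤ K₃ * α ^ 2 * Real.exp (2 * l * T) := by
    intro T hT hTle hxT hPT
    have c1 : (C / l * C + C) * ε * T ≤ 1 := by
      refine le_trans ?_ hεT.le
      calc (C / l * C + C) * ε * T ≤ (C / l * C + C) * ε * Tm := by gcongr
        _ = _ := by rw [hTm]; ring
    have c2 : 2 * C * R ^ 2 * α ^ 2 * Real.exp (4 * I₀) * T ≤ ρ / 2 := by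
      refine le_trans ?_ hbT.le
      calc 2 * C * R ^ 2 * α ^ 2 * Real.exp (4 * I₀) * T
          ≤ 2 * C * R ^ 2 * α ^ 2 * Real.exp (4 * I₀) * Tm := by gcongr
        _ = _ := by rw [hTm]; ring
    obtain ⟨q1, q2, q3, q4, q5⟩ := H.apriori hC hl hδ (pow_pos hα 2) hR hε.le hs hT hxT hPT hI₀
      hI₀0 c1 hF0 hR0 c2
    have g1 : Real.exp (2 * l * T) ≤ k / α ^ 2 := by
      rw [hk, div_div, le_div_iff₀ (by positivity)]
      linarith
    have g2 : 2 * l * T ≤ 2 * L + Real.log k := by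
      have := (Real.le_log_iff_exp_le (by positivity)).2 g1
      rw [Real.log_div hk0.ne' (by positivity), Real.log_pow] at this
      rw [hLdef]; push_cast at this; linarith
    have g3 : Real.log k < 2 * L := by
      have := Real.log_neg (by positivity) hkα
      rw [Real.log_mul hk0.ne' (by positivity), Real.log_pow] at this
      rw [hLdef]; push_cast at this; linarith
    have g4 : T < Tm := by
      rw [hTm, div_mul_eq_mul_div, lt_div_iff₀ hl]; linarith
    have g5 : P T ≤ K₂ * α ^ (2 - 2 * δ) := by
      refine q2.trans ?_
      have e1 : Real.exp (2 * (l * δ) * T) = Real.exp (2 * l * T) ^ δ := by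
        rw [← Real.exp_mul]; ring_nf
      have e2 : (k / α ^ 2) ^ δ = k ^ δ * α ^ (-(2 * δ)) := by
        rw [Real.div_rpow hk0.le (by positivity), ← Real.rpow_two, ← Real.rpow_mul hα.le,
          Real.rpow_neg hα.le, div_eq_mul_inv]
      have e3 : α ^ (2 - 2 * δ) = α ^ 2 * α ^ (-(2 * δ)) := by
        rw [← Real.rpow_two, ← Real.rpow_add hα]; ring_nf
      rw [e1, e3, hK₂]
      calc R * α ^ 2 * Real.exp I₀ * Real.exp (2 * l * T) ^ δ
          ≤ R * α ^ 2 * Real.exp I₀ * (k / α ^ 2) ^ δ := by gcongr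
        _ = _ := by rw [e2]; ring
    refine ⟨g2, g4, g5, g5.trans_lt ?_, q1.trans (le_of_eq (by rw [hK₁]; ring)),
      q3.trans (le_of_eq (by rw [hK₃]; ring))⟩
    rw [hεsq]; linarith [mul_lt_mul_of_pos_right hK₂α hε0]
  -- The three exit conditions in one continuous function; it is negative at 0, and the exit is the
  -- first time it is nonnegative.
  set f : ℝ → ℝ := fun t => max (max (x t - c) (P t - ε)) (t - Tm) with hf
  have hPc : ContinuousOn P (Ici 0) := fun t ht => (H.deriv_P t ht).continuousWithinAt
  have hfc : ContinuousOn f (Ici 0) :=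
    ((H.cont_x.sub continuousOn_const).sup (hPc.sub continuousOn_const)).sup
      (continuousOn_id.sub continuousOn_const)
  have hf0 : f 0 < 0 := by
    have := H.x_le 0
    have := hPn 0
    have := hFn 0
    refine max_lt (max_lt ?_ ?_) ?_ <;> linarith
  have hcl : IsCompact (Icc 0 Tm ∩ f ⁻¹' Ici 0) :=
    isCompact_Icc.of_isClosed_subset
      ((hfc.mono Icc_subset_Ici_self).preimage_isClosed_of_isClosed isClosed_Icc isClosed_Ici)
      inter_subset_left
  obtain ⟨T, ⟨hTI, hfT⟩, hmin⟩ := hcl.exists_isLeast ⟨Tm, ⟨hTm0.le, le_rfl⟩, by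
    simp only [mem_preimage, hf, mem_Ici]
    exact le_max_of_le_right (by simp)⟩
  have hfneg : ∀ t ∈ Icc 0 T, f t ≤ 0 := by
    intro t ht
    by_contra! hpos
    obtain ⟨τ, hτ, hτ0⟩ := intermediate_value_Icc ht.1 (hfc.mono Icc_subset_Ici_self)
      ⟨hf0.le, hpos.le⟩
    have h1 := hmin ⟨⟨hτ.1, hτ.2.trans (ht.2.trans hTI.2)⟩, hτ0.ge⟩
    have : τ = t := le_antisymm hτ.2 (ht.2.trans h1)
    rw [this] at hτ0; linarith
  have hxT : ∀ t ∈ Icc 0 T, x t ≤ c := fun t ht => by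
    have := (le_max_left _ _).trans ((le_max_left _ _).trans (hfneg t ht)); linarith
  have hPT : ∀ t ∈ Icc 0 T, P t ≤ ε := fun t ht => by
    have := (le_max_right _ _).trans ((le_max_left _ _).trans (hfneg t ht)); linarith
  obtain ⟨g1, g2, g3, g4, g5, g6⟩ := claim T hTI.1 hTI.2 hxT hPT
  have hxc : c ≤ x T := by
    have h0 : 0 ≤ f T := hfT
    by_contra! hlt
    exact absurd h0 (not_le.2 (max_lt (max_lt (by linarith) (by linarith)) (by linarith)))
  have hFc : 2 * c ≤ F T := by linarith [H.x_le T]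
  refine ⟨T, ⟨⟨hTI.1, hxc⟩, fun t ht => ?_⟩, ?_, ?_, ?_, ?_, hFc⟩
  · by_contra! hlt
    have h0 : 0 ≤ f t := le_max_of_le_left (le_max_of_le_left (sub_nonneg.2 ht.2))
    exact absurd (hmin ⟨⟨ht.1, hlt.le.trans hTI.2⟩, h0⟩) (not_le.2 hlt)
  · have := le_abs_self (Real.log k)
    have := abs_nonneg (Real.log k)
    have := abs_nonneg (Real.log (2 * c / K₃))
    linarith
  · have h1 : 2 * c / K₃ ≤ α ^ 2 * Real.exp (2 * l * T) := by
      rw [div_le_iff₀ hK₃0]; linarith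
    have h2 := Real.log_le_log (by positivity) h1
    rw [Real.log_mul (by positivity) (Real.exp_pos _).ne', Real.log_pow, Real.log_exp] at h2
    push_cast at h2
    have := neg_abs_le (Real.log (2 * c / K₃))
    have := abs_nonneg (Real.log k)
    have := abs_nonneg (Real.log (2 * c / K₃))
    linarith
  · refine g5.trans ?_
    gcongr
    linarith [abs_nonneg (Real.log k), abs_nonneg (Real.log (2 * c / K₃))]
  · refine g3.trans ?_
    gcongr
    linarith [abs_nonneg (Real.log k), abs_nonneg (Real.log (2 * c / K₃))]

end Escape
end

noncomputable section

/-! ### Gaussian initializations are good with high probability. -/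

section Probability

open MeasureTheory ProbabilityTheory Filter Topology

/-- Fubini: once the other coordinates are fixed, a coordinate j with v j ≠ 0 is confined to a
single point. -/
theorem pi_dotProduct_eq_zero_null (μ : Measure ℝ) [IsProbabilityMeasure μ]
    [NullSingletonClass μ] {n : ℕ} {v : Fin n → ℝ} (hv : v ≠ 0) :
    Measure.pi (fun _ : Fin n => μ) {y | y ⬝ᵥ v = 0} = 0 := by
  obtain ⟨j, hj⟩ := Function.ne_iff.1 hv
  simp only [Pi.zero_apply] at hj
  obtain ⟨k, rfl⟩ : ∃ k, n = k + 1 := ⟨n - 1, by have := j.pos; omega⟩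
  have hp := measurePreserving_piFinSuccAbove (fun _ : Fin (k + 1) => μ) j
  set s : Set (ℝ × (Fin k → ℝ)) := {p | p.1 * v j + ∑ i, p.2 i * v (j.succAbove i) = 0} with hs
  have hsm : MeasurableSet s := by
    refine measurableSet_eq_fun ?_ measurable_const
    fun_prop
  have heq : {y : Fin (k + 1) → ℝ | y ⬝ᵥ v = 0}
      = MeasurableEquiv.piFinSuccAbove (fun _ => ℝ) j ⁻¹' s := by
    ext y
    simp only [Set.mem_ofPred_eq, Set.mem_preimage, hs, dotProduct, Fin.sum_univ_succAbove _ j]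
    rfl
  rw [heq, hp.measure_preimage hsm.nullMeasurableSet, Measure.prod_apply_symm hsm]
  simp only [lintegral_eq_zero_iff' (measurable_measure_prodMk_right hsm).aemeasurable]
  refine Eventually.of_forall fun f => ?_
  refine measure_mono_null (t := {-(∑ i, f i * v (j.succAbove i)) / v j}) (fun a ha => ?_)
    (measure_singleton _)
  simp only [Set.mem_preimage, hs, Set.mem_ofPred_eq] at ha
  simp only [Set.mem_singleton_iff]
  field_simp
  linarith

/-- The initializations that are bounded and not too close to being orthogonal to `v`. -/
def goodInit {r n h : ℕ} (v : Fin n → ℝ) (k : ℕ) :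
    Set ((Fin r → Fin n → ℝ) × (Fin r → Fin h → ℝ)) :=
  {X | (∑ i, ∑ j, X.1 i j ^ 2 ≤ k) ∧ (∑ i, ∑ j, X.2 i j ^ 2 ≤ k) ∧
    (1 / ((k : ℝ) + 1) ≤ ∑ i, (∑ j, X.1 i j * v j) ^ 2) ∧ 0 < ∑ i, ∑ j, X.2 i j ^ 2}

theorem measurableSet_goodInit {r n h : ℕ} (v : Fin n → ℝ) (k : ℕ) :
    MeasurableSet (goodInit (r := r) (h := h) v k) := by
  have m₁ : Measurable fun X : (Fin r → Fin n → ℝ) × (Fin r → Fin h → ℝ) =>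
      ∑ i, ∑ j, X.1 i j ^ 2 := by fun_prop
  have m₂ : Measurable fun X : (Fin r → Fin n → ℝ) × (Fin r → Fin h → ℝ) =>
      ∑ i, ∑ j, X.2 i j ^ 2 := by fun_prop
  have m₃ : Measurable fun X : (Fin r → Fin n → ℝ) × (Fin r → Fin h → ℝ) =>
      ∑ i, (∑ j, X.1 i j * v j) ^ 2 := by fun_prop
  exact (measurableSet_le m₁ measurable_const).inter <|
    (measurableSet_le m₂ measurable_const).inter <|
    (measurableSet_le measurable_const m₃).inter (measurableSet_lt measurable_const m₂)

theorem monotone_goodInit {r n h : ℕ} (v : Fin n → ℝ) :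
    Monotone (goodInit (r := r) (h := h) v) := by
  intro k l hkl X hX
  have hkl' : (k : ℝ) ≤ l := by exact_mod_cast hkl
  refine ⟨hX.1.trans hkl', hX.2.1.trans hkl', hX.2.2.1.trans' ?_, hX.2.2.2⟩
  gcongr

instance {r n h : ℕ} : IsProbabilityMeasure (stdGaussianPair r n h) := by
  unfold stdGaussianPair; infer_instance

/-- An initialization is good for some k as soon as one row of X₁ is not orthogonal to v and one
entry of X₂ is nonzero; each of these fails only on a null set. -/
theorem measure_iUnion_goodInit {r n h : ℕ} (hr : 0 < r) (hh : 0 < h) {v : Fin n → ℝ}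
    (hv : v ≠ 0) : stdGaussianPair r n h (⋃ k, goodInit v k) = 1 := by
  have : NullSingletonClass (gaussianReal 0 1) := nullSingletonClass_gaussianReal one_ne_zero
  rw [← prob_compl_eq_zero_iff (MeasurableSet.iUnion fun k => measurableSet_goodInit v k)]
  set i₀ : Fin r := ⟨0, hr⟩
  set j₀ : Fin h := ⟨0, hh⟩
  have hw : (Pi.single j₀ (1 : ℝ) : Fin h → ℝ) ≠ 0 := by simp
  have n1 : stdGaussianPair r n h {X | X.1 i₀ ⬝ᵥ v = 0} = 0 := by
    have e := (measurePreserving_eval (fun _ : Fin r => Measure.pi fun _ : Fin n =>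
      gaussianReal 0 1) i₀).comp (measurePreserving_fst (μ := Measure.pi fun _ : Fin r =>
      Measure.pi fun _ : Fin n => gaussianReal 0 1) (ν := Measure.pi fun _ : Fin r =>
      Measure.pi fun _ : Fin h => gaussianReal 0 1))
    exact e.quasiMeasurePreserving.preimage_null (pi_dotProduct_eq_zero_null _ hv)
  have n2 : stdGaussianPair r n h {X | X.2 i₀ ⬝ᵥ Pi.single j₀ 1 = 0} = 0 := by
    have e := (measurePreserving_eval (fun _ : Fin r => Measure.pi fun _ : Fin h =>
      gaussianReal 0 1) i₀).comp (measurePreserving_snd (μ := Measure.pi fun _ : Fin r =>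
      Measure.pi fun _ : Fin n => gaussianReal 0 1) (ν := Measure.pi fun _ : Fin r =>
      Measure.pi fun _ : Fin h => gaussianReal 0 1))
    exact e.quasiMeasurePreserving.preimage_null (pi_dotProduct_eq_zero_null _ hw)
  refine measure_mono_null (fun X hX => ?_) (measure_union_null n1 n2)
  by_contra hcon
  simp only [Set.mem_union, Set.mem_ofPred_eq, not_or, dotProduct_single, mul_one] at hcon
  refine hX (Set.mem_iUnion.2 ?_)
  have p1 : 0 < ∑ i, (∑ j, X.1 i j * v j) ^ 2 :=
    Finset.sum_pos' (fun i _ => sq_nonneg _) ⟨i₀, Finset.mem_univ _, by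
      have := hcon.1; simp only [dotProduct] at this; positivity⟩
  have p2 : 0 < ∑ i, ∑ j, X.2 i j ^ 2 :=
    Finset.sum_pos' (fun i _ => Finset.sum_nonneg fun j _ => sq_nonneg _) ⟨i₀, Finset.mem_univ _,
      Finset.sum_pos' (fun j _ => sq_nonneg _) ⟨j₀, Finset.mem_univ _, by
        have := hcon.2; positivity⟩⟩
  obtain ⟨k, hk⟩ := exists_nat_ge (max (max (∑ i, ∑ j, X.1 i j ^ 2) (∑ i, ∑ j, X.2 i j ^ 2))
    (1 / ∑ i, (∑ j, X.1 i j * v j) ^ 2))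
  refine ⟨k, (le_max_left _ _).trans ((le_max_left _ _).trans hk),
    (le_max_right _ _).trans ((le_max_left _ _).trans hk), ?_, p2⟩
  have h1 := (le_max_right _ _).trans hk
  rw [div_le_iff₀ p1] at h1
  rw [div_le_iff₀ (by positivity)]
  nlinarith

/-- Continuity from below of the measure. A single k then provides the bounds that make the
threshold on α uniform over the event. -/
theorem exists_goodInit {r n h : ℕ} (hr : 0 < r) (hh : 0 < h) {v : Fin n → ℝ}
    (hv : v ≠ 0) {η : ℝ} (hη : 0 < η) :
    ∃ k : ℕ, 0 < k ∧ ENNReal.ofReal (1 - η) ≤ stdGaussianPair r n h (goodInit v k) := by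
  have ht := tendsto_measure_iUnion_atTop (μ := stdGaussianPair r n h)
    (monotone_goodInit (r := r) (h := h) v)
  rw [measure_iUnion_goodInit hr hh hv] at ht
  have hlt : ENNReal.ofReal (1 - η) < 1 := by
    rw [← ENNReal.ofReal_one]
    exact (ENNReal.ofReal_lt_ofReal_iff one_pos).2 (by linarith)
  obtain ⟨k, hk, hk0⟩ := ((ht.eventually (lt_mem_nhds hlt)).and (eventually_gt_atTop 0)).exists
  exact ⟨k, hk0, hk.le⟩

end Probability
end

noncomputable section

/-! ### Spectral norm and top singular vectors. -/

section Spectral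

open scoped Matrix.Norms.Frobenius

variable {ι κ : Type*} [Fintype ι] [Fintype κ]

theorem norm_replicateCol_sq (x : ι → ℝ) : ‖Matrix.replicateCol Unit x‖ ^ 2 = x ⬝ᵥ x := by
  rw [← matInner_self]
  simp [matInner, dotProduct]

theorem transpose_replicateCol_mul (x y : ι → ℝ) :
    (Matrix.replicateCol Unit x)ᵀ * Matrix.replicateCol Unit y
      = (x ⬝ᵥ y) • (1 : Matrix Unit Unit ℝ) := by
  ext i j
  simp [Matrix.mul_apply, dotProduct]

theorem norm_mul_col_le [DecidableEq κ] (Z : Matrix ι κ ℝ) (y : Matrix κ Unit ℝ) :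
    ‖Z * y‖ ≤ specNorm Z * ‖y‖ := by
  have hy : y = Matrix.replicateCol Unit (fun i => y i ()) := by ext i j; rfl
  rw [hy, ← Matrix.replicateCol_mulVec, Matrix.frobenius_norm_replicateCol,
    Matrix.frobenius_norm_replicateCol]
  exact Matrix.l2_opNorm_mulVec Z (WithLp.toLp 2 fun i => y i ())

theorem specNorm_le_norm [DecidableEq κ] (Z : Matrix ι κ ℝ) : specNorm Z ≤ ‖Z‖ := by
  rw [specNorm, Matrix.l2_opNorm_def]
  refine ContinuousLinearMap.opNorm_le_bound _ (norm_nonneg _) fun y => ?_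
  have h := Matrix.frobenius_norm_mul Z (Matrix.replicateCol Unit (WithLp.ofLp y))
  rw [← Matrix.replicateCol_mulVec, Matrix.frobenius_norm_replicateCol,
    Matrix.frobenius_norm_replicateCol] at h
  exact h

theorem specNorm_nonneg [DecidableEq κ] (Z : Matrix ι κ ℝ) : 0 ≤ specNorm Z := by
  rw [specNorm, Matrix.l2_opNorm_def]; exact norm_nonneg _

/-- Testing Z on the column Zᵀa: ‖Zᵀa‖² = ⟨a, ZZᵀa⟩ is at most the spectral norm of Z times ‖Zᵀa‖.
-/
theorem norm_transpose_mul_le_specNorm [DecidableEq κ] {a : Matrix ι Unit ℝ} (ha : aᵀ * a = 1)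
    (Z : Matrix ι κ ℝ) : ‖aᵀ * Z‖ ≤ specNorm Z := by
  have ha1 : ‖a‖ ^ 2 = 1 := by
    rw [← matInner_self, matInner_eq_trace, ha]; simp
  have ha1' : ‖a‖ = 1 := by
    have := norm_nonneg a; nlinarith
  have e : ‖aᵀ * Z‖ = ‖Zᵀ * a‖ := by
    rw [← Matrix.frobenius_norm_transpose, Matrix.transpose_mul, Matrix.transpose_transpose]
  rw [e]
  have h1 : ‖Zᵀ * a‖ ^ 2 ≤ specNorm Z * ‖Zᵀ * a‖ := by
    rw [← matInner_self, matInner_mul_left, Matrix.transpose_transpose]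
    refine (le_abs_self _).trans ((abs_matInner_le _ _).trans ?_)
    rw [ha1', one_mul]
    exact norm_mul_col_le Z _
  by_contra! hlt
  have := specNorm_nonneg Z
  nlinarith

/-- A top left singular vector is close to any direction that carries most of the matrix. -/
theorem one_sub_sq_le_of_isTopLeftSingularVector [DecidableEq κ] {Z : Matrix ι κ ℝ} {w : ι → ℝ}
    (hw : IsTopLeftSingularVector Z w) {a : ι → ℝ} (ha : a ⬝ᵥ a = 1) :
    specNorm Z ^ 2 * (1 - (a ⬝ᵥ w) ^ 2)
      ≤ ‖Z‖ ^ 2 - ‖(Matrix.replicateCol Unit a)ᵀ * Z‖ ^ 2 := by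
  obtain ⟨b, -, hw1, hb1, hZb, -⟩ := hw
  set A := Matrix.replicateCol Unit a
  have hA : Aᵀ * A = 1 := by rw [transpose_replicateCol_mul, ha, one_smul]
  have hb : ‖Matrix.replicateCol Unit b‖ ^ 2 = 1 := by rw [norm_replicateCol_sq, hb1]
  -- The off-axis part of Z sends the right singular vector b to the top singular value times the
  -- off-axis part of w, and b has norm 1.
  have h1 : projOff A Z * Matrix.replicateCol Unit b
      = specNorm Z • projOff A (Matrix.replicateCol Unit w) := by
    rw [← projOff_mul, ← Matrix.replicateCol_mulVec, hZb, Matrix.replicateCol_smul, projOff_smul]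
  have h2 : ‖projOff A (Matrix.replicateCol Unit w)‖ ^ 2 = 1 - (a ⬝ᵥ w) ^ 2 := by
    have := norm_sq_eq_projOff hA (Matrix.replicateCol Unit w)
    rw [norm_replicateCol_sq, hw1, transpose_replicateCol_mul, ← matInner_self (_ • _)] at this
    simp only [matInner, Finset.univ_unique, Finset.sum_singleton, Matrix.smul_apply,
      Matrix.one_apply_eq, smul_eq_mul, mul_one] at this
    linarith
  have h3 := Matrix.frobenius_norm_mul (projOff A Z) (Matrix.replicateCol Unit b)
  have h4 := pow_le_pow_left₀ (norm_nonneg _) h3 2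
  rw [h1, norm_smul, mul_pow, mul_pow, hb, h2, mul_one, Real.norm_eq_abs, sq_abs] at h4
  rw [norm_sq_eq_projOff hA Z]
  linarith

theorem cosSq_eq {a b : ι → ℝ} (ha : a ⬝ᵥ a = 1) :
    cosSq a b = (a ⬝ᵥ b) ^ 2 / (b ⬝ᵥ b) := by
  have hn : ∀ x : ι → ℝ, ‖(WithLp.toLp 2 x : EuclideanSpace ℝ ι)‖ ^ 2 = x ⬝ᵥ x := fun x => by
    rw [← Matrix.frobenius_norm_replicateCol (ι := Unit), norm_replicateCol_sq]
  rw [cosSq, InnerProductGeometry.cos_angle, div_pow, mul_pow, hn, hn, ha, one_mul,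
    EuclideanSpace.inner_eq_star_dotProduct]
  simp [dotProduct_comm]

end Spectral

namespace LoRAWeights

open scoped Matrix.Norms.Frobenius

variable {m h n r : ℕ}

theorem norm_Z₁_sq (θ : LoRAWeights m h n r) : ‖θ.Z₁‖ ^ 2 = ‖θ.A₁‖ ^ 2 + ‖θ.B₁‖ ^ 2 := by
  rw [← Matrix.frobenius_norm_transpose θ.A₁]
  simp only [← matInner_self, matInner, Fintype.sum_sum_type, Z₁, Matrix.fromRows_apply_inl,
    Matrix.fromRows_apply_inr]
  ring

theorem norm_Z₂_sq (θ : LoRAWeights m h n r) : ‖θ.Z₂‖ ^ 2 = ‖θ.A₂‖ ^ 2 + ‖θ.B₂‖ ^ 2 := by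
  rw [← Matrix.frobenius_norm_transpose θ.A₂]
  simp only [← matInner_self, matInner, Fintype.sum_sum_type, Z₂, Matrix.fromRows_apply_inl,
    Matrix.fromRows_apply_inr]
  ring

variable {g : Fin h → ℝ} {v : Fin n → ℝ}

theorem dotProduct_elim_smul (hg : g ⬝ᵥ g = 1) (hv : v ⬝ᵥ v = 1) :
    ((Real.sqrt 2)⁻¹ • Sum.elim g v) ⬝ᵥ ((Real.sqrt 2)⁻¹ • Sum.elim g v) = 1 := by
  rw [smul_dotProduct, dotProduct_smul, sumElim_dotProduct_sumElim, hg, hv, smul_eq_mul,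
    smul_eq_mul, ← mul_assoc, ← mul_inv, Real.mul_self_sqrt zero_le_two]
  norm_num

/-- The vector (g, v) has length √2; this normalization accounts for the factor 1/2 in `signal`. -/
theorem norm_axis_mul_Z₁ (g : Fin h → ℝ) (v : Fin n → ℝ) (θ : LoRAWeights m h n r) :
    ‖(Matrix.replicateCol Unit ((Real.sqrt 2)⁻¹ • Sum.elim g v))ᵀ * θ.Z₁‖ ^ 2
      = θ.signal (Matrix.replicateCol Unit g) (Matrix.replicateCol Unit v) := by
  have e : (Matrix.replicateCol Unit ((Real.sqrt 2)⁻¹ • Sum.elim g v))ᵀ * θ.Z₁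
      = (Real.sqrt 2)⁻¹ • (θ.B₁ᵀ * Matrix.replicateCol Unit g
        + θ.A₁ * Matrix.replicateCol Unit v)ᵀ := by
    ext i j
    simp [Matrix.mul_apply, Z₁, Fintype.sum_sum_type, Finset.mul_sum, mul_add]
    congr 1 <;> exact Finset.sum_congr rfl fun k _ => by ring
  rw [e, norm_smul, mul_pow, Matrix.frobenius_norm_transpose, signal, norm_inv,
    Real.norm_of_nonneg (Real.sqrt_nonneg 2), inv_pow, Real.sq_sqrt zero_le_two]
  ring

theorem signal_le_specNorm_sq (hg : g ⬝ᵥ g = 1) (hv : v ⬝ᵥ v = 1) (θ : LoRAWeights m h n r) :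
    θ.signal (Matrix.replicateCol Unit g) (Matrix.replicateCol Unit v) ≤ specNorm θ.Z₁ ^ 2 := by
  rw [← norm_axis_mul_Z₁]
  refine pow_le_pow_left₀ (norm_nonneg _) (norm_transpose_mul_le_specNorm ?_ _) 2
  rw [transpose_replicateCol_mul, dotProduct_elim_smul hg hv, one_smul]

theorem one_sub_cosSq_le (hg : g ⬝ᵥ g = 1) (hv : v ⬝ᵥ v = 1) (θ : LoRAWeights m h n r)
    {w : Fin h ⊕ Fin n → ℝ} (hw : IsTopLeftSingularVector θ.Z₁ w) :
    specNorm θ.Z₁ ^ 2 * (1 - cosSq w (Sum.elim g v))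
      ≤ θ.offAxis₁ (Matrix.replicateCol Unit g) (Matrix.replicateCol Unit v) := by
  have h1 := one_sub_sq_le_of_isTopLeftSingularVector hw (dotProduct_elim_smul hg hv)
  have hw1 : w ⬝ᵥ w = 1 := hw.choose_spec.2.1
  have hG : (Matrix.replicateCol Unit g)ᵀ * Matrix.replicateCol Unit g = 1 := by
    rw [transpose_replicateCol_mul, hg, one_smul]
  have hV : (Matrix.replicateCol Unit v)ᵀ * Matrix.replicateCol Unit v = 1 := by
    rw [transpose_replicateCol_mul, hv, one_smul]
  rw [norm_axis_mul_Z₁, norm_Z₁_sq, ← signal_add_offAxis₁ hG hV, smul_dotProduct, smul_eq_mul,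
    mul_pow, inv_pow, Real.sq_sqrt zero_le_two, dotProduct_comm] at h1
  rw [cosSq_eq hw1, sumElim_dotProduct_sumElim, hg, hv,
    show (w ⬝ᵥ Sum.elim g v) ^ 2 / (1 + 1) = 2⁻¹ * (w ⬝ᵥ Sum.elim g v) ^ 2 by ring]
  linarith

end LoRAWeights
end

noncomputable section

/-! ### From the weights to the scalar system, the time window and the powers of α. -/

section Assembly

open scoped Matrix.Norms.Frobenius
open Filter Topology

variable {m h n r : ℕ} {W₂ : Matrix (Fin m) (Fin h) ℝ} {W₁ : Matrix (Fin h) (Fin n) ℝ}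
  {Yft : Matrix (Fin m) (Fin n) ℝ}

theorem specNorm_pos {ι κ : Type*} [Fintype ι] [Fintype κ] [DecidableEq κ] {M : Matrix ι κ ℝ}
    (hM : M ≠ 0) : 0 < specNorm M := by
  rw [specNorm, Matrix.l2_opNorm_def, norm_pos_iff]
  exact (LinearEquiv.map_ne_zero_iff _).2 hM

theorem rankOneTask_of_isSingularTriple {Ypre : Matrix (Fin m) (Fin n) ℝ} {u : Fin m → ℝ}
    {g : Fin h → ℝ} {v : Fin n → ℝ} {σ σ₁ σ₂ : ℝ} (hY : Ypre = W₂ * W₁)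
    (hΔ : Yft - Ypre = σ • Matrix.vecMulVec u v)
    (hW₁ : IsSingularTriple W₁ σ₁ g v) (hW₂ : IsSingularTriple W₂ σ₂ u g) :
    RankOneTask W₂ W₁ Yft (Matrix.replicateCol Unit u) (Matrix.replicateCol Unit g)
      (Matrix.replicateCol Unit v) σ σ₁ σ₂ := by
  obtain ⟨-, hg, hv, h1, h2⟩ := hW₁
  obtain ⟨-, hu, -, h3, h4⟩ := hW₂
  refine ⟨?_, ?_, ?_, ?_, ?_, ?_, ?_, ?_⟩
  · rw [transpose_replicateCol_mul, hu, one_smul]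
  · rw [transpose_replicateCol_mul, hg, one_smul]
  · rw [transpose_replicateCol_mul, hv, one_smul]
  · rw [Matrix.transpose_replicateCol, ← Matrix.vecMulVec_eq, ← hΔ, ← hY]; abel
  · rw [← Matrix.replicateCol_mulVec, h1, Matrix.replicateCol_smul]
  · rw [← Matrix.replicateCol_mulVec, h2, Matrix.replicateCol_smul]
  · rw [← Matrix.replicateCol_mulVec, h3, Matrix.replicateCol_smul]
  · rw [← Matrix.replicateCol_mulVec, h4, Matrix.replicateCol_smul]

theorem matInner_replicateCol (B : Matrix (Fin h) (Fin r) ℝ) (A : Matrix (Fin r) (Fin n) ℝ)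
    (g : Fin h → ℝ) (v : Fin n → ℝ) :
    matInner (Bᵀ * Matrix.replicateCol Unit g) (A * Matrix.replicateCol Unit v)
      = g ⬝ᵥ ((B * A) *ᵥ v) := by
  rw [matInner_mul_left, Matrix.transpose_transpose, ← Matrix.mul_assoc,
    ← Matrix.replicateCol_mulVec]
  simp [matInner, dotProduct]

theorem IsGradientFlow.saddleSystem {θ : ℝ → LoRAWeights m h n r}
    (hθ : IsGradientFlow W₂ W₁ Yft θ) {U : Matrix (Fin m) Unit ℝ} {G : Matrix (Fin h) Unit ℝ}
    {V : Matrix (Fin n) Unit ℝ} {σ σ₁ σ₂ C c s δ : ℝ} (hT : RankOneTask W₂ W₁ Yft U G V σ σ₁ σ₂)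
    (hδ : σ * σ₂ * δ = σ * σ₁)
    (H : ∀ θ : LoRAWeights m h n r,
      matInner (θ.B₁ᵀ * G) (θ.A₁ * V) ≤ c → θ.bulk G V ≤ s →
      |θ.signalRate W₂ W₁ Yft G V - 2 * (σ * σ₂) * θ.signal G V|
        ≤ C * ((θ.signal G V + θ.bulk G V) * (θ.signal G V + θ.offAxis U G V)) ∧
      σ * σ₂ * θ.signal G V - C * θ.offAxis U G V ≤ θ.signalRate W₂ W₁ Yft G V ∧
      θ.sizeRate W₂ W₁ Yft + θ.offAxis₁Rate W₂ W₁ Yft G V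
        ≤ 2 * (σ * σ₁) * θ.bulk G V + C * ((θ.signal G V + θ.bulk G V) * θ.bulk G V) ∧
      θ.offAxis₁Rate W₂ W₁ Yft G V + θ.offAxis₂Rate W₂ W₁ Yft U G
        ≤ C * ((θ.signal G V + θ.bulk G V) * θ.offAxis U G V)) :
    SaddleSystem C (σ * σ₂) δ c s (fun t => (θ t).signal G V)
      (fun t => (θ t).signalRate W₂ W₁ Yft G V) (fun t => (θ t).offAxis U G V)
      (fun t => (θ t).offAxis₁Rate W₂ W₁ Yft G V + (θ t).offAxis₂Rate W₂ W₁ Yft U G)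
      (fun t => (θ t).bulk G V)
      (fun t => (θ t).sizeRate W₂ W₁ Yft + (θ t).offAxis₁Rate W₂ W₁ Yft G V)
      (fun t => matInner ((θ t).B₁ᵀ * G) ((θ t).A₁ * V)) where
  deriv_F t ht := LoRAWeights.hasDeriv_signal hθ ht G V
  deriv_Q t ht := (LoRAWeights.hasDeriv_offAxis₁ hθ ht G V).add
    (LoRAWeights.hasDeriv_offAxis₂ hθ ht U G)
  deriv_P t ht := (LoRAWeights.hasDeriv_size hθ ht).add (LoRAWeights.hasDeriv_offAxis₁ hθ ht G V)
  cont_x t ht := (((hθ.hasMatDeriv_B₁ ht).transpose.mul_const G).matInner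
    ((hθ.hasMatDeriv_A₁ ht).mul_const V)).continuousWithinAt
  F_nonneg t := LoRAWeights.signal_nonneg G V _
  Q_nonneg t := LoRAWeights.offAxis_nonneg U G V _
  Q_le_P t := LoRAWeights.offAxis_le_bulk hT.unit_U hT.unit_G V _
  x_le t := by
    rw [LoRAWeights.signal_eq_two_mul_add]
    linarith [sq_nonneg ‖(θ t).B₁ᵀ * G - (θ t).A₁ * V‖]
  F_le t := by
    rw [LoRAWeights.signal_eq_two_mul_add, LoRAWeights.offAxis, LoRAWeights.offAxis₁]
    linarith [sq_nonneg ‖projOff G (θ t).B₁‖, sq_nonneg ‖projOff V (θ t).A₁ᵀ‖,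
      LoRAWeights.offAxis₂_nonneg U G (θ t)]
  abs_sub_le t _ hx hP := (H (θ t) hx hP).1
  F_growth t _ hx hP := (H (θ t) hx hP).2.1
  P_growth t _ hx hP := by rw [hδ]; exact (H (θ t) hx hP).2.2.1
  Q_growth t _ hx hP := (H (θ t) hx hP).2.2.2

theorem IsGradientFlow.norm_A₂_sq_sub {θ : ℝ → LoRAWeights m h n r}
    (hθ : IsGradientFlow W₂ W₁ Yft θ) {t : ℝ} (ht : 0 ≤ t) :
    ‖(θ 0).A₂‖ ^ 2 - ‖(θ 0).B₂‖ ^ 2 ≤ ‖(θ t).A₂‖ ^ 2 - ‖(θ t).B₂‖ ^ 2 :=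
  le_of_hasDerivWithinAt_nonneg (f' := fun _ => 0) ht
    (fun _ hτ => LoRAWeights.hasDeriv_imbalance₂ hθ hτ) fun _ _ => le_rfl

theorem norm_of_sq {p q : ℕ} (X : Fin p → Fin q → ℝ) :
    ‖(Matrix.of X : Matrix (Fin p) (Fin q) ℝ)‖ ^ 2 = ∑ i, ∑ j, X i j ^ 2 := by
  rw [← matInner_self]; simp [matInner, sq]

theorem zMax_loraInit {α : ℝ} (hα : 0 < α) (X : (Fin r → Fin n → ℝ) × (Fin r → Fin h → ℝ)) :
    zMax α (loraInit m α X)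
      = max ‖(Matrix.of X.1 : Matrix (Fin r) (Fin n) ℝ)‖
        ‖(Matrix.of X.2 : Matrix (Fin r) (Fin h) ℝ)‖ := by
  have h1 : ‖(loraInit m α X).Z₁‖ = α * ‖(Matrix.of X.1 : Matrix (Fin r) (Fin n) ℝ)‖ := by
    rw [← sq_eq_sq₀ (norm_nonneg _) (by positivity), LoRAWeights.norm_Z₁_sq]
    simp [loraInit, norm_smul, abs_of_pos hα, -Matrix.smul_of]
  have h2 : ‖(loraInit m α X).Z₂‖ = α * ‖(Matrix.of X.2 : Matrix (Fin r) (Fin h) ℝ)‖ := by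
    rw [← sq_eq_sq₀ (norm_nonneg _) (by positivity), LoRAWeights.norm_Z₂_sq]
    simp [loraInit, norm_smul, abs_of_pos hα, -Matrix.smul_of]
  rw [zMax, frobNorm_eq_norm, frobNorm_eq_norm, h1, h2, ← mul_max_of_nonneg _ _ hα.le,
    ← mul_assoc, one_div_mul_cancel hα.ne', one_mul]

theorem norm_of_mul_replicateCol_sq (X : Fin r → Fin n → ℝ) (v : Fin n → ℝ) :
    ‖(Matrix.of X : Matrix (Fin r) (Fin n) ℝ) * Matrix.replicateCol Unit v‖ ^ 2
      = ∑ i, (∑ j, X i j * v j) ^ 2 := by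
  rw [← Matrix.replicateCol_mulVec, norm_replicateCol_sq]
  simp [dotProduct, Matrix.mulVec, sq]

theorem zMax_sq_bounds {α : ℝ} (hα : 0 < α) {v : Fin n → ℝ} (hv : v ⬝ᵥ v = 1) {k : ℕ}
    {X : (Fin r → Fin n → ℝ) × (Fin r → Fin h → ℝ)} (hX : X ∈ goodInit v k) :
    1 / ((k : ℝ) + 1) ≤ zMax α (loraInit m α X) ^ 2 ∧ zMax α (loraInit m α X) ^ 2 ≤ k := by
  rw [zMax_loraInit hα]
  constructor
  · refine hX.2.2.1.trans ?_
    rw [← norm_of_mul_replicateCol_sq]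
    refine pow_le_pow_left₀ (norm_nonneg _) (le_max_of_le_left ?_) 2
    have h1 : ‖Matrix.replicateCol Unit v‖ = 1 := by
      have := norm_replicateCol_sq v
      rw [hv] at this
      exact (pow_eq_one_iff_of_nonneg (norm_nonneg _) two_ne_zero).1 this
    simpa [h1] using Matrix.frobenius_norm_mul (Matrix.of X.1) (Matrix.replicateCol Unit v)
  · rcases max_choice ‖(Matrix.of X.1 : Matrix (Fin r) (Fin n) ℝ)‖
      ‖(Matrix.of X.2 : Matrix (Fin r) (Fin h) ℝ)‖ with e | e <;> rw [e, norm_of_sq]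
    exacts [hX.1, hX.2.1]

theorem signal_loraInit (m : ℕ) (α : ℝ) (X : (Fin r → Fin n → ℝ) × (Fin r → Fin h → ℝ))
    (G : Matrix (Fin h) Unit ℝ) (v : Fin n → ℝ) :
    (loraInit m α X).signal G (Matrix.replicateCol Unit v)
      = 1 / 2 * (∑ i, (∑ j, X.1 i j * v j) ^ 2) * α ^ 2 := by
  rw [LoRAWeights.signal, ← norm_of_mul_replicateCol_sq]
  simp [loraInit, norm_smul, mul_pow, -Matrix.smul_of]
  ring

/-- Only leading coefficients matter. With L = log(1/α), σσ₂T is L up to a constant, while the early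
time contributes (2/(5 − δ))L ≤ L/2 and the escape duration at least (4/(1 + δ))L > L, both up to
constants. For small α the early time is nonnegative and the escape duration alone already exceeds
T. -/
theorem earlyTime_le_of_log_le {W₂ : Matrix (Fin m) (Fin h) ℝ} {W₁ : Matrix (Fin h) (Fin n) ℝ}
    {ΔY : Matrix (Fin m) (Fin n) ℝ} {w σ σ₂ δ : ℝ} (hσ : 0 < σ) (hσ₂ : 0 < σ₂) (hδ0 : 0 ≤ δ)
    (hδ : δ < 1) (hw : w = specNorm ΔY + specNorm W₁ ^ 2 + specNorm W₁ * specNorm W₂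
      + specNorm W₂ ^ 2 + Real.sqrt (specNorm W₁ + specNorm W₂)) (hw0 : 0 < w)
    {a b : ℝ} (ha : 0 < a) (hb : 0 < b) (K : ℝ) :
    ∀ᶠ α in 𝓝[>] (0 : ℝ), ∀ z T : ℝ, a ≤ z ^ 2 → z ^ 2 ≤ b →
      σ * σ₂ * T ≤ -Real.log α + K → -Real.log α - K ≤ σ * σ₂ * T →
      earlyTime W₂ W₁ ΔY σ σ₂ δ α z ≤ T ∧
      T ≤ earlyTime W₂ W₁ ΔY σ σ₂ δ α z + escapeDuration σ σ₂ δ α z := by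
  have hl : 0 < σ * σ₂ := mul_pos hσ hσ₂
  have hD : 0 < (1 - δ ^ 2) * σ ^ 2 / 4 := by
    have : 0 < 1 - δ ^ 2 := by nlinarith
    positivity
  set D := (1 - δ ^ 2) * σ ^ 2 / 4 with hDdef
  have hlog : Tendsto (fun α : ℝ => -Real.log α) (𝓝[>] 0) atTop :=
    tendsto_neg_atBot_atTop.comp Real.tendsto_log_nhdsGT_zero
  filter_upwards [self_mem_nhdsWithin,
    hlog.eventually_ge_atTop (2 * |K| + |Real.log (a * w)|),
    hlog.eventually_ge_atTop (Real.log (b * w)),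
    hlog.eventually_ge_atTop (|K| - Real.log (D / b)), hlog.eventually_ge_atTop |K|]
    with α hα h1 h2 h3 h4 z T hza hzb hT1 hT2
  have hα : 0 < α := hα
  have hz : 0 < z ^ 2 := ha.trans_le hza
  have hK := le_abs_self K
  have e1 : earlyTime W₂ W₁ ΔY σ σ₂ δ α z
      = 2 / (5 - δ) * (-Real.log α - Real.log (z ^ 2 * w)) / (σ * σ₂) := by
    rw [earlyTime, ← hw, one_div, Real.log_inv, mul_assoc α, Real.log_mul hα.ne' (by positivity)]
    have : 5 - δ ≠ 0 := by linarith
    field_simp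
    ring
  have h5 : 0 < 5 - δ := by linarith
  constructor
  · rw [e1, div_le_iff₀ hl]
    have m1 : Real.log (a * w) ≤ Real.log (z ^ 2 * w) := by
      apply Real.log_le_log (by positivity); gcongr
    have m2 := neg_abs_le (Real.log (a * w))
    have m3 : (2 / (5 - δ)) ≤ 1 / 2 := by rw [div_le_div_iff₀ h5 two_pos]; linarith
    have m4 : 0 ≤ -Real.log α + |Real.log (a * w)| := by
      linarith [abs_nonneg (Real.log (a * w)), abs_nonneg K]
    calc 2 / (5 - δ) * (-Real.log α - Real.log (z ^ 2 * w))
        ≤ 2 / (5 - δ) * (-Real.log α + |Real.log (a * w)|) := by gcongr; linarith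
      _ ≤ 1 / 2 * (-Real.log α + |Real.log (a * w)|) := by gcongr
      _ ≤ T * (σ * σ₂) := by linarith
  · have m1 : Real.log (z ^ 2 * w) ≤ Real.log (b * w) := by
      apply Real.log_le_log (by positivity); gcongr
    have m2 : 0 ≤ earlyTime W₂ W₁ ΔY σ σ₂ δ α z := by
      rw [e1]
      have : 0 ≤ -Real.log α - Real.log (z ^ 2 * w) := by linarith
      positivity
    have m3 : 2 * -Real.log α + Real.log (D / b)
        ≤ Real.log (1 + (1 - δ ^ 2) * σ ^ 2 / (4 * α ^ 2 * z ^ 2)) := by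
      have : 2 * -Real.log α + Real.log (D / b) = Real.log (D / b / α ^ 2) := by
        rw [Real.log_div (div_pos hD hb).ne' (pow_pos hα 2).ne', Real.log_pow]; push_cast; ring
      rw [this]
      refine Real.log_le_log (by positivity) ?_
      have : D / b / α ^ 2 ≤ D / z ^ 2 / α ^ 2 := by gcongr
      refine this.trans ?_
      have : D / z ^ 2 / α ^ 2 = (1 - δ ^ 2) * σ ^ 2 / (4 * α ^ 2 * z ^ 2) := by
        rw [hDdef]; field_simp
      rw [this]; linarith
    have m4 : T ≤ escapeDuration σ σ₂ δ α z := by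
      rw [escapeDuration, le_div_iff₀ (by positivity)]
      have : T * ((1 + δ) * σ * σ₂) = (1 + δ) * (σ * σ₂ * T) := by ring
      rw [this]
      have : -Real.log α + |K| ≤ Real.log (1 + (1 - δ ^ 2) * σ ^ 2 / (4 * α ^ 2 * z ^ 2)) := by
        linarith
      have h6 : 0 ≤ -Real.log α + |K| := by linarith [abs_nonneg K]
      nlinarith
    linarith

/-- The true error is of order α², so the spare power α^{2−e} absorbs the constant K/c.
`rpow_neg_le_div` does the same for the norm ratio. -/
theorem one_sub_rpow_le {α K c e y s : ℝ} (hα : 0 < α) (hc : 0 < c)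
    (hKe : K / c * α ^ (2 - e) < 1) (hs : c ≤ s) (h : s * (1 - y) ≤ K * α ^ 2) :
    1 - α ^ e ≤ y := by
  have e1 : α ^ 2 = α ^ (2 - e) * α ^ e := by
    rw [← Real.rpow_add hα, ← Real.rpow_two]; ring_nf
  have hp : 0 < α ^ e := Real.rpow_pos_of_pos hα _
  have h2 : K * α ^ 2 ≤ c * α ^ e := by
    have h3 := mul_le_mul_of_nonneg_left hKe.le (mul_pos hc hp).le
    have h4 : K * α ^ 2 = c * α ^ e * (K / c * α ^ (2 - e)) := by rw [e1]; field_simp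
    linarith
  by_contra! hlt
  have h3 : α ^ e < 1 - y := by linarith
  have h4 := mul_lt_mul_of_pos_left h3 hc
  have h5 := mul_le_mul_of_nonneg_right hs (hp.le.trans h3.le)
  linarith

theorem rpow_neg_le_div {α K c d e a b : ℝ} (hα : 0 < α) (hc : 0 < c)
    (hKe : K / c * α ^ (d - e) < 1) (ha : c ≤ a) (hb : 0 < b) (h : b ≤ K * α ^ d) :
    α ^ (-e) ≤ a / b := by
  have hp : 0 < α ^ (-e) := Real.rpow_pos_of_pos hα _
  rw [le_div_iff₀ hb]
  have h1 := mul_le_mul_of_nonneg_left h hp.le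
  have h2 : α ^ (-e) * (K * α ^ d) = c * (K / c * α ^ (d - e)) := by
    rw [show d - e = -e + d by ring, Real.rpow_add hα]; field_simp
  have h3 := mul_le_mul_of_nonneg_left hKe.le hc.le
  linarith

end Assembly

end

/-! ### The main theorem. -/

theorem claim2 {m h n r : ℕ} (hr : 0 < r)
    (W₂ : Matrix (Fin m) (Fin h) ℝ) (W₁ : Matrix (Fin h) (Fin n) ℝ)
    (Ypre Yft : Matrix (Fin m) (Fin n) ℝ) (hW : AlignedTask W₂ W₁ Ypre Yft)
    (u : Fin m → ℝ) (g : Fin h → ℝ) (v : Fin n → ℝ) (σ σ₁ σ₂ δ : ℝ)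
    (hσ : 0 < σ) (hΔ : Yft - Ypre = σ • Matrix.vecMulVec u v)
    (hW₁ : IsSingularTriple W₁ σ₁ g v) (hW₂ : IsSingularTriple W₂ σ₂ u g)
    (hσ₂ : 0 < σ₂) (hδ : δ = σ₁ / σ₂) (hδ1 : δ < 1) :
    ∃ c₄ > 0, ∃ c₅ > 0, ∀ η : ℝ, 0 < η →
      ∃ αstar > 0, ∃ S : Set ((Fin r → Fin n → ℝ) × (Fin r → Fin h → ℝ)),
        MeasurableSet S ∧ ENNReal.ofReal (1 - η) ≤ stdGaussianPair r n h S ∧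
        ∀ X ∈ S, ∀ α : ℝ, 0 < α → α ≤ αstar →
          ∀ θ : ℝ → LoRAWeights m h n r, IsGradientFlow W₂ W₁ Yft θ → θ 0 = loraInit m α X →
            ∃ T₁ : ℝ, IsAlignmentEnd θ g v σ σ₂ δ T₁ ∧
              earlyTime W₂ W₁ (Yft - Ypre) σ σ₂ δ α (zMax α (θ 0)) ≤ T₁ ∧
              T₁ ≤ earlyTime W₂ W₁ (Yft - Ypre) σ σ₂ δ α (zMax α (θ 0))
                    + escapeDuration σ σ₂ δ α (zMax α (θ 0)) ∧
              (∀ w : Fin h ⊕ Fin n → ℝ, IsTopLeftSingularVector (θ T₁).Z₁ w →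
                1 - c₄ * α ^ ((1 + δ) / (3 + δ)) ≤ cosSq w (Sum.elim g v)) ∧
              c₅ * α ^ (-(4 * (1 - δ) / (5 - δ))) ≤
                specNorm (θ T₁).Z₁ ^ 2 / specNorm (θ T₁).Z₂ ^ 2 := by
  open scoped Matrix.Norms.Frobenius in
  open Filter Topology in
  have hT := rankOneTask_of_isSingularTriple hW.1 hΔ hW₁ hW₂
  have hσ₁ : 0 ≤ σ₁ := hW₁.1
  have hg : g ⬝ᵥ g = 1 := hW₁.2.1
  have hv : v ⬝ᵥ v = 1 := hW₁.2.2.1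
  have hu : u ⬝ᵥ u = 1 := hW₂.2.1
  have hv0 : v ≠ 0 := by rintro rfl; simp at hv
  have hu0 : u ≠ 0 := by rintro rfl; simp at hu
  have hh : 0 < h := by
    rcases Nat.eq_zero_or_pos h with rfl | hh
    · simp [dotProduct] at hg
    · exact hh
  have hδ0 : 0 ≤ δ := hδ ▸ div_nonneg hσ₁ hσ₂.le
  have hl : 0 < σ * σ₂ := mul_pos hσ hσ₂
  have hlδ : σ * σ₂ * δ = σ * σ₁ := by rw [hδ]; field_simp
  set c := (1 - δ) * σ / (4 * σ₂) with hc
  have hc0 : 0 < c := by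
    have : 0 < 1 - δ := by linarith
    positivity
  have hσc : σ₂ * c ≤ σ / 4 := by
    have : σ₂ * c = (1 - δ) * σ / 4 := by rw [hc]; field_simp
    rw [this]; nlinarith
  obtain ⟨C, hC, s, hs0, hs1, hrates⟩ :=
    LoRAWeights.rates_bounds (r := r) hT hσ hσ₁ hσ₂ hσc
  -- Both constants can be 1, independently of η: the dependence of K on the event is hidden in
  -- `αstar` through the spare powers of α.
  refine ⟨1, one_pos, 1, one_pos, fun η hη => ?_⟩
  obtain ⟨k, hk0, hk⟩ := exists_goodInit (h := h) hr hh hv0 hη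
  have hk0' : (0 : ℝ) < k := by exact_mod_cast hk0
  -- As B₁ vanishes initially, the signal starts at ½‖X₁v‖²α², and the total squared size is (‖X₁‖²
  -- + ‖X₂‖²)α² ≤ 2kα².
  obtain ⟨K, hK, hesc⟩ := SaddleSystem.escape (s := s) (ρ := 1 / 2 * (1 / ((k : ℝ) + 1)))
    (R := 2 * k) hC hl hδ0 hδ1 hc0 hs0 hs1 (by positivity) (by positivity)
  have hY0 : Yft - Ypre ≠ 0 := by
    rw [hΔ]
    obtain ⟨i, hi⟩ := Function.ne_iff.1 hu0
    obtain ⟨j, hj⟩ := Function.ne_iff.1 hv0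
    exact fun hz => mul_ne_zero hσ.ne' (mul_ne_zero hi hj) (congrFun₂ hz i j)
  have hw0 : 0 < specNorm (Yft - Ypre) + specNorm W₁ ^ 2 + specNorm W₁ * specNorm W₂
      + specNorm W₂ ^ 2 + Real.sqrt (specNorm W₁ + specNorm W₂) := by
    have := specNorm_pos hY0
    have := specNorm_nonneg W₁
    have := specNorm_nonneg W₂
    positivity
  have htime := earlyTime_le_of_log_le hσ hσ₂ hδ0 hδ1 rfl hw0
    (a := 1 / ((k : ℝ) + 1)) (b := k) (by positivity) hk0' K
  have he₁ : 0 < 2 - (1 + δ) / (3 + δ) := by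
    have : (1 + δ) / (3 + δ) < 1 := by rw [div_lt_one (by linarith)]; linarith
    linarith
  -- The dynamics give the exponent 2(1 − δ), which beats 4(1 − δ)/(5 − δ) because 2 < 5 − δ.
  have he₂ : 0 < (2 - 2 * δ) - 4 * (1 - δ) / (5 - δ) := by
    have h5 : 0 < 5 - δ := by linarith
    have : 4 * (1 - δ) / (5 - δ) < 2 - 2 * δ := by
      rw [div_lt_iff₀ h5]; nlinarith
    linarith
  have hall := hesc.and (htime.and ((eventually_const_mul_rpow_lt he₁ (K / (2 * c)) one_pos).and
    (eventually_const_mul_rpow_lt he₂ (K / (2 * c)) one_pos)))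
  obtain ⟨αstar, hαstar, hsub⟩ := mem_nhdsGT_iff_exists_Ioc_subset.1 hall
  refine ⟨αstar, hαstar, goodInit v k, measurableSet_goodInit v k, hk, ?_⟩
  intro X hX α hα hαle θ hθ h0
  obtain ⟨hesc, htime, hcos, himb⟩ := hsub ⟨hα, hαle⟩
  have hsys := hθ.saddleSystem hT hlδ hrates
  obtain ⟨T, hleast, hTu, hTl, hQ, hP, hF⟩ := hesc _ _ _ _ _ _ _ hsys
    (by
      simp only [h0]
      rw [signal_loraInit]
      gcongr
      exact hX.2.2.1)
    (by
      simp only [h0]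
      rw [← LoRAWeights.totalNorm_sq_eq hT, LoRAWeights.totalNorm_sq]
      simp only [loraInit, norm_smul, mul_pow, norm_zero, Real.norm_eq_abs, sq_abs, norm_of_sq]
      nlinarith [hX.1, hX.2.1, sq_nonneg α])
  have hT0 : 0 ≤ T := hleast.1.1
  obtain ⟨hz1, hz2⟩ := zMax_sq_bounds (m := m) hα hv hX
  obtain ⟨ht1, ht2⟩ := htime (zMax α (θ 0)) T (by rw [h0]; exact hz1) (by rw [h0]; exact hz2)
    hTu hTl
  have hs₁ := hF.trans (LoRAWeights.signal_le_specNorm_sq hg hv (θ T))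
  refine ⟨T, ?_, ht1, ht2, fun w hw => ?_, ?_⟩
  · simpa only [IsAlignmentEnd, ← matInner_replicateCol] using hleast
  · have h1 := (LoRAWeights.one_sub_cosSq_le hg hv (θ T) hw).trans
      ((le_add_of_nonneg_right (LoRAWeights.offAxis₂_nonneg (Matrix.replicateCol Unit u)
        (Matrix.replicateCol Unit g) (θ T))).trans hQ)
    rw [one_mul]
    exact one_sub_rpow_le hα (mul_pos two_pos hc0) hcos hs₁ h1
  -- The quotient bound needs Z₂ ≠ 0: the conserved difference ‖A₂‖² − ‖B₂‖² starts at α²‖X₂‖² > 0.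
  · have hX2 : 0 < ‖(θ T).A₂‖ ^ 2 := by
      have h1 := hθ.norm_A₂_sq_sub hT0
      have h2 : 0 < ‖(θ 0).A₂‖ ^ 2 - ‖(θ 0).B₂‖ ^ 2 := by
        rw [h0]
        simp only [loraInit, norm_smul, mul_pow, norm_zero, Real.norm_eq_abs, sq_abs, norm_of_sq]
        have := hX.2.2.2
        have : 0 < α ^ 2 * ∑ i, ∑ j, X.2 i j ^ 2 := by positivity
        linarith
      linarith [sq_nonneg ‖(θ T).B₂‖]
    have hZ₂ := LoRAWeights.norm_Z₂_sq (θ T)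
    have hs₂ : 0 < specNorm (θ T).Z₂ := by
      refine specNorm_pos fun hz => ?_
      rw [hz, norm_zero] at hZ₂
      linarith [sq_nonneg ‖(θ T).B₂‖]
    have hle : specNorm (θ T).Z₂ ^ 2 ≤ K * α ^ (2 - 2 * δ) := by
      refine (pow_le_pow_left₀ hs₂.le (specNorm_le_norm _) 2).trans (le_trans ?_ hP)
      rw [hZ₂]
      exact le_add_of_nonneg_right (LoRAWeights.offAxis₁_nonneg _ _ _)
    rw [one_mul]
    exact rpow_neg_le_div hα (mul_pos two_pos hc0) himb hs₁ (pow_pos hs₂ 2) hle
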